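/- Let $M$ be a smooth 7-manifold with a Riemannian metric $g$, and let $\varphi$ be a $G_2$-structure on $M$ compatible with $g$: a smooth 3-form which at each point equals $e^{123}+e^{145}+e^{167}+e^{246}-e^{257}-e^{347}-e^{356}$ in some $g$-orthonormal coframe. Let $G$ be a smooth 4-form, $\Delta$ a smooth real function, $\lambda_1,\lambda_2,\mu$ real constants, and $\lambda=\lambda_1+i\lambda_2$. *Notation.* $\nabla$ is the Levi-Civita connection of $g$, $\partial\Delta$ the gradient of $\Delta$, and $\ast$ the Hodge star for the orientation in which the coframes above are positive. A ($g$-compatible) $G_2$-structure $\phi$ with $\psi=\ast\phi$ has the cross product $\langle u\times v,w\rangle=\phi(u,v,w)$ and makes $\mathbb{O}M=\Lambda^0\oplus TM$ an octonion bundle by $(a,\alpha)(b,\beta)=(ab-\langle\alpha,\beta\rangle,\ a\beta+b\alpha+\alpha\times\beta)$, with $\overline{(a,\alpha)}=(a,-\alpha)$, $|(a,\alpha)|^2=a^2+|\alpha|^2$, $A^{-1}=\bar A/|A|^2$ and $[A,B,C]=A(BC)-(AB)C$. For a vector $u$ put $\hat u=\delta(u)=(0,u)$ and $\delta_a=\delta(e_a)$.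 The torsion $T$ of $\phi$ is defined by $T_a{}^m=\frac1{48}(\nabla_a\phi_{bcd})\psi^{mbcd}$, i.e. $\nabla_a\phi_{bcd}=2T_a{}^m\psi_{mbcd}$; it is also regarded as the 1-form $T_a=(0,T_a{}^m)$ with values in imaginary octonions, and $T^t$ is its transpose. Its components are given by $T=\tau_1g+\tau_7\lrcorner\phi+\tau_{14}+\tau_{27}$, where $\tau_{14}$ is skew with $(\tau_{14})^{ab}\phi_{abc}=0$, $\tau_{27}$ is symmetric and traceless, and $(\tau_7\lrcorner\phi)_{ab}=\tau_7^c\phi_{cab}$; $\tau_7$ is identified with a vector and $\tau_{14}$ with an imaginary-octonion-valued 1-form. For a nowhere-vanishing octonion section $A=(a,\alpha)$, $$\varphi_A=\sigma_A(\varphi)=|A|^{-2}\big((a^2-|\alpha|^2)\varphi-2a\,\alpha\lrcorner{\ast\varphi}+2\,\alpha\wedge(\alpha\lrcorner\varphi)\big),\qquad \psi_A=\ast\varphi_A,$$ which is again a $G_2$-structure compatible with $g$; its torsion is $T^{(A)}$, with components $\tau_j^{(A)}$. Complexified octonions are written $Z=X+iY$, with $Z^*=X-iY$, and $D_aZ=\nabla_aZ-ZT_a$,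 where $T$ is the torsion of $\varphi$. *Equations.* With the octonion product of $\varphi$, the octonionic Killing equations are $$0=\lambda e^{-\Delta}Z^*+i\big(\mu e^{-4\Delta}+\tfrac12\widehat{\partial\Delta}\big)Z+\tfrac1{144}G_{bcde}\,\delta^b(\delta^c(\delta^d(\delta^eZ))),$$ $$D_aZ=-\tfrac12\mu e^{-4\Delta}\delta_aZ-\tfrac{i}{144}G_{bcde}\,\delta_a(\delta^b(\delta^c(\delta^d(\delta^eZ))))-\tfrac{i}{12}G_{abcd}\,\delta^b(\delta^c(\delta^dZ)).\qquad(\mathrm K)$$ *Conditions.* For smooth nowhere-vanishing sections $X,Y$ of $\mathbb OM$ put $W=(w_0,w)=YX^{-1}$ (product of $\varphi$); in (2)–(4) all octonion products are those of $\varphi_X$, and $w$ also denotes the dual 1-form. 1. $2w_0\lambda_1-\lambda_2(1-|W|^2)=\mu e^{-3\Delta}(1+|W|^2)$, $\ dw_0=-\frac32(1+|W|^2)w_0\,d\Delta-4(w_0\lambda_1-\lambda_2)e^{-\Delta}w$, and $\ \dfrac{d|W|^2}{1+|W|^2}=\frac32(1-|W|^2)\,d\Delta-4\lambda_1e^{-\Delta}w$.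 2. Write $G=Q_0\psi_X+Q_1^\flat\wedge\varphi_X+4\iota_{\psi_X}(Q_2)$ with $Q_2$ symmetric and traceless and $\iota_\psi(h)_{abcd}=h_{[a}{}^m\psi_{|m|bcd]}$. Then $$Q_2(w)=w_0Q_1-\tfrac14(Q_0-6\lambda_1e^{-\Delta})w-\tfrac34\partial\Delta,$$ $$\big(\tfrac73Q_0,\tfrac43Q_1\big)=\big(2e^{-\Delta}(\lambda_2-\mu e^{-3\Delta}),-\partial\Delta\big)W+2\lambda_1e^{-\Delta}.$$ 3. $\displaystyle (T^{(X)})^t=\hat Q\bar W+\tfrac14\delta(\widehat{\partial\Delta})+\big(\lambda_1e^{-\Delta}w-\tfrac12d\Delta,\ -\tfrac12\lambda_2e^{-\Delta}\delta\big)$, where $\hat Q=\big(Q_1,\ -\tfrac14(Q_0-2\lambda_1e^{-\Delta})\delta-Q_2\big)$ and $\delta(\widehat{\partial\Delta})$ is the product $\delta_a\widehat{\partial\Delta}$. 4. The torsion components satisfy $$\tau_1^{(X)}+|W|^2\tau_1^{(Y)}=\tfrac12\mu e^{-4\Delta}(1+|W|^2),\qquad \tau_7^{(X)}+|W|^2\tau_7^{(Y)}=\tfrac12(1+|W|^2)\,\partial\Delta,$$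 $$\tau_{14}^{(X)}-|W|^2\tau_{14}^{(Y)}=-\tfrac18(|W|^2+1)\,[\delta,\widehat{\partial\Delta},W]W^{-1},\qquad \tau_{27}^{(X)}+|W|^2\tau_{27}^{(Y)}=0.$$ **Theorem.** There exist smooth nowhere-vanishing $X,Y$ such that $Z=X+iY$ solves (K) if and only if there exist smooth nowhere-vanishing $X,Y$ for which (1)–(4) hold. More precisely, for given smooth nowhere-vanishing $X,Y$, the section $Z=X+iY$ solves (K) if and only if (1)–(4) hold and $d\big(e^{-\Delta}(|X|^2+|Y|^2)\big)=0$. -/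

import Mathlib

open scoped Manifold ContDiff Bundle

noncomputable section

namespace OctKilling

/-! ### Algebra in one tangent space -/

/-- The components `(e^{abc})_{ijk}` of the decomposable 3-form `e^a ∧ e^b ∧ e^c` on `ℝ⁷`. -/
def elem3 (a b c i j k : Fin 7) : ℝ :=
  Matrix.det (Matrix.of fun r s : Fin 3 => if ![a, b, c] r = ![i, j, k] s then (1 : ℝ) else 0)

/-- The components of the standard 3-form
`e^{123} + e^{145} + e^{167} + e^{246} - e^{257} - e^{347} - e^{356}` (indices shifted to `0,…,6`),
whose stabilizer in `GL(7, ℝ)` is `G₂`. -/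
def phi0 (i j k : Fin 7) : ℝ :=
  elem3 0 1 2 i j k + elem3 0 3 4 i j k + elem3 0 5 6 i j k + elem3 1 3 5 i j k
    - elem3 1 4 6 i j k - elem3 2 3 6 i j k - elem3 2 4 5 i j k

/-- Octonions modelled on `V`: a real part and an imaginary part in `V`. -/
abbrev Oct (V : Type*) := ℝ × V

/-- Complexified octonions `Z = X + i Y`, stored as the pair `(X, Y)` of the `ℂ`-real and the
`ℂ`-imaginary part. -/
abbrev COct (V : Type*) := Oct V × Oct V

/-- Everything needed to compute at one point: a scalar product, a positively oriented orthonormal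
frame (used to contract and raise indices and for the orientation), and a 3-form. -/
structure G2Point (V : Type*) where
  ip : V → V → ℝ
  e : Fin 7 → V
  ph : V → V → V → ℝ

section Pointwise

variable {V : Type*} [AddCommGroup V] [Module ℝ V]

/-- Imaginary octonion of a vector. -/
def delta (u : V) : Oct V := (0, u)

/-- Octonion conjugation. -/
def oconj (A : Oct V) : Oct V := (A.1, -A.2)

namespace G2Point

variable (S : G2Point V)

/-- The vector dual to a covector. -/
def sharp (l : V → ℝ) : V := ∑ i, l (S.e i) • S.e i

/-- The volume form for which the frame is positive. -/
def vol (v : Fin 7 → V) : ℝ := Matrix.det (Matrix.of fun a b => S.ip (S.e a) (v b))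

/-- The Hodge dual of a 3-form: `(⋆η)_{abcd} = (1/6) η^{ijk} vol_{ijkabcd}`. -/
def star3 (η : V → V → V → ℝ) (a b c d : V) : ℝ :=
  (1 / 6) * ∑ i, ∑ j, ∑ k,
    η (S.e i) (S.e j) (S.e k) * S.vol ![S.e i, S.e j, S.e k, a, b, c, d]

/-- The 4-form `ψ = ⋆φ`. -/
def psi : V → V → V → V → ℝ := S.star3 S.ph

/-- The cross product: `⟨u × v, w⟩ = φ(u, v, w)`. -/
def cross (u v : V) : V := S.sharp fun w => S.ph u v w

/-- The octonion product determined by `φ`. -/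
def mul (A B : Oct V) : Oct V :=
  (A.1 * B.1 - S.ip A.2 B.2, A.1 • B.2 + B.1 • A.2 + S.cross A.2 B.2)

/-- `|A|²`. -/
def normSq (A : Oct V) : ℝ := A.1 ^ 2 + S.ip A.2 A.2

/-- The inverse `Ā / |A|²`. -/
def inv (A : Oct V) : Oct V := (S.normSq A)⁻¹ • oconj A

/-- The associator `[A, B, C] = A(BC) - (AB)C`. -/
def assoc (A B C : Oct V) : Oct V := S.mul A (S.mul B C) - S.mul (S.mul A B) C

/-- `σ_A(φ) = |A|⁻² ((a² - |α|²) φ - 2 a α ⌟ ⋆φ + 2 α ∧ (α ⌟ φ))` for `A = (a, α)`. -/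
def sigma (A : Oct V) (u v w : V) : ℝ :=
  (S.normSq A)⁻¹ *
    ((A.1 ^ 2 - S.ip A.2 A.2) * S.ph u v w - 2 * A.1 * S.psi A.2 u v w
      + 2 * (S.ip A.2 u * S.ph A.2 v w - S.ip A.2 v * S.ph A.2 u w + S.ip A.2 w * S.ph A.2 u v))

/-- The change of gauge: `φ` is replaced by `φ_A = σ_A(φ)`, and the metric and the orientation are
kept. -/
def gauge (A : Oct V) : G2Point V where
  ip := S.ip
  e := S.e
  ph := S.sigma A

/-- `q♭ ∧ φ` for a vector `q`. -/
def wedgePhi (q a b c d : V) : ℝ :=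
  S.ip q a * S.ph b c d - S.ip q b * S.ph a c d + S.ip q c * S.ph a b d - S.ip q d * S.ph a b c

/-- `ι_ψ(h)_{abcd} = h_{[a}^m ψ_{|m|bcd]}`, for a symmetric 2-tensor `h` seen as an endomorphism. -/
def iotaPsi (h : V →ₗ[ℝ] V) (a b c d : V) : ℝ :=
  (1 / 4) * (S.psi (h a) b c d + S.psi a (h b) c d + S.psi a b (h c) d + S.psi a b c (h d))

/-- `Q₀, Q₁, Q₂` are the components of the 4-form `G` in the representations `1, 7, 27`:
`Q₂` is symmetric and traceless and `G = Q₀ ψ + Q₁♭ ∧ φ + 4 ι_ψ(Q₂)`. -/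
structure IsFourFormDecomp (G : V → V → V → V → ℝ) (Q0 : ℝ) (Q1 : V) (Q2 : V →ₗ[ℝ] V) :
    Prop where
  symm : ∀ u v, S.ip (Q2 u) v = S.ip u (Q2 v)
  traceless : ∑ i, S.ip (Q2 (S.e i)) (S.e i) = 0
  eq : ∀ a b c d, G a b c d = Q0 * S.psi a b c d + S.wedgePhi Q1 a b c d + 4 * S.iotaPsi Q2 a b c d

/-- `τ₁, τ₇, τ₁₄, τ₂₇` are the components of the 2-tensor `T` in the representations
`1, 7, 14, 27`: `T = τ₁ g + τ₇ ⌟ φ + τ₁₄ + τ₂₇` with `τ₁₄ ∈ Λ²₁₄` (skew, and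
`τ₁₄ ^{ab} φ_{abc} = 0`) and `τ₂₇` symmetric and traceless. -/
structure IsTorsionDecomp (T : V → V → ℝ) (τ1 : ℝ) (τ7 : V) (τ14 τ27 : V →ₗ[ℝ] V →ₗ[ℝ] ℝ) :
    Prop where
  eq : ∀ u v, T u v = τ1 * S.ip u v + S.ph τ7 u v + τ14 u v + τ27 u v
  skew14 : ∀ u v, τ14 u v = -τ14 v u
  phi14 : ∀ w, ∑ a, ∑ b, τ14 (S.e a) (S.e b) * S.ph (S.e a) (S.e b) w = 0
  symm27 : ∀ u v, τ27 u v = τ27 v u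
  trace27 : ∑ i, τ27 (S.e i) (S.e i) = 0

/-- Left multiplication of a complexified octonion by an octonion. -/
def lmul (A : Oct V) (Z : COct V) : COct V := (S.mul A Z.1, S.mul A Z.2)

/-- Right multiplication of a complexified octonion by an octonion. -/
def rmul (Z : COct V) (A : Oct V) : COct V := (S.mul Z.1 A, S.mul Z.2 A)

/-- `G_{bcde} δ^b(δ^c(δ^d(δ^e Z)))`. -/
def cliff4 (G : V → V → V → V → ℝ) (Z : COct V) : COct V :=
  ∑ i, ∑ j, ∑ k, ∑ l, G (S.e i) (S.e j) (S.e k) (S.e l) •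
    S.lmul (delta (S.e i)) (S.lmul (delta (S.e j)) (S.lmul (delta (S.e k))
      (S.lmul (delta (S.e l)) Z)))

/-- `u^a G_{abcd} δ^b(δ^c(δ^d Z))`. -/
def cliff3 (G : V → V → V → V → ℝ) (u : V) (Z : COct V) : COct V :=
  ∑ i, ∑ j, ∑ k, G u (S.e i) (S.e j) (S.e k) •
    S.lmul (delta (S.e i)) (S.lmul (delta (S.e j)) (S.lmul (delta (S.e k)) Z))

end G2Point

/-- Multiplication by a complex number, `(a + i b)(X + i Y)`. -/
def csmul (c : ℂ) (Z : COct V) : COct V :=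
  (c.re • Z.1 - c.im • Z.2, c.re • Z.2 + c.im • Z.1)

/-- Complex conjugation `Z* = X - i Y`. -/
def cstar (Z : COct V) : COct V := (Z.1, -Z.2)

end Pointwise

/-! ### Tensor fields on a 7-manifold -/

abbrev E7 := EuclideanSpace ℝ (Fin 7)

variable {M : Type*} [TopologicalSpace M] [ChartedSpace E7 M] [IsManifold (𝓡 7) ∞ M]

variable (M) in
/-- Smooth Riemannian metrics on `M`. -/
abbrev Metric7 :=
  Bundle.ContMDiffRiemannianMetric (𝓡 7) ∞ E7 (fun x : M => TangentSpace (𝓡 7) x)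

variable (M) in
/-- Fields of alternating `k`-forms on `M`. -/
abbrev FormField (k : ℕ) := ∀ p : M, (TangentSpace (𝓡 7) p) [⋀^Fin k]→ₗ[ℝ] ℝ

variable (M) in
/-- Sections of the octonion bundle `Λ⁰ ⊕ TM`. -/
abbrev OctField := ∀ p : M, Oct (TangentSpace (𝓡 7) p)

/-- The vector field near `p`, with constant components in the chart at `p`, whose value at `p`
is `v`. -/
def coordField {p : M} (v : TangentSpace (𝓡 7) p) (q : M) : TangentSpace (𝓡 7) q :=
  FiberBundle.extend E7 v q

/-- Smoothness of a form field: its components in the charts are smooth. -/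
def SmoothForm {k : ℕ} (η : FormField M k) : Prop :=
  ∀ (p : M) (a : Fin k → TangentSpace (𝓡 7) p),
    ContMDiffOn (𝓡 7) 𝓘(ℝ) ∞ (fun q => η q fun i => coordField (a i) q) (chartAt E7 p).source

/-- Smoothness of an octonion section. -/
def SmoothOct (A : OctField M) : Prop :=
  ContMDiff (𝓡 7) 𝓘(ℝ) ∞ (fun p => (A p).1) ∧
    ContMDiff (𝓡 7) (𝓡 7).tangent ∞ fun p => (⟨p, (A p).2⟩ : TangentBundle (𝓡 7) M)

/-- `e` is a `g`-orthonormal frame of `T_pM` in which `φ` is the standard 3-form. -/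
def IsAdaptedFrame (g : Metric7 M) (φ : FormField M 3) (p : M)
    (e : Fin 7 → TangentSpace (𝓡 7) p) : Prop :=
  (∀ i j, g.inner p (e i) (e j) = if i = j then 1 else 0) ∧
    ∀ i j k, φ p ![e i, e j, e k] = phi0 i j k

/-- `φ` is a `G₂`-structure whose associated metric is `g`: a smooth 3-form which at every point
is standard in some `g`-orthonormal frame. -/
def IsG2Structure (g : Metric7 M) (φ : FormField M 3) : Prop :=
  SmoothForm φ ∧ ∀ p, ∃ e, IsAdaptedFrame g φ p e

/-- A chosen adapted frame. Nothing below depends on the choice: two adapted frames differ by an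
element of `G₂ ⊂ SO(7)`. -/
def adaptedFrame (g : Metric7 M) (φ : FormField M 3) (p : M) : Fin 7 → TangentSpace (𝓡 7) p :=
  Classical.epsilon (IsAdaptedFrame g φ p)

/-- The metric, the orientation and the 3-form of a `G₂`-structure, at each point. -/
def g2 (g : Metric7 M) (φ : FormField M 3) (p : M) : G2Point (TangentSpace (𝓡 7) p) where
  ip u v := g.inner p u v
  e := adaptedFrame g φ p
  ph u v w := φ p ![u, v, w]

/-- The `G₂`-structure `φ_X = σ_X(φ)`. -/
def g2gauge (g : Metric7 M) (φ : FormField M 3) (X : OctField M) (p : M) :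
    G2Point (TangentSpace (𝓡 7) p) :=
  (g2 g φ p).gauge (X p)

/-- The Levi-Civita derivative `∇_u ∂_v` at `p` of a coordinate field of the chart at `p`, from
`2 g(∇_u ∂_v, ∂_m) = ∂_u g(∂_v, ∂_m) + ∂_v g(∂_u, ∂_m) - ∂_m g(∂_u, ∂_v)`; the index `m` is raised
with a `g`-orthonormal frame `e`. -/
def christoffel (g : Metric7 M) {p : M} (e : Fin 7 → TangentSpace (𝓡 7) p)
    (u v : TangentSpace (𝓡 7) p) : TangentSpace (𝓡 7) p :=
  ∑ m, ((1 / 2 : ℝ) *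
      (mvfderiv (𝓡 7) (fun q => g.inner q (coordField v q) (coordField (e m) q)) p u
        + mvfderiv (𝓡 7) (fun q => g.inner q (coordField u q) (coordField (e m) q)) p v
        - mvfderiv (𝓡 7) (fun q => g.inner q (coordField u q) (coordField v q)) p (e m))) • e m

/-- The Levi-Civita derivative `∇_u V` of a vector field `V`: the derivative of the components of
`V` in the chart at `p`, corrected by the Christoffel symbols. -/
def nablaVec (g : Metric7 M) {p : M} (e : Fin 7 → TangentSpace (𝓡 7) p)
    (V : ∀ q : M, TangentSpace (𝓡 7) q) (u : TangentSpace (𝓡 7) p) : TangentSpace (𝓡 7) p :=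
  (trivializationAt E7 (fun q : M => TangentSpace (𝓡 7) q) p).symm p
      (mvfderiv (𝓡 7)
        (fun q => (trivializationAt E7 (fun q : M => TangentSpace (𝓡 7) q) p ⟨q, V q⟩).2) p u)
    + christoffel g e u (V p)

/-- The Levi-Civita derivative `(∇_u η)(a, b, c)` of a field of trilinear forms. -/
def nabla3 (g : Metric7 M) {p : M} (e : Fin 7 → TangentSpace (𝓡 7) p)
    (η : ∀ q : M, TangentSpace (𝓡 7) q → TangentSpace (𝓡 7) q → TangentSpace (𝓡 7) q → ℝ)
    (u a b c : TangentSpace (𝓡 7) p) : ℝ :=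
  mvfderiv (𝓡 7) (fun q => η q (coordField a q) (coordField b q) (coordField c q)) p u
    - η p (christoffel g e u a) b c - η p a (christoffel g e u b) c
    - η p a b (christoffel g e u c)

/-- The full torsion tensor `T_{am} = (1/48) (∇_a φ_{bcd}) ψ_m^{bcd}` of a `G₂`-structure, that is,
`∇_a φ_{bcd} = 2 T_a^m ψ_{mbcd}`. -/
def torsion (g : Metric7 M) (S : ∀ q : M, G2Point (TangentSpace (𝓡 7) q)) (p : M)
    (u w : TangentSpace (𝓡 7) p) : ℝ :=
  (1 / 48) * ∑ i, ∑ j, ∑ k,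
    nabla3 g (S p).e (fun q => (S q).ph) u ((S p).e i) ((S p).e j) ((S p).e k)
      * (S p).psi w ((S p).e i) ((S p).e j) ((S p).e k)

/-- The imaginary octonion `T_u`. -/
def torsionOct (g : Metric7 M) (S : ∀ q : M, G2Point (TangentSpace (𝓡 7) q)) (p : M)
    (u : TangentSpace (𝓡 7) p) : Oct (TangentSpace (𝓡 7) p) :=
  delta ((S p).sharp fun w => torsion g S p u w)

/-- The imaginary octonion `(T^t)_u`. -/
def torsionTransposeOct (g : Metric7 M) (S : ∀ q : M, G2Point (TangentSpace (𝓡 7) q)) (p : M)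
    (u : TangentSpace (𝓡 7) p) : Oct (TangentSpace (𝓡 7) p) :=
  delta ((S p).sharp fun w => torsion g S p w u)

/-- The gradient. -/
def grad (S : ∀ q : M, G2Point (TangentSpace (𝓡 7) q)) (f : M → ℝ) (p : M) :
    TangentSpace (𝓡 7) p :=
  (S p).sharp fun u => mvfderiv (𝓡 7) f p u

/-- The octonion covariant derivative `D_u A = ∇_u A - A T_u`. -/
def octD (g : Metric7 M) (S : ∀ q : M, G2Point (TangentSpace (𝓡 7) q)) (A : OctField M) (p : M)
    (u : TangentSpace (𝓡 7) p) : Oct (TangentSpace (𝓡 7) p) :=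
  (mvfderiv (𝓡 7) (fun q => (A q).1) p u, nablaVec g (S p).e (fun q => (A q).2) u)
    - (S p).mul (A p) (torsionOct g S p u)

/-- The 4-form at `p` as a function of four vectors. -/
def form4 (G : FormField M 4) (p : M) (a b c d : TangentSpace (𝓡 7) p) : ℝ := G p ![a, b, c, d]

/-- The octonionic Killing equations for `Z = X + i Y`. -/
def IsKilling (g : Metric7 M) (φ : FormField M 3) (G : FormField M 4) (Δ : M → ℝ)
    (lam : ℂ) (μ : ℝ) (X Y : OctField M) : Prop :=
  ∀ p : M,
    let S := g2 g φ
    let Z : COct (TangentSpace (𝓡 7) p) := (X p, Y p)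
    (0 = csmul (lam * (Real.exp (-Δ p) : ℂ)) (cstar Z)
        + csmul Complex.I
            ((S p).lmul (μ * Real.exp (-4 * Δ p), (1 / 2 : ℝ) • grad S Δ p) Z)
        + (1 / 144 : ℝ) • (S p).cliff4 (form4 G p) Z) ∧
    ∀ u : TangentSpace (𝓡 7) p,
      ((octD g S X p u, octD g S Y p u) : COct (TangentSpace (𝓡 7) p)) =
        -(((1 / 2 : ℝ) * μ * Real.exp (-4 * Δ p)) • (S p).lmul (delta u) Z)
        - csmul (Complex.I / 144) ((S p).lmul (delta u) ((S p).cliff4 (form4 G p) Z))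
        - csmul (Complex.I / 12) ((S p).cliff3 (form4 G p) u Z)

/-- `W = Y X⁻¹`, with the product of `φ`. -/
def quot (g : Metric7 M) (φ : FormField M 3) (X Y : OctField M) : OctField M :=
  fun p => (g2 g φ p).mul (Y p) ((g2 g φ p).inv (X p))

/-- Condition (1): the equations for `w₀` and `|W|²`. -/
def Cond1 (g : Metric7 M) (φ : FormField M 3) (Δ : M → ℝ) (l1 l2 μ : ℝ) (X Y : OctField M) :
    Prop :=
  ∀ p : M,
    let S := g2 g φ
    let W := quot g φ X Y
    let w0 : M → ℝ := fun q => (W q).1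
    let W2 : M → ℝ := fun q => (S q).normSq (W q)
    (2 * w0 p * l1 - l2 * (1 - W2 p) = μ * Real.exp (-3 * Δ p) * (1 + W2 p)) ∧
    (∀ u : TangentSpace (𝓡 7) p,
      mvfderiv (𝓡 7) w0 p u =
        -(3 / 2) * (1 + W2 p) * w0 p * mvfderiv (𝓡 7) Δ p u
          - 4 * (w0 p * l1 - l2) * Real.exp (-Δ p) * (S p).ip (W p).2 u) ∧
    (∀ u : TangentSpace (𝓡 7) p,
      mvfderiv (𝓡 7) W2 p u / (1 + W2 p) =
        (3 / 2) * (1 - W2 p) * mvfderiv (𝓡 7) Δ p u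
          - 4 * l1 * Real.exp (-Δ p) * (S p).ip (W p).2 u)

/-- Conditions (2) and (3): the relations satisfied by the components `Q₀, Q₁, Q₂` of `G` with
respect to `φ_X`, and the expression for the torsion of `φ_X`. All products are those of `φ_X`. -/
def Cond23 (g : Metric7 M) (φ : FormField M 3) (G : FormField M 4) (Δ : M → ℝ) (l1 l2 μ : ℝ)
    (X Y : OctField M) : Prop :=
  ∀ p : M,
    let SX := g2gauge g φ X
    let W := quot g φ X Y p
    let dΔ := grad SX Δ p
    ∃ (Q0 : ℝ) (Q1 : TangentSpace (𝓡 7) p)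
      (Q2 : TangentSpace (𝓡 7) p →ₗ[ℝ] TangentSpace (𝓡 7) p),
      (SX p).IsFourFormDecomp (form4 G p) Q0 Q1 Q2 ∧
      (Q2 W.2 = W.1 • Q1 - ((1 / 4) * (Q0 - 6 * l1 * Real.exp (-Δ p))) • W.2
        - (3 / 4 : ℝ) • dΔ) ∧
      ((((7 / 3) * Q0, (4 / 3 : ℝ) • Q1) : Oct (TangentSpace (𝓡 7) p)) =
        (SX p).mul (2 * Real.exp (-Δ p) * (l2 - μ * Real.exp (-3 * Δ p)), -dΔ) W
          + (2 * l1 * Real.exp (-Δ p), 0)) ∧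
      ∀ u : TangentSpace (𝓡 7) p,
        torsionTransposeOct g SX p u =
          (SX p).mul
              ((SX p).ip Q1 u, -((1 / 4) * (Q0 - 2 * l1 * Real.exp (-Δ p))) • u - Q2 u)
              (oconj W)
            + (1 / 4 : ℝ) • (SX p).mul (delta u) (delta dΔ)
            + (l1 * Real.exp (-Δ p) * (SX p).ip W.2 u - (1 / 2) * mvfderiv (𝓡 7) Δ p u,
                -((1 / 2) * l2 * Real.exp (-Δ p)) • u)

/-- Condition (4): the relations between the torsion components of `φ_X` and of `φ_Y`. The
associator and the product are those of `φ_X`. -/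
def Cond4 (g : Metric7 M) (φ : FormField M 3) (Δ : M → ℝ) (μ : ℝ) (X Y : OctField M) : Prop :=
  ∀ p : M,
    let SX := g2gauge g φ X
    let SY := g2gauge g φ Y
    let W := quot g φ X Y p
    let W2 := (SX p).normSq W
    let dΔ := grad SX Δ p
    ∃ (x1 y1 : ℝ) (x7 y7 : TangentSpace (𝓡 7) p)
      (x14 x27 y14 y27 : TangentSpace (𝓡 7) p →ₗ[ℝ] TangentSpace (𝓡 7) p →ₗ[ℝ] ℝ),
      (SX p).IsTorsionDecomp (torsion g SX p) x1 x7 x14 x27 ∧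
      (SY p).IsTorsionDecomp (torsion g SY p) y1 y7 y14 y27 ∧
      (x1 + W2 * y1 = (1 / 2) * μ * Real.exp (-4 * Δ p) * (1 + W2)) ∧
      (x7 + W2 • y7 = ((1 / 2) * (1 + W2)) • dΔ) ∧
      (∀ u : TangentSpace (𝓡 7) p,
        delta ((SX p).sharp fun v => x14 u v - W2 * y14 u v) =
          -((1 / 8) * (W2 + 1)) •
            (SX p).mul ((SX p).assoc (delta u) (delta dΔ) W) ((SX p).inv W)) ∧
      (x27 + W2 • y27 = 0)

/-- The four conditions together. -/
def Conditions (g : Metric7 M) (φ : FormField M 3) (G : FormField M 4) (Δ : M → ℝ)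
    (l1 l2 μ : ℝ) (X Y : OctField M) : Prop :=
  Cond1 g φ Δ l1 l2 μ X Y ∧ Cond23 g φ G Δ l1 l2 μ X Y ∧ Cond4 g φ Δ μ X Y

/-- `A` is a smooth octonion section without zeros. -/
def IsNonvanishing (A : OctField M) : Prop := SmoothOct A ∧ ∀ p, A p ≠ 0

end OctKilling

end

set_option linter.unusedSectionVars false
set_option linter.unusedSimpArgs false

/-! Everything reduces to linear algebra in one tangent space after division by `X` on the right.
The reason is the identity |X|² φ_X(u, v, w) = ⟨u(vX), wX⟩ (`IsG2.normSq_mul_sigma`), which says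
that the product ∘ of φ_X satisfies A(BX) = (A ∘ B)X (`IsG2.gauge_mul`). Hence the Killing equations
for (X, Y) become equations for (1, W) with the product of φ_X, and φ_Y is obtained from φ_X by the
change of gauge with `W` (`IsG2.gauge_gauge`).

On the differential side, φ(a, b, a × b) = |a|²|b|² − ⟨a, b⟩² forces ∇φ to be a contraction of ψ
(`IsOct.exists_eq_cpsi`, `IsG2Structure.nabla3_ph`). The associator then compensates the torsion
term of `D`, so that D(AB) = (∇A)B + A(DB) (`IsG2Structure.octD_mul`). Differentiating the formula
for φ_A gives the torsion of φ_A as minus the imaginary part of (DA)A⁻¹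
(`IsG2Structure.torsion_gauge`). So K = (DX)X⁻¹ and E = (DY)X⁻¹ contain both torsions and the
derivatives of w₀, |W|² and of the norms.

A 4-form acts on octonions by Clifford multiplication as 144 P, with P symmetric and traceless; the
action is faithful, and Q₀, Q₁, Q₂ are the blocks of P (`IsG2.cl4_eq`,
`IsG2.exists_fourFormDecomp`). The commutator of G with a vector v is a multiple of the action of v
⌟ G, so the Killing equations involve only P: they prescribe P1 and PW, and after these are inserted
they prescribe K and E (`G2Point.killX`, `G2Point.killY`, `IsG2.killing_div`).

The prescriptions for P1 and PW amount to the algebraic relations of `Cond1` and `Cond23`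
(`IsOct.pop_eqs_iff`). Symmetry of P lets it be evaluated on 1 and W in the derivatives of w₀, of
|W|² and of the norms, and cancels it from the sum of T^X(a, c) and |W|² T^Y(c, a). The symmetric
and skew parts of that sum, together with the 7-components, which are found by a contraction with
the cross product, are `Cond4` (`IsG2.torsionRel`). Conversely, the torsion of φ_X gives Im K, the
equation for d|W|² and the normalization give Re K and ⟨E, W⟩, and `Cond4` gives the other
components of E (`IsG2.oip_eq_of_torsionRel`). This is `IsG2.killing_iff`.

The existence statement follows because the conditions see only φ_X, φ_Y and W, which do not change
when X and Y are multiplied by a common function; that function is chosen to make e^{-Δ}(|X|² +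
|Y|²) constant.

The Hodge star enters through one fact: the product of the left multiplications by all seven frame
vectors is ±1. It identifies ⋆φ_X, for the orientation fixed by φ, with the 4-form built from the
cross product of φ_X (`IsOct.normSq_mul_star3`). -/

noncomputable section

namespace OctKilling

/-! ### Octonion algebra from the axioms of a cross product -/

section Pointwise

variable {V : Type*} [AddCommGroup V] [Module ℝ V]

/-- The laws of a seven-dimensional cross product: a scalar product with orthonormal frame and an
alternating 3-form whose cross product satisfies `u × (u × v) = ⟨u, v⟩ u - ⟨u, u⟩ v`. -/
structure IsOct (S : G2Point V) : Prop where
  ip_add : ∀ u v w, S.ip (u + v) w = S.ip u w + S.ip v w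
  ip_smul : ∀ (c : ℝ) u w, S.ip (c • u) w = c * S.ip u w
  ip_comm : ∀ u v, S.ip u v = S.ip v u
  orth : ∀ i j, S.ip (S.e i) (S.e j) = if i = j then 1 else 0
  expand : ∀ v, ∑ i, S.ip v (S.e i) • S.e i = v
  ph_add : ∀ u u' v w, S.ph (u + u') v w = S.ph u v w + S.ph u' v w
  ph_smul : ∀ (c : ℝ) u v w, S.ph (c • u) v w = c * S.ph u v w
  ph_swap : ∀ u v w, S.ph v u w = -S.ph u v w
  ph_swap' : ∀ u v w, S.ph u w v = -S.ph u v w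
  cross_cross : ∀ u v, S.cross u (S.cross u v) = S.ip u v • u - S.ip u u • v

/-- The scalar product of octonions. -/
def G2Point.oip (S : G2Point V) (A B : Oct V) : ℝ := A.1 * B.1 + S.ip A.2 B.2

namespace IsOct

variable {S : G2Point V} (h : IsOct S)
include h

lemma ip_add' (u v w : V) : S.ip w (u + v) = S.ip w u + S.ip w v := by
  rw [h.ip_comm, h.ip_add, h.ip_comm u, h.ip_comm v]

lemma ip_smul' (c : ℝ) (u w : V) : S.ip w (c • u) = c * S.ip w u := by
  rw [h.ip_comm, h.ip_smul, h.ip_comm u]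

lemma ip_neg (u w : V) : S.ip (-u) w = -S.ip u w := by
  rw [← neg_one_smul ℝ, h.ip_smul]; ring

lemma ip_neg' (u w : V) : S.ip w (-u) = -S.ip w u := by
  rw [← neg_one_smul ℝ, h.ip_smul']; ring

lemma ip_sub (u v w : V) : S.ip (u - v) w = S.ip u w - S.ip v w := by
  rw [sub_eq_add_neg, h.ip_add, h.ip_neg]; ring

lemma ip_sub' (u v w : V) : S.ip w (u - v) = S.ip w u - S.ip w v := by
  rw [sub_eq_add_neg, h.ip_add', h.ip_neg']; ring

lemma ip_zero (w : V) : S.ip 0 w = 0 := by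
  rw [← zero_smul ℝ (0 : V), h.ip_smul]; ring

lemma ip_zero' (w : V) : S.ip w 0 = 0 := by rw [h.ip_comm, h.ip_zero]

/-- The scalar product with a fixed vector. -/
def ipl (w : V) : V →ₗ[ℝ] ℝ where
  toFun v := S.ip w v
  map_add' u v := h.ip_add' u v w
  map_smul' c u := h.ip_smul' c u w

lemma ip_sum' {ι : Type*} (s : Finset ι) (f : ι → V) (w : V) :
    S.ip w (∑ i ∈ s, f i) = ∑ i ∈ s, S.ip w (f i) :=
  map_sum (h.ipl w) f s

lemma ip_sum {ι : Type*} (s : Finset ι) (f : ι → V) (w : V) :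
    S.ip (∑ i ∈ s, f i) w = ∑ i ∈ s, S.ip (f i) w := by
  rw [h.ip_comm, h.ip_sum']; simp only [h.ip_comm w]

lemma ext {u v : V} (H : ∀ w, S.ip u w = S.ip v w) : u = v := by
  rw [← h.expand u, ← h.expand v]; simp only [H]

lemma parseval (u v : V) : ∑ i, S.ip u (S.e i) * S.ip v (S.e i) = S.ip u v := by
  conv_rhs => rw [← h.expand v, h.ip_sum']
  simp only [h.ip_smul', mul_comm]

lemma ip_self_eq (u : V) : S.ip u u = ∑ i, S.ip u (S.e i) ^ 2 := by
  rw [← h.parseval]; simp only [sq]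

lemma ip_self_nonneg (u : V) : 0 ≤ S.ip u u := by
  rw [h.ip_self_eq]; positivity

lemma eq_zero_of_ip_self {u : V} (hu : S.ip u u = 0) : u = 0 := by
  rw [h.ip_self_eq, Finset.sum_eq_zero_iff_of_nonneg (fun _ _ => sq_nonneg _)] at hu
  rw [← h.expand u]
  exact Finset.sum_eq_zero fun i hi => by
    rw [pow_eq_zero_iff two_ne_zero |>.1 (hu i hi), zero_smul]

lemma contract {W : Type*} [AddCommGroup W] [Module ℝ W] (f : V →ₗ[ℝ] W) (v : V) :
    ∑ i, S.ip v (S.e i) • f (S.e i) = f v := by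
  conv_rhs => rw [← h.expand v, map_sum]
  simp only [map_smul]

lemma sum_ip_self : ∑ i, S.ip (S.e i) (S.e i) = 7 := by simp [h.orth]

lemma ph_add₂ (u v v' w : V) : S.ph u (v + v') w = S.ph u v w + S.ph u v' w := by
  rw [h.ph_swap, h.ph_add, h.ph_swap u, h.ph_swap u]; ring

lemma ph_smul₂ (c : ℝ) (u v w : V) : S.ph u (c • v) w = c * S.ph u v w := by
  rw [h.ph_swap, h.ph_smul, h.ph_swap u]; ring

lemma ph_add₃ (u v w w' : V) : S.ph u v (w + w') = S.ph u v w + S.ph u v w' := by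
  rw [h.ph_swap', h.ph_add₂, h.ph_swap' u v, h.ph_swap' u v]; ring

lemma ph_smul₃ (c : ℝ) (u v w : V) : S.ph u v (c • w) = c * S.ph u v w := by
  rw [h.ph_swap', h.ph_smul₂, h.ph_swap' u v]; ring

lemma ph_cyc (u v w : V) : S.ph v w u = S.ph u v w := by
  rw [h.ph_swap', h.ph_swap]; ring

lemma ph_self (u w : V) : S.ph u u w = 0 := by
  have := h.ph_swap u u w; linarith

lemma ph_self' (u w : V) : S.ph w u u = 0 := by
  have := h.ph_swap' w u u; linarith

lemma ip_sharp (f : V →ₗ[ℝ] ℝ) (w : V) : S.ip (S.sharp f) w = f w := by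
  rw [G2Point.sharp, h.ip_sum, ← h.contract f w]
  refine Finset.sum_congr rfl fun i _ => ?_
  rw [h.ip_smul, h.ip_comm, smul_eq_mul, mul_comm]

/-- The 3-form with two arguments fixed. -/
def phl (u v : V) : V →ₗ[ℝ] ℝ where
  toFun w := S.ph u v w
  map_add' w w' := h.ph_add₃ u v w w'
  map_smul' c w := h.ph_smul₃ c u v w

lemma phl_apply (u v w : V) : h.phl u v w = S.ph u v w := rfl

lemma ip_cross (u v w : V) : S.ip (S.cross u v) w = S.ph u v w := h.ip_sharp (h.phl u v) w

lemma ip_cross' (u v w : V) : S.ip w (S.cross u v) = S.ph u v w := by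
  rw [h.ip_comm, h.ip_cross]

lemma cross_add (u v w : V) : S.cross u (v + w) = S.cross u v + S.cross u w :=
  h.ext fun x => by simp only [h.ip_add, h.ip_cross, h.ph_add₂]

lemma add_cross (u v w : V) : S.cross (u + v) w = S.cross u w + S.cross v w :=
  h.ext fun x => by simp only [h.ip_add, h.ip_cross, h.ph_add]

lemma cross_smul (c : ℝ) (u v : V) : S.cross u (c • v) = c • S.cross u v :=
  h.ext fun x => by simp only [h.ip_smul, h.ip_cross, h.ph_smul₂]

lemma smul_cross (c : ℝ) (u v : V) : S.cross (c • u) v = c • S.cross u v :=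
  h.ext fun x => by simp only [h.ip_smul, h.ip_cross, h.ph_smul]

lemma cross_anti (u v : V) : S.cross v u = -S.cross u v :=
  h.ext fun x => by simp only [h.ip_neg, h.ip_cross, h.ph_swap u v]

lemma cross_self (u : V) : S.cross u u = 0 :=
  h.ext fun x => by simp only [h.ip_zero, h.ip_cross, h.ph_self]

lemma cross_neg (u v : V) : S.cross u (-v) = -S.cross u v :=
  h.ext fun x => by rw [← neg_one_smul ℝ v, h.cross_smul, neg_one_smul]

lemma neg_cross (u v : V) : S.cross (-u) v = -S.cross u v :=
  h.ext fun x => by rw [← neg_one_smul ℝ u, h.smul_cross, neg_one_smul]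

lemma cross_sub (u v w : V) : S.cross u (v - w) = S.cross u v - S.cross u w := by
  rw [sub_eq_add_neg, h.cross_add, h.cross_neg, ← sub_eq_add_neg]

lemma cross_zero (u : V) : S.cross u 0 = 0 := by
  have := h.cross_smul 0 u 0; simpa using this

lemma zero_cross (u : V) : S.cross 0 u = 0 := by
  have := h.smul_cross 0 0 u; simpa using this

/-- Polarization of `cross_cross` in its repeated argument. -/
lemma cross_cross_polar (u v w : V) : S.cross u (S.cross v w) + S.cross v (S.cross u w) =
    S.ip u w • v + S.ip v w • u - (2 * S.ip u v) • w := by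
  have h1 := h.cross_cross (u + v) w
  simp only [h.add_cross, h.cross_add, h.cross_cross, h.ip_add, h.ip_add', h.ip_comm v u] at h1
  have h2 : S.cross u (S.cross v w) + S.cross v (S.cross u w) =
      (S.ip u w + S.ip v w) • (u + v)
        - (S.ip u u + S.ip u v + (S.ip u v + S.ip v v)) • w
        - (S.ip u w • u - S.ip u u • w) - (S.ip v w • v - S.ip v v • w) := by
    rw [← h1]; abel
  rw [h2]; module

/-! #### The algebra of octonions -/

lemma oip_comm (A B : Oct V) : S.oip A B = S.oip B A := by
  simp only [G2Point.oip, h.ip_comm A.2, mul_comm]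

lemma oip_add (A B C : Oct V) : S.oip (A + B) C = S.oip A C + S.oip B C := by
  simp only [G2Point.oip, Prod.fst_add, Prod.snd_add, h.ip_add]; ring

lemma oip_smul (c : ℝ) (A B : Oct V) : S.oip (c • A) B = c * S.oip A B := by
  simp only [G2Point.oip, Prod.smul_fst, Prod.smul_snd, h.ip_smul, smul_eq_mul]; ring

lemma oip_add' (A B C : Oct V) : S.oip C (A + B) = S.oip C A + S.oip C B := by
  rw [h.oip_comm, h.oip_add, h.oip_comm A, h.oip_comm B]

lemma oip_smul' (c : ℝ) (A B : Oct V) : S.oip B (c • A) = c * S.oip B A := by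
  rw [h.oip_comm, h.oip_smul, h.oip_comm A]

lemma oip_neg (A B : Oct V) : S.oip (-A) B = -S.oip A B := by
  rw [← neg_one_smul ℝ, h.oip_smul]; ring

lemma oip_neg' (A B : Oct V) : S.oip B (-A) = -S.oip B A := by
  rw [← neg_one_smul ℝ, h.oip_smul']; ring

lemma oip_sub (A B C : Oct V) : S.oip (A - B) C = S.oip A C - S.oip B C := by
  rw [sub_eq_add_neg, h.oip_add, h.oip_neg]; ring

lemma oip_sub' (A B C : Oct V) : S.oip C (A - B) = S.oip C A - S.oip C B := by
  rw [sub_eq_add_neg, h.oip_add', h.oip_neg']; ring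

/-- The scalar product with a fixed octonion. -/
def oipl (A : Oct V) : Oct V →ₗ[ℝ] ℝ where
  toFun B := S.oip A B
  map_add' B C := h.oip_add' B C A
  map_smul' c B := h.oip_smul' c B A

lemma oip_sum' {ι : Type*} (s : Finset ι) (f : ι → Oct V) (A : Oct V) :
    S.oip A (∑ i ∈ s, f i) = ∑ i ∈ s, S.oip A (f i) :=
  map_sum (h.oipl A) f s

lemma oip_sum {ι : Type*} (s : Finset ι) (f : ι → Oct V) (A : Oct V) :
    S.oip (∑ i ∈ s, f i) A = ∑ i ∈ s, S.oip (f i) A := by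
  rw [h.oip_comm, h.oip_sum']; simp only [h.oip_comm A]

lemma oip_one (A : Oct V) : S.oip A (1, 0) = A.1 := by simp [G2Point.oip, h.ip_zero']

lemma oip_delta (A : Oct V) (u : V) : S.oip A (delta u) = S.ip A.2 u := by
  simp [G2Point.oip, delta]

lemma oip_one_left (A : Oct V) : S.oip (1, 0) A = A.1 := by simp [G2Point.oip, h.ip_zero]

lemma oip_delta_left (A : Oct V) (u : V) : S.oip (delta u) A = S.ip u A.2 := by
  simp [G2Point.oip, delta]

lemma oext {A B : Oct V} (H : ∀ C, S.oip A C = S.oip B C) : A = B := by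
  refine Prod.ext ?_ (h.ext fun w => ?_)
  · rw [← h.oip_one A, ← h.oip_one B, H]
  · rw [← h.oip_delta, ← h.oip_delta, H]

lemma oext' {A B : Oct V} (H1 : A.1 = B.1) (H : ∀ w, S.oip A (delta w) = S.oip B (delta w)) :
    A = B :=
  Prod.ext H1 (h.ext fun w => by rw [← h.oip_delta, ← h.oip_delta, H])

lemma normSq_eq (A : Oct V) : S.normSq A = S.oip A A := by
  simp only [G2Point.normSq, G2Point.oip, sq]

lemma normSq_nonneg (A : Oct V) : 0 ≤ S.normSq A :=
  add_nonneg (sq_nonneg _) (h.ip_self_nonneg _)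

lemma normSq_ne_zero {A : Oct V} (hA : A ≠ 0) : S.normSq A ≠ 0 := by
  intro h0
  have h1 := h.ip_self_nonneg A.2
  have h2 := sq_nonneg A.1
  rw [G2Point.normSq] at h0
  exact hA (Prod.ext (by simpa using (by linarith : A.1 ^ 2 = 0))
    (h.eq_zero_of_ip_self (by linarith)))

lemma normSq_pos {A : Oct V} (hA : A ≠ 0) : 0 < S.normSq A :=
  lt_of_le_of_ne (h.normSq_nonneg A) (h.normSq_ne_zero hA).symm

lemma mul_add (A B C : Oct V) : S.mul A (B + C) = S.mul A B + S.mul A C := by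
  refine Prod.ext ?_ ?_
  · simp only [G2Point.mul, Prod.fst_add, Prod.snd_add, h.ip_add']; ring
  · simp only [G2Point.mul, Prod.fst_add, Prod.snd_add, h.cross_add]; module

lemma add_mul (A B C : Oct V) : S.mul (A + B) C = S.mul A C + S.mul B C := by
  refine Prod.ext ?_ ?_
  · simp only [G2Point.mul, Prod.fst_add, Prod.snd_add, h.ip_add]; ring
  · simp only [G2Point.mul, Prod.fst_add, Prod.snd_add, h.add_cross]; module

lemma mul_smul (c : ℝ) (A B : Oct V) : S.mul A (c • B) = c • S.mul A B := by
  refine Prod.ext ?_ ?_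
  · simp only [G2Point.mul, Prod.smul_fst, Prod.smul_snd, h.ip_smul', smul_eq_mul]; ring
  · simp only [G2Point.mul, Prod.smul_fst, Prod.smul_snd, h.cross_smul, smul_eq_mul]; module

lemma smul_mul (c : ℝ) (A B : Oct V) : S.mul (c • A) B = c • S.mul A B := by
  refine Prod.ext ?_ ?_
  · simp only [G2Point.mul, Prod.smul_fst, Prod.smul_snd, h.ip_smul, smul_eq_mul]; ring
  · simp only [G2Point.mul, Prod.smul_fst, Prod.smul_snd, h.smul_cross, smul_eq_mul]; module

lemma one_mul (A : Oct V) : S.mul (1, 0) A = A := by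
  refine Prod.ext ?_ ?_ <;> simp [G2Point.mul, h.ip_zero, h.zero_cross]

lemma mul_one (A : Oct V) : S.mul A (1, 0) = A := by
  refine Prod.ext ?_ ?_ <;> simp [G2Point.mul, h.ip_zero', h.cross_zero]

lemma real_mul (c : ℝ) (A : Oct V) : S.mul (c, 0) A = c • A := by
  refine Prod.ext ?_ ?_ <;> simp [G2Point.mul, h.ip_zero, h.zero_cross]

lemma mul_neg (A B : Oct V) : S.mul A (-B) = -S.mul A B := by
  rw [← neg_one_smul ℝ B, h.mul_smul, neg_one_smul]

lemma neg_mul (A B : Oct V) : S.mul (-A) B = -S.mul A B := by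
  rw [← neg_one_smul ℝ A, h.smul_mul, neg_one_smul]

lemma mul_sub (A B C : Oct V) : S.mul A (B - C) = S.mul A B - S.mul A C := by
  rw [sub_eq_add_neg, h.mul_add, h.mul_neg, ← sub_eq_add_neg]

lemma sub_mul (A B C : Oct V) : S.mul (A - B) C = S.mul A C - S.mul B C := by
  rw [sub_eq_add_neg, h.add_mul, h.neg_mul, ← sub_eq_add_neg]

lemma mul_zero (A : Oct V) : S.mul A 0 = 0 := by
  have := h.mul_smul 0 A 0; simpa using this

lemma zero_mul (A : Oct V) : S.mul 0 A = 0 := by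
  have := h.smul_mul 0 0 A; simpa using this

/-- Multiplication as a bilinear map. -/
def mulL : Oct V →ₗ[ℝ] Oct V →ₗ[ℝ] Oct V :=
  LinearMap.mk₂ ℝ S.mul h.add_mul h.smul_mul h.mul_add h.mul_smul

lemma mul_sum {ι : Type*} (s : Finset ι) (f : ι → Oct V) (A : Oct V) :
    S.mul A (∑ i ∈ s, f i) = ∑ i ∈ s, S.mul A (f i) :=
  map_sum (h.mulL A) f s

lemma sum_mul {ι : Type*} (s : Finset ι) (f : ι → Oct V) (A : Oct V) :
    S.mul (∑ i ∈ s, f i) A = ∑ i ∈ s, S.mul (f i) A :=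
  map_sum (h.mulL.flip A) f s

lemma conj_mul (A B : Oct V) : oconj (S.mul A B) = S.mul (oconj B) (oconj A) := by
  refine Prod.ext ?_ ?_
  · simp only [G2Point.mul, oconj, h.ip_neg, h.ip_neg', h.ip_comm B.2]; ring
  · simp only [G2Point.mul, oconj, h.cross_neg, h.neg_cross, h.cross_anti A.2 B.2]; module

/-- Adjointness of left multiplication by A and by its conjugate rests only on φ being alternating.
It is the main tool for moving factors in scalar products. -/
lemma oip_mul_left (A B C : Oct V) : S.oip (S.mul A B) C = S.oip B (S.mul (oconj A) C) := by
  simp only [G2Point.oip, G2Point.mul, oconj, h.ip_add, h.ip_add', h.ip_smul, h.ip_smul', h.ip_neg,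
    h.ip_neg', h.neg_cross, h.ip_cross, h.ip_cross', h.ph_swap' A.2 B.2, h.ip_comm B.2 A.2]
  ring

lemma oip_conj (A B : Oct V) : S.oip (oconj A) (oconj B) = S.oip A B := by
  simp only [G2Point.oip, oconj, h.ip_neg, h.ip_neg', neg_neg]

lemma conj_conj (A : Oct V) : oconj (oconj A) = A := by simp [oconj]

lemma oip_mul_right (A B C : Oct V) : S.oip (S.mul A B) C = S.oip A (S.mul C (oconj B)) := by
  rw [← h.oip_conj, h.conj_mul, h.oip_mul_left, ← h.oip_conj, h.conj_conj, h.conj_mul,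
    h.conj_conj, h.conj_conj]

lemma delta_mul_delta_mul (u : V) (A : Oct V) :
    S.mul (delta u) (S.mul (delta u) A) = -S.ip u u • A := by
  refine Prod.ext ?_ ?_
  · simp only [G2Point.mul, delta, h.ip_add', h.ip_smul', h.ip_cross', Prod.smul_fst, smul_eq_mul,
      h.ph_swap' u u, h.ph_self]
    ring
  · simp only [G2Point.mul, delta, h.cross_add, h.cross_smul, h.cross_self, h.cross_cross,
      Prod.smul_snd]
    module

lemma delta_add (u v : V) : delta (u + v) = delta u + delta v := by simp [delta]
lemma delta_smul (c : ℝ) (u : V) : delta (c • u) = c • delta u := by simp [delta]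

/-- Left multiplication by imaginary octonions. -/
def L : V →ₗ[ℝ] Module.End ℝ (Oct V) where
  toFun u := h.mulL (delta u)
  map_add' u v := by rw [h.delta_add, map_add]
  map_smul' c u := by rw [h.delta_smul, map_smul]; rfl

lemma L_apply (u : V) (A : Oct V) : h.L u A = S.mul (delta u) A := rfl

lemma clifford (u v : V) : h.L u * h.L v = -(h.L v * h.L u) - (2 * S.ip u v) • 1 := by
  have key : ∀ w : V, h.L w * h.L w = -S.ip w w • 1 := fun w =>
    LinearMap.ext fun A => h.delta_mul_delta_mul w A
  have h1 := key (u + v)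
  rw [map_add, _root_.add_mul, _root_.mul_add, _root_.mul_add, key, key] at h1
  simp only [h.ip_add, h.ip_add', h.ip_comm v u] at h1
  have h2 : h.L u * h.L v = -(S.ip u u + S.ip u v + (S.ip u v + S.ip v v)) • (1 : Module.End ℝ (Oct V))
      - (-S.ip u u • 1) - (-S.ip v v • 1) - h.L v * h.L u := by
    rw [← h1]; abel
  rw [h2]; module

lemma clifford_apply (u v : V) (A : Oct V) : S.mul (delta u) (S.mul (delta v) A) =
    -S.mul (delta v) (S.mul (delta u) A) - (2 * S.ip u v) • A := by
  have := LinearMap.congr_fun (h.clifford u v) A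
  simpa using! this

/-- With A = a + δ_α the Clifford relation gives (a − δ_α)(a + δ_α) = a² + |α|². This is the only
form of alternativity needed: it yields division and multiplicativity of the norm. -/
lemma conj_mul_mul (A B : Oct V) : S.mul (oconj A) (S.mul A B) = S.normSq A • B := by
  have hA : A = A.1 • ((1 : ℝ), (0 : V)) + delta A.2 := by
    refine Prod.ext ?_ ?_ <;> simp [delta]
  have hB : oconj A = A.1 • ((1 : ℝ), (0 : V)) - delta A.2 := by
    refine Prod.ext ?_ ?_ <;> simp [delta, oconj]
  rw [hB]
  nth_rw 3 [hA]
  simp only [h.sub_mul, h.add_mul, h.smul_mul, h.one_mul, h.mul_add, h.mul_smul,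
    h.delta_mul_delta_mul, G2Point.normSq]
  module

lemma mul_mul_conj (A B : Oct V) : S.mul (S.mul B A) (oconj A) = S.normSq A • B := by
  have h1 := congrArg oconj (h.conj_mul_mul (oconj A) (oconj B))
  rw [h.conj_mul, h.conj_mul, h.conj_conj, h.conj_conj] at h1
  rw [h1]
  have h2 : S.normSq (oconj A) = S.normSq A := by rw [h.normSq_eq, h.normSq_eq, h.oip_conj]
  rw [h2]; simp only [oconj, Prod.smul_fst, Prod.smul_snd, smul_neg, neg_neg]; rfl

lemma normSq_conj (A : Oct V) : S.normSq (oconj A) = S.normSq A := by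
  rw [h.normSq_eq, h.normSq_eq, h.oip_conj]

lemma oip_mul_mul (A B X : Oct V) : S.oip (S.mul A X) (S.mul B X) = S.normSq X * S.oip A B := by
  rw [h.oip_mul_right, h.mul_mul_conj, h.oip_smul']

lemma oip_mul_mul' (A B X : Oct V) : S.oip (S.mul X A) (S.mul X B) = S.normSq X * S.oip A B := by
  rw [h.oip_mul_left, h.conj_mul_mul, h.oip_smul']

lemma mul_inv_mul {X : Oct V} (hX : X ≠ 0) (A : Oct V) : S.mul (S.mul A (S.inv X)) X = A := by
  have h1 := h.mul_mul_conj (oconj X) A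
  rw [h.conj_conj, h.normSq_conj] at h1
  rw [G2Point.inv, h.mul_smul, h.smul_mul, h1, smul_smul, inv_mul_cancel₀ (h.normSq_ne_zero hX),
    one_smul]

lemma mul_mul_inv {X : Oct V} (hX : X ≠ 0) (A : Oct V) : S.mul (S.mul A X) (S.inv X) = A := by
  rw [G2Point.inv, h.mul_smul, h.mul_mul_conj, smul_smul, inv_mul_cancel₀ (h.normSq_ne_zero hX),
    one_smul]

lemma mul_right_cancel {X : Oct V} (hX : X ≠ 0) {A B : Oct V} (H : S.mul A X = S.mul B X) :
    A = B := by rw [← h.mul_mul_inv hX A, H, h.mul_mul_inv hX]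

lemma oip_L (u : V) (A B : Oct V) :
    S.oip (S.mul (delta u) A) B = -S.oip A (S.mul (delta u) B) := by
  have : oconj (delta u) = -delta u := by simp [oconj, delta]
  rw [h.oip_mul_left, this, h.neg_mul, h.oip_neg']

lemma mul_delta_delta (u v : V) : S.mul (delta u) (delta v) = (-S.ip u v, S.cross u v) := by
  simp [G2Point.mul, delta]

end IsOct
end Pointwise
end OctKilling
end

/-! ### The 4-form of a cross product and the change of gauge `σ_X` -/

noncomputable section

namespace OctKilling

section Pointwise

variable {V : Type*} [AddCommGroup V] [Module ℝ V]

/-- The 4-form determined by the cross product. -/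
def G2Point.cpsi (S : G2Point V) (a b c d : V) : ℝ :=
  S.ip (S.cross a b) (S.cross c d) - S.ip a c * S.ip b d + S.ip a d * S.ip b c

/-- A `G₂`-structure on one tangent space: the Hodge dual of the 3-form is the 4-form determined by
the cross product. -/
structure IsG2 (S : G2Point V) : Prop extends IsOct S where
  psi_eq : ∀ a b c d, S.psi a b c d = S.cpsi a b c d

lemma oct_eq (X : Oct V) : X = X.1 • ((1 : ℝ), (0 : V)) + delta X.2 := by
  refine Prod.ext ?_ ?_ <;> simp [delta]

namespace IsOct

variable {S : G2Point V} (h : IsOct S)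
include h

lemma cpsi_add (a a' b c d : V) :
    S.cpsi (a + a') b c d = S.cpsi a b c d + S.cpsi a' b c d := by
  simp only [G2Point.cpsi, h.add_cross, h.ip_add]; ring

lemma cpsi_smul (k : ℝ) (a b c d : V) : S.cpsi (k • a) b c d = k * S.cpsi a b c d := by
  simp only [G2Point.cpsi, h.smul_cross, h.ip_smul]; ring

lemma cpsi_swap (a b c d : V) : S.cpsi b a c d = -S.cpsi a b c d := by
  simp only [G2Point.cpsi, h.cross_anti a b, h.ip_neg]; ring

/-- The polarized double cross product identity, paired with a. The other two transpositions are
visible in the definition, so `cpsi` is alternating. -/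
lemma cpsi_swap₂ (a b c d : V) : S.cpsi a c b d = -S.cpsi a b c d := by
  have h1 := congrArg (fun x => S.ip x a) (h.cross_cross_polar c b d)
  simp only [h.ip_add, h.ip_sub, h.ip_smul, h.ip_cross] at h1
  rw [h.ph_cyc a c, h.ph_cyc a b, ← h.ip_cross (a) c, ← h.ip_cross a b] at h1
  simp only [G2Point.cpsi]
  rw [h.ip_comm b a, h.ip_comm c a, h.ip_comm d a] at h1
  rw [h.ip_comm b c]
  linarith

lemma cpsi_swap₃ (a b c d : V) : S.cpsi a b d c = -S.cpsi a b c d := by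
  simp only [G2Point.cpsi, h.cross_anti c d, h.ip_neg']; ring

lemma cpsi_cyc (a b c d : V) : S.cpsi b c d a = -S.cpsi a b c d := by
  rw [h.cpsi_swap₃, h.cpsi_swap₂, h.cpsi_swap]; ring

lemma ip_cross_cross (a b c d : V) : S.ip (S.cross a b) (S.cross c d) =
    S.cpsi a b c d + S.ip a c * S.ip b d - S.ip a d * S.ip b c := by
  simp only [G2Point.cpsi]; ring

/-- The associator is given by the 4-form. -/
lemma oip_assoc (a b c d : V) : S.oip (S.assoc (delta a) (delta b) (delta c)) (delta d) =
    -2 * S.cpsi a b c d := by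
  have e1 : S.ph a (S.cross b c) d = S.cpsi d a b c + S.ip d b * S.ip a c - S.ip d c * S.ip a b := by
    rw [h.ph_cyc d a, ← h.ip_cross, h.ip_cross_cross]
  have e2 : S.ph (S.cross a b) c d =
      S.cpsi c d a b + S.ip c a * S.ip d b - S.ip c b * S.ip d a := by
    rw [← h.ph_cyc, ← h.ip_cross, h.ip_cross_cross]
  have e3 : S.cpsi c d a b = S.cpsi a b c d := by rw [h.cpsi_cyc, h.cpsi_cyc]; ring
  have e4 : S.cpsi d a b c = -S.cpsi a b c d := by rw [h.cpsi_cyc d a b c]; ring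
  rw [h.oip_delta, G2Point.assoc, h.mul_delta_delta, h.mul_delta_delta]
  simp only [G2Point.mul, delta, Prod.snd_sub, h.ip_add, h.ip_sub, h.ip_smul, h.ip_cross]
  rw [e1, e2, e3, e4, h.ip_comm d a, h.ip_comm d b, h.ip_comm d c, h.ip_comm c a, h.ip_comm c b]
  ring

lemma mul_delta_comm (u v : V) : S.mul (delta u) (delta v) =
    -S.mul (delta v) (delta u) - (2 * S.ip u v) • ((1 : ℝ), (0 : V)) := by
  have := h.clifford_apply u v (1, 0)
  simpa only [h.mul_one] using this

/-- The 3-form `⟨u(vX), wX⟩`. -/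
lemma oip_delta_delta (X : Oct V) (u v w : V) :
    S.oip (S.mul (delta u) (S.mul (delta v) X)) (S.mul (delta w) X) =
    (X.1 ^ 2 - S.ip X.2 X.2) * S.ph u v w - 2 * X.1 * S.cpsi X.2 u v w
      + 2 * (S.ip X.2 u * S.ph X.2 v w - S.ip X.2 v * S.ph X.2 u w
        + S.ip X.2 w * S.ph X.2 u v) := by
  obtain ⟨x, α⟩ := X
  -- The form is quadratic in X = x + δ_α: `e0` is its x² part, `e1` its part linear in x and `e6`
  -- its part quadratic in α.
  have e0 : S.oip (S.mul (delta u) (delta v)) (delta w) = S.ph u v w := by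
    rw [h.mul_delta_delta, h.oip_delta, h.ip_cross]
  have e1 : S.oip (S.mul (delta u) (delta v)) (S.mul (delta w) (delta α)) +
      S.oip (S.mul (delta u) (S.mul (delta v) (delta α))) (delta w) = -2 * S.cpsi α u v w := by
    have e2 : S.ph u (S.cross v α) w =
        S.cpsi w u v α + S.ip w v * S.ip u α - S.ip w α * S.ip u v := by
      rw [h.ph_cyc w u, ← h.ip_cross, h.ip_cross_cross]
    have e3 : S.cpsi w u v α = -S.cpsi α w u v := by rw [h.cpsi_cyc α w u v]
    have e4 : S.cpsi u v w α = -S.cpsi α u v w := by rw [h.cpsi_cyc α u v w]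
    have e5 : S.cpsi α w u v = S.cpsi α u v w := by
      rw [h.cpsi_swap₂ α u w v, h.cpsi_swap₃ α u v w]; ring
    have e12 : S.ph u v (S.cross w α) =
        S.cpsi u v w α + S.ip u w * S.ip v α - S.ip u α * S.ip v w := by
      rw [← h.ip_cross, h.ip_cross_cross]
    simp only [h.mul_delta_delta, h.oip_delta, G2Point.oip]
    simp only [G2Point.mul, delta, h.ip_add, h.ip_smul, h.ip_cross, e2, e12, e3, e4, e5]
    rw [h.ip_comm w v]
    ring
  have e6 : S.oip (S.mul (delta u) (S.mul (delta v) (delta α))) (S.mul (delta w) (delta α)) =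
      - S.ip α α * S.ph u v w + 2 * (S.ip α u * S.ph α v w - S.ip α v * S.ph α u w
        + S.ip α w * S.ph α u v) := by
    have e7 : S.mul (delta u) (S.mul (delta v) (delta α)) =
        S.mul (delta α) (S.mul (delta u) (delta v)) + (2 * S.ip u α) • delta v
          - (2 * S.ip v α) • delta u := by
      rw [h.mul_delta_comm v α, h.mul_sub, h.mul_smul, h.mul_one, h.mul_neg,
        h.clifford_apply u α]
      module
    have e8 : S.oip (S.mul (delta α) (S.mul (delta u) (delta v))) (S.mul (delta α) (delta w)) =
        S.ip α α * S.ph u v w := by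
      rw [h.oip_mul_mul', e0]; simp [G2Point.normSq, delta]
    have e9 : ∀ z : V, S.oip (delta z) (S.mul (delta α) (delta w)) = S.ph α w z := fun z => by
      rw [h.mul_delta_delta, h.oip_delta_left, h.ip_cross']
    have e10 : S.oip (S.mul (delta α) (S.mul (delta u) (delta v))) (1, 0) = - S.ph α u v := by
      rw [h.oip_one, h.mul_delta_delta]; simp [G2Point.mul, delta, h.ip_cross', h.ph_cyc α u v]
    have e11 : ∀ z : V, S.oip (delta z) (1, 0) = 0 := fun z => by rw [h.oip_one]; rfl
    rw [e7, h.mul_delta_comm w α]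
    simp only [h.oip_sub, h.oip_add, h.oip_smul, h.oip_sub', h.oip_neg', h.oip_smul', e8, e9, e10,
      e11, h.ph_swap' α v w, h.ph_swap' α u w, h.ip_comm u α, h.ip_comm v α, h.ip_comm w α]
    ring
  have e13 : ∀ z : V, S.mul (delta z) (x, α) = x • delta z + S.mul (delta z) (delta α) := fun z => by
    rw [oct_eq (x, α), h.mul_add, h.mul_smul, h.mul_one]
  simp only [e13, h.mul_add, h.mul_smul, h.oip_add, h.oip_add', h.oip_smul, h.oip_smul', e0, e6]
  linear_combination x * e1

lemma oip_self_delta (X : Oct V) (u v : V) :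
    S.oip (S.mul (delta u) X) (S.mul (delta v) X) = S.normSq X * S.ip u v := by
  rw [h.oip_mul_mul, h.oip_delta]; rfl

lemma oip_self_mul_delta (X : Oct V) (u : V) : S.oip X (S.mul (delta u) X) = 0 := by
  have := h.oip_L u X X
  rw [h.oip_comm] at this; linarith

end IsOct

namespace IsG2

variable {S : G2Point V} (h : IsG2 S)
include h

/-- The intrinsic meaning of `σ_X`, from which every property of φ_X is deduced. -/
lemma normSq_mul_sigma {X : Oct V} (hX : X ≠ 0) (u v w : V) :
    S.normSq X * S.sigma X u v w =
      S.oip (S.mul (delta u) (S.mul (delta v) X)) (S.mul (delta w) X) := by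
  rw [h.oip_delta_delta, G2Point.sigma, mul_inv_cancel_left₀ (h.normSq_ne_zero hX), h.psi_eq]

/-- The 3-form `σ_X(φ)` with two arguments fixed. -/
def sigmal (X : Oct V) (u v : V) : V →ₗ[ℝ] ℝ :=
  (S.normSq X)⁻¹ • (h.oipl (S.mul (delta u) (S.mul (delta v) X)) ∘ₗ h.mulL.flip X ∘ₗ
    (LinearMap.inr ℝ ℝ V))

lemma sigmal_apply {X : Oct V} (hX : X ≠ 0) (u v w : V) :
    h.sigmal X u v w = S.sigma X u v w := by
  rw [← mul_right_inj' (h.normSq_ne_zero hX), h.normSq_mul_sigma hX]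
  change S.normSq X * ((S.normSq X)⁻¹ * _) = _
  rw [mul_inv_cancel_left₀ (h.normSq_ne_zero hX)]
  rfl

lemma ip_gauge_cross {X : Oct V} (hX : X ≠ 0) (u v w : V) :
    S.ip ((S.gauge X).cross u v) w = S.sigma X u v w := by
  rw [← h.sigmal_apply hX, ← h.ip_sharp (h.sigmal X u v) w]
  congr 1
  refine congrArg S.sharp (funext fun w => ?_)
  rw [h.sigmal_apply hX]
  rfl

/-- The product of `φ_X` satisfies `A (B X) = (A ∘ B) X`. -/
lemma gauge_mul_delta {X : Oct V} (hX : X ≠ 0) (u : V) (A : Oct V) :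
    S.mul (delta u) (S.mul A X) = S.mul ((S.gauge X).mul (delta u) A) X := by
  have key : ∀ v, S.mul (delta u) (S.mul (delta v) X) =
      S.mul ((S.gauge X).mul (delta u) (delta v)) X := by
    intro v
    have hm : (S.gauge X).mul (delta u) (delta v) = (-S.ip u v, (S.gauge X).cross u v) := by
      simp [G2Point.mul, delta, G2Point.gauge]
    refine h.oext fun C => ?_
    -- Right multiplication by X is onto, so it suffices to pair both sides with products BX.
    obtain ⟨B, rfl⟩ : ∃ B, C = S.mul B X := ⟨_, (h.mul_inv_mul hX C).symm⟩
    rw [h.oip_mul_mul, hm]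
    nth_rw 1 [oct_eq B]
    rw [h.add_mul, h.smul_mul, h.one_mul, h.oip_add', h.oip_smul', ← h.normSq_mul_sigma hX,
      h.oip_L, h.oip_self_delta, h.ip_comm v u, G2Point.oip, h.ip_gauge_cross hX]
    ring
  have hA : (S.gauge X).mul (delta u) A =
      A.1 • delta u + (S.gauge X).mul (delta u) (delta A.2) := by
    simp [G2Point.mul, delta, G2Point.gauge]
  rw [hA, h.add_mul, ← key]
  nth_rw 1 [oct_eq A]
  rw [h.add_mul, h.smul_mul, h.one_mul, h.mul_add, h.mul_smul, h.smul_mul]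

/-- Each axiom is the corresponding property of ⟨u(vX), wX⟩: left multiplications by vectors are
skew and satisfy the Clifford relation, whatever X is. -/
lemma gauge_isOct {X : Oct V} (hX : X ≠ 0) : IsOct (S.gauge X) where
  ip_add := h.ip_add
  ip_smul := h.ip_smul
  ip_comm := h.ip_comm
  orth := h.orth
  expand := h.expand
  ph_add u u' v w := by
    rw [← mul_right_inj' (h.normSq_ne_zero hX), _root_.mul_add]
    change S.normSq X * S.sigma X _ _ _ = S.normSq X * S.sigma X _ _ _ + S.normSq X * S.sigma X _ _ _
    rw [h.normSq_mul_sigma hX, h.normSq_mul_sigma hX, h.normSq_mul_sigma hX, h.delta_add, h.add_mul,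
      h.oip_add]
  ph_smul c u v w := by
    rw [← mul_right_inj' (h.normSq_ne_zero hX), mul_left_comm]
    change S.normSq X * S.sigma X _ _ _ = c * (S.normSq X * S.sigma X _ _ _)
    rw [h.normSq_mul_sigma hX, h.normSq_mul_sigma hX, h.delta_smul, h.smul_mul, h.oip_smul]
  ph_swap u v w := by
    rw [← mul_right_inj' (h.normSq_ne_zero hX), _root_.mul_neg]
    change S.normSq X * S.sigma X _ _ _ = -(S.normSq X * S.sigma X _ _ _)
    rw [h.normSq_mul_sigma hX, h.normSq_mul_sigma hX, h.clifford_apply v u, h.oip_sub, h.oip_neg,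
      h.oip_smul]
    rw [h.oip_self_mul_delta]; ring
  ph_swap' u v w := by
    rw [← mul_right_inj' (h.normSq_ne_zero hX), _root_.mul_neg]
    change S.normSq X * S.sigma X _ _ _ = -(S.normSq X * S.sigma X _ _ _)
    rw [h.normSq_mul_sigma hX, h.normSq_mul_sigma hX, h.oip_L, h.oip_comm]
  cross_cross u v := by
    -- Two left multiplications by u act on vX as −|u|²; cancelling X and taking the imaginary part
    -- gives the double cross product of φ_X.
    have h1 := h.gauge_mul_delta hX u ((S.gauge X).mul (delta u) (delta v))
    rw [← h.gauge_mul_delta hX, h.delta_mul_delta_mul, ← h.smul_mul] at h1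
    have h2 := congrArg Prod.snd (h.mul_right_cancel hX h1)
    have hm : (S.gauge X).mul (delta u) (delta v) = (-S.ip u v, (S.gauge X).cross u v) := by
      simp [G2Point.mul, delta, G2Point.gauge]
    rw [hm] at h2
    simp only [G2Point.mul, delta, Prod.smul_snd] at h2
    change _ = S.ip u v • u - S.ip u u • v
    rw [zero_smul, zero_add] at h2
    rw [sub_eq_add_neg, ← neg_smul, h2]
    module

end IsG2
end Pointwise
end OctKilling
end

noncomputable section

namespace OctKilling

/-! ### The standard frame -/

/-- Index of `e_i × e_j` in the standard frame. -/
def cidx (i j : Fin 7) : Fin 7 :=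
  (([[0, 2, 1, 4, 3, 6, 5], [2, 1, 0, 5, 6, 3, 4], [1, 0, 2, 6, 5, 4, 3], [4, 5, 6, 3, 0, 1, 2],
    [3, 6, 5, 0, 4, 2, 1], [6, 3, 4, 1, 2, 5, 0], [5, 4, 3, 2, 1, 0, 6]] :
    List (List (Fin 7))).getD i []).getD j 0

/-- Sign of `e_i × e_j` in the standard frame. -/
def csgn (i j : Fin 7) : ℤ :=
  (([[0, 1, -1, 1, -1, 1, -1], [-1, 0, 1, 1, -1, -1, 1], [1, -1, 0, -1, -1, 1, 1],
    [-1, -1, 1, 0, 1, 1, -1], [1, 1, 1, -1, 0, -1, -1], [-1, 1, -1, -1, 1, 0, 1],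
    [1, -1, -1, 1, 1, -1, 0]] : List (List ℤ)).getD i []).getD j 0

/-- The Kronecker symbol. -/
def dlt (i j : Fin 7) : ℤ := if i = j then 1 else 0

lemma dlt_cast (i j : Fin 7) : ((dlt i j : ℤ) : ℝ) = if i = j then 1 else 0 := by
  simp [dlt]

/-- The integer components of a decomposable 3-form. -/
def elemZ (a b c i j k : Fin 7) : ℤ :=
  dlt a i * dlt b j * dlt c k - dlt a i * dlt b k * dlt c j - dlt a j * dlt b i * dlt c k
    + dlt a j * dlt b k * dlt c i + dlt a k * dlt b i * dlt c j - dlt a k * dlt b j * dlt c i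

lemma elem3_eq (a b c i j k : Fin 7) : elem3 a b c i j k = (elemZ a b c i j k : ℝ) := by
  simp only [elemZ]
  push_cast
  simp only [dlt_cast]
  rw [elem3, Matrix.det_fin_three]
  rfl

set_option maxRecDepth 100000 in
lemma phi0_eq (i j k : Fin 7) : phi0 i j k = ((csgn i j * dlt (cidx i j) k : ℤ) : ℝ) := by
  have : ∀ i j k : Fin 7, elemZ 0 1 2 i j k + elemZ 0 3 4 i j k + elemZ 0 5 6 i j k
      + elemZ 1 3 5 i j k - elemZ 1 4 6 i j k - elemZ 2 3 6 i j k - elemZ 2 4 5 i j k =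
      csgn i j * dlt (cidx i j) k := by decide +kernel
  rw [← this]
  simp only [phi0, elem3_eq]
  push_cast; rfl

/-- The polarized double cross product identity on the frame, as a finite check of integer
coefficients. -/
lemma csgn_cross : ∀ i j k m : Fin 7, csgn j k * (csgn i (cidx j k) * dlt (cidx i (cidx j k)) m)
    + csgn i k * (csgn j (cidx i k) * dlt (cidx j (cidx i k)) m)
    = dlt i k * dlt j m + dlt j k * dlt i m - 2 * dlt i j * dlt k m := by decide +kernel

section Pointwise

variable {V : Type*} [AddCommGroup V] [Module ℝ V]

lemma eq_zero_of_frame {W : Type*} [AddCommGroup W] [Module ℝ W] {e : Fin 7 → V}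
    {c : V → Fin 7 → ℝ} (he : ∀ v, ∑ i, c v i • e i = v) (f : V → W)
    (hadd : ∀ u v, f (u + v) = f u + f v) (hsmul : ∀ (r : ℝ) u, f (r • u) = r • f u)
    (hz : ∀ i, f (e i) = 0) (v : V) : f v = 0 := by
  let F : V →ₗ[ℝ] W := { toFun := f, map_add' := hadd, map_smul' := hsmul }
  have : F v = 0 := by
    rw [← he v, map_sum]
    exact Finset.sum_eq_zero fun i _ => by
      rw [map_smul]; change _ • f (e i) = 0; rw [hz, smul_zero]
  exact this

/-- A 3-form which is standard in an orthonormal frame defines a cross product. -/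
lemma isOct_of_frame {S : G2Point V}
    (ip_add : ∀ u v w, S.ip (u + v) w = S.ip u w + S.ip v w)
    (ip_smul : ∀ (c : ℝ) u w, S.ip (c • u) w = c * S.ip u w)
    (ip_comm : ∀ u v, S.ip u v = S.ip v u)
    (orth : ∀ i j, S.ip (S.e i) (S.e j) = if i = j then 1 else 0)
    (expand : ∀ v, ∑ i, S.ip v (S.e i) • S.e i = v)
    (ph_add : ∀ u u' v w, S.ph (u + u') v w = S.ph u v w + S.ph u' v w)
    (ph_smul : ∀ (c : ℝ) u v w, S.ph (c • u) v w = c * S.ph u v w)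
    (ph_swap : ∀ u v w, S.ph v u w = -S.ph u v w)
    (ph_swap' : ∀ u v w, S.ph u w v = -S.ph u v w)
    (hph : ∀ i j k, S.ph (S.e i) (S.e j) (S.e k) = phi0 i j k) : IsOct S := by
  have ip_add' : ∀ u v w, S.ip w (u + v) = S.ip w u + S.ip w v := fun u v w => by
    rw [ip_comm, ip_add, ip_comm u, ip_comm v]
  have ip_smul' : ∀ (c : ℝ) u w, S.ip w (c • u) = c * S.ip w u := fun c u w => by
    rw [ip_comm, ip_smul, ip_comm u]
  have c1 : ∀ u u' v, S.cross (u + u') v = S.cross u v + S.cross u' v := fun u u' v => by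
    simp only [G2Point.cross, G2Point.sharp, ph_add, add_smul, Finset.sum_add_distrib]
  have c2 : ∀ (c : ℝ) u v, S.cross (c • u) v = c • S.cross u v := fun c u v => by
    simp only [G2Point.cross, G2Point.sharp, ph_smul, mul_smul, Finset.smul_sum]
  have c3 : ∀ u v, S.cross v u = -S.cross u v := fun u v => by
    simp only [G2Point.cross, G2Point.sharp, ph_swap u v, neg_smul, Finset.sum_neg_distrib]
  have c1' : ∀ u u' v, S.cross v (u + u') = S.cross v u + S.cross v u' := fun u u' v => by
    rw [c3, c1, c3 v, c3 v]; abel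
  have c2' : ∀ (c : ℝ) u v, S.cross v (c • u) = c • S.cross v u := fun c u v => by
    rw [c3, c2, c3 v, smul_neg, neg_neg]
  have ce : ∀ i j, S.cross (S.e i) (S.e j) = (csgn i j : ℝ) • S.e (cidx i j) := fun i j => by
    simp only [G2Point.cross, G2Point.sharp, hph, phi0_eq]
    push_cast
    simp only [dlt_cast]
    simp
  let F : V → V → V → V := fun u u' v => S.cross u (S.cross u' v) + S.cross u' (S.cross u v)
    - S.ip u v • u' - S.ip u' v • u + (2 * S.ip u u') • v
  have key : ∀ u u' v, F u u' v = 0 := by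
    intro u u' v
    refine eq_zero_of_frame expand (fun u => F u u' v) (fun a b => ?_) (fun r a => ?_)
      (fun i => ?_) u
    · simp only [F, c1, c1', ip_add]; module
    · simp only [F, c2, c2', ip_smul]; module
    refine eq_zero_of_frame expand (fun u' => F (S.e i) u' v) (fun a b => ?_) (fun r a => ?_)
      (fun j => ?_) u'
    · simp only [F, c1, c1', ip_add, ip_add']; module
    · simp only [F, c2, c2', ip_smul, ip_smul']; module
    refine eq_zero_of_frame expand (fun v => F (S.e i) (S.e j) v) (fun a b => ?_) (fun r a => ?_)
      (fun k => ?_) v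
    · simp only [F, c1, c1', ip_add, ip_add']; module
    · simp only [F, c2, c2', ip_smul, ip_smul']; module
    -- Each term is written as a sum over m of multiples of e_m, so that the coefficients can be
    -- compared with `csgn_cross`.
    have hsum : ∀ i, S.e i = ∑ m, ((dlt i m : ℤ) : ℝ) • S.e m := fun i => by simp [dlt_cast]
    simp only [F, ce, c2', orth, ← dlt_cast]
    rw [hsum (cidx i _), hsum (cidx j _), hsum i, hsum j, hsum k]
    simp only [Finset.smul_sum, ← Finset.sum_add_distrib, ← Finset.sum_sub_distrib]
    refine Finset.sum_eq_zero fun m _ => ?_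
    have := congrArg (fun z : ℤ => (z : ℝ)) (csgn_cross i j k m)
    push_cast at this
    simp only [smul_smul, ← add_smul, ← sub_smul]
    convert zero_smul ℝ _
    linear_combination this
  exact ⟨ip_add, ip_smul, ip_comm, orth, expand, ph_add, ph_smul, ph_swap, ph_swap', fun u v => by
    have h1 := key u u v
    simp only [F] at h1
    have h2 : (2 : ℝ) • S.cross u (S.cross u v) = (2 : ℝ) • (S.ip u v • u - S.ip u u • v) := by
      rw [← sub_eq_zero, ← h1]; module
    exact smul_right_injective V two_ne_zero h2⟩

end Pointwise
end OctKilling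
end

noncomputable section

namespace OctKilling

/-! ### The Hodge dual in an orthonormal frame -/

/-- Vandermonde determinant of seven integers. -/
def vd7 (a b c d e f g : ℤ) : ℤ :=
  (b - a) * (c - a) * (d - a) * (e - a) * (f - a) * (g - a) * (c - b) * (d - b) * (e - b) * (f - b)
    * (g - b) * (d - c) * (e - c) * (f - c) * (g - c) * (e - d) * (f - d) * (g - d) * (f - e)
    * (g - e) * (g - f)

/-- The splittings of seven indices into an increasing triple and an increasing quadruple. -/
def splits : List (Fin 7 × Fin 7 × Fin 7 × Fin 7 × Fin 7 × Fin 7 × Fin 7) :=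
  [(0, 1, 2, 3, 4, 5, 6), (0, 1, 3, 2, 4, 5, 6), (0, 1, 4, 2, 3, 5, 6), (0, 1, 5, 2, 3, 4, 6),
    (0, 1, 6, 2, 3, 4, 5), (0, 2, 3, 1, 4, 5, 6), (0, 2, 4, 1, 3, 5, 6), (0, 2, 5, 1, 3, 4, 6),
    (0, 2, 6, 1, 3, 4, 5), (0, 3, 4, 1, 2, 5, 6), (0, 3, 5, 1, 2, 4, 6), (0, 3, 6, 1, 2, 4, 5),
    (0, 4, 5, 1, 2, 3, 6), (0, 4, 6, 1, 2, 3, 5), (0, 5, 6, 1, 2, 3, 4), (1, 2, 3, 0, 4, 5, 6),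
    (1, 2, 4, 0, 3, 5, 6), (1, 2, 5, 0, 3, 4, 6), (1, 2, 6, 0, 3, 4, 5), (1, 3, 4, 0, 2, 5, 6),
    (1, 3, 5, 0, 2, 4, 6), (1, 3, 6, 0, 2, 4, 5), (1, 4, 5, 0, 2, 3, 6), (1, 4, 6, 0, 2, 3, 5),
    (1, 5, 6, 0, 2, 3, 4), (2, 3, 4, 0, 1, 5, 6), (2, 3, 5, 0, 1, 4, 6), (2, 3, 6, 0, 1, 4, 5),
    (2, 4, 5, 0, 1, 3, 6), (2, 4, 6, 0, 1, 3, 5), (2, 5, 6, 0, 1, 3, 4), (3, 4, 5, 0, 1, 2, 6),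
    (3, 4, 6, 0, 1, 2, 5), (3, 5, 6, 0, 1, 2, 4), (4, 5, 6, 0, 1, 2, 3)]

/-- The factor 24883200 is 1!·2!·3!·4!·5!·6!, the Vandermonde determinant of 0, …, 6. A split into a
triple and the complementary quadruple has sign (−1)^{i+j+k−3}, whence the minus sign. -/
lemma vd7_splits : ∀ t ∈ splits, ∀ i j k : Fin 7,
    vd7 i.val j.val k.val t.2.2.2.1.val t.2.2.2.2.1.val t.2.2.2.2.2.1.val t.2.2.2.2.2.2.val =
      -24883200 * (-1) ^ (t.1.val + t.2.1.val + t.2.2.1.val) * elemZ t.1 t.2.1 t.2.2.1 i j k := by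
  decide +kernel

lemma exists_split : ∀ a b c d : Fin 7, a < b → b < c → c < d →
    ∃ t ∈ splits, t.2.2.2 = (a, b, c, d) := by decide +kernel

/-- Index table of left multiplication by `e_i` in the coordinates of the standard frame. -/
def lidx (i : Fin 7) (n : Fin 8) : Fin 8 :=
  (([[1, 0, 3, 2, 5, 4, 7, 6],
    [2, 3, 0, 1, 6, 7, 4, 5],
    [3, 2, 1, 0, 7, 6, 5, 4],
    [4, 5, 6, 7, 0, 1, 2, 3],
    [5, 4, 7, 6, 1, 0, 3, 2],
    [6, 7, 4, 5, 2, 3, 0, 1],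
    [7, 6, 5, 4, 3, 2, 1, 0]] :
    List (List (Fin 8))).getD i []).getD n 0

/-- Sign table of left multiplication by `e_i` in the coordinates of the standard frame. -/
def lsgn (i : Fin 7) (n : Fin 8) : ℤ :=
  (([[-1, 1, -1, 1, -1, 1, -1, 1],
    [-1, 1, 1, -1, -1, 1, 1, -1],
    [-1, -1, 1, 1, 1, 1, -1, -1],
    [-1, 1, 1, -1, 1, -1, -1, 1],
    [-1, -1, -1, -1, 1, 1, 1, 1],
    [-1, 1, -1, 1, 1, -1, 1, -1],
    [-1, -1, 1, 1, -1, -1, 1, 1]] :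
    List (List ℤ)).getD i []).getD n 0

/-- Up to sign, the product of all seven left multiplications is the identity, so a product of three
of them equals ± the product of the other four. The order k, i, j against d, c, a, b is the one
produced in `normSq_mul_star3` when all factors are moved to one side of the scalar product. -/
lemma lmul_splits : ∀ t ∈ splits, ∀ n : Fin 8,
    lidx t.2.1 (lidx t.1 (lidx t.2.2.1 n)) =
      lidx t.2.2.2.2.1 (lidx t.2.2.2.1 (lidx t.2.2.2.2.2.1 (lidx t.2.2.2.2.2.2 n))) ∧
    (-1) ^ (t.1.val + t.2.1.val + t.2.2.1.val) *
      (lsgn t.2.2.1 n * (lsgn t.1 (lidx t.2.2.1 n) * lsgn t.2.1 (lidx t.1 (lidx t.2.2.1 n)))) =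
    lsgn t.2.2.2.2.2.2 n * (lsgn t.2.2.2.2.2.1 (lidx t.2.2.2.2.2.2 n) *
      (lsgn t.2.2.2.1 (lidx t.2.2.2.2.2.1 (lidx t.2.2.2.2.2.2 n)) *
      lsgn t.2.2.2.2.1 (lidx t.2.2.2.1 (lidx t.2.2.2.2.2.1 (lidx t.2.2.2.2.2.2 n))))) := by
  decide +kernel

lemma lmul_table : ∀ (a m : Fin 7), lsgn a 0 = -1 ∧ lidx a 0 = a.succ ∧
    (lsgn a m.succ = if a = m then 1 else -csgn a m) ∧
    lidx a m.succ = if a = m then 0 else (cidx a m).succ := by decide +kernel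

lemma csgn_self : ∀ a, csgn a a = 0 := by decide +kernel

/-- The transposed indicator matrix times the Vandermonde matrix of 0, …, 6 is the Vandermonde
matrix of v. Signs of permutations thus become products of integer differences, with 0 when v is not
injective. -/
lemma det_indicator (v : Fin 7 → Fin 7) :
    24883200 * Matrix.det (Matrix.of fun r s => if r = v s then (1 : ℝ) else 0) =
      vd7 (v 0).val (v 1).val (v 2).val (v 3).val (v 4).val (v 5).val (v 6).val := by
  have h1 : (Matrix.of fun r s => if r = v s then (1 : ℝ) else 0).transpose *
      Matrix.vandermonde (fun r : Fin 7 => (r.val : ℝ)) =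
      Matrix.vandermonde (fun s : Fin 7 => ((v s).val : ℝ)) := by
    ext s t
    simp [Matrix.mul_apply, Matrix.vandermonde_apply]
  have i0 : Finset.Ioi (0 : Fin 7) = {1, 2, 3, 4, 5, 6} := by decide
  have i1 : Finset.Ioi (1 : Fin 7) = {2, 3, 4, 5, 6} := by decide
  have i2 : Finset.Ioi (2 : Fin 7) = {3, 4, 5, 6} := by decide
  have i3 : Finset.Ioi (3 : Fin 7) = {4, 5, 6} := by decide
  have i4 : Finset.Ioi (4 : Fin 7) = {5, 6} := by decide
  have i5 : Finset.Ioi (5 : Fin 7) = {6} := by decide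
  have i6 : Finset.Ioi (6 : Fin 7) = ∅ := by decide
  have key : ∀ f : Fin 7 → ℤ, (Matrix.vandermonde (fun r => (f r : ℝ))).det =
      vd7 (f 0) (f 1) (f 2) (f 3) (f 4) (f 5) (f 6) := by
    intro f
    rw [Matrix.det_vandermonde, Fin.prod_univ_seven, i0, i1, i2, i3, i4, i5, i6, vd7]
    push_cast
    simp only [Finset.prod_insert, Finset.prod_singleton, Finset.prod_empty, Finset.mem_insert,
      Finset.mem_singleton, Fin.reduceEq, or_self, not_false_eq_true, mul_assoc, mul_one]
  have h2 := congrArg Matrix.det h1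
  rw [Matrix.det_mul, Matrix.det_transpose] at h2
  have k1 := key (fun r => (r.val : ℤ))
  have k2 := key (fun s => ((v s).val : ℤ))
  simp only [Int.cast_natCast] at k1 k2
  rw [k1, k2] at h2
  rw [← h2, mul_comm]
  norm_num [vd7]

section Pointwise

variable {V : Type*} [AddCommGroup V] [Module ℝ V]

namespace IsOct

variable {S : G2Point V} (h : IsOct S)
include h

/-- The coordinates of an octonion. -/
def _root_.OctKilling.G2Point.oc (S : G2Point V) (A : Oct V) : Fin 8 → ℝ :=
  Fin.cons A.1 fun m => S.ip A.2 (S.e m)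

lemma oc_ext {A B : Oct V} (H : ∀ n, S.oc A n = S.oc B n) : A = B := by
  refine Prod.ext (H 0) ?_
  rw [← h.expand A.2, ← h.expand B.2]
  exact Finset.sum_congr rfl fun m _ => congrArg (· • S.e m) (H m.succ)

lemma oc_mul (hph : ∀ i j k, S.ph (S.e i) (S.e j) (S.e k) = phi0 i j k) (a : Fin 7) (X : Oct V)
    (n : Fin 8) : S.oc (S.mul (delta (S.e a)) X) n = lsgn a n * S.oc X (lidx a n) := by
  refine Fin.cases ?_ (fun m => ?_) n
  · rw [(lmul_table a 0).1, (lmul_table a 0).2.1]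
    simp [G2Point.oc, G2Point.mul, delta, h.ip_comm (S.e a)]
  · have h1 : S.ph (S.e a) X.2 (S.e m) = -csgn a m * S.ip X.2 (S.e (cidx a m)) := by
      rw [h.ph_swap', ← h.phl_apply, ← h.contract]
      simp only [h.phl_apply, hph, phi0_eq]
      push_cast
      simp [dlt_cast]
      ring
    rw [(lmul_table a m).2.2.1, (lmul_table a m).2.2.2]
    simp only [G2Point.oc, G2Point.mul, delta, Fin.cons_succ, h.ip_add, h.ip_smul, h.ip_cross, h1,
      h.orth]
    split_ifs with ham
    · subst ham
      simp [csgn_self]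
    · simp

end IsOct

end Pointwise
end OctKilling
end

/-! ### `ψ` and `ψ_X` as Hodge duals -/

noncomputable section

namespace OctKilling

section Pointwise

variable {V : Type*} [AddCommGroup V] [Module ℝ V]

/-- An alternating 4-form which vanishes on increasing quadruples of frame vectors is zero. -/
lemma alternating_four_eq_zero {e : Fin 7 → V} {c : V → Fin 7 → ℝ}
    (he : ∀ v, ∑ i, c v i • e i = v) (F : V → V → V → V → ℝ)
    (hadd : ∀ a a' b c d, F (a + a') b c d = F a b c d + F a' b c d)
    (hsmul : ∀ (r : ℝ) a b c d, F (r • a) b c d = r * F a b c d)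
    (h1 : ∀ a b c d, F b a c d = -F a b c d) (h2 : ∀ a b c d, F a c b d = -F a b c d)
    (h3 : ∀ a b c d, F a b d c = -F a b c d)
    (hz : ∀ a b c d, a < b → b < c → c < d → F (e a) (e b) (e c) (e d) = 0) (a b c d : V) :
    F a b c d = 0 := by
  have s1 : ∀ a c d, F a a c d = 0 := fun a c d => by have := h1 a a c d; linarith
  have s2 : ∀ a c d, F c a a d = 0 := fun a c d => by have := h2 c a a d; linarith
  have s3 : ∀ a c d, F c d a a = 0 := fun a c d => by have := h3 c d a a; linarith
  have k1 : ∀ a b c d, b < c → c < d → F (e a) (e b) (e c) (e d) = 0 := fun a b c d hbc hcd => by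
    rcases lt_trichotomy a b with hab | rfl | hab
    · exact hz _ _ _ _ hab hbc hcd
    · exact s1 _ _ _
    rw [h1]
    rcases lt_trichotomy a c with hac | rfl | hac
    · rw [hz _ _ _ _ hab hac hcd, neg_zero]
    · rw [s2, neg_zero]
    rw [h2]
    rcases lt_trichotomy a d with had | rfl | had
    · rw [hz _ _ _ _ hbc hac had]; simp
    · rw [s3]; simp
    rw [h3, hz _ _ _ _ hbc hcd had]; simp
  have k2 : ∀ a b c d, c < d → F (e a) (e b) (e c) (e d) = 0 := fun a b c d hcd => by
    rcases lt_trichotomy b c with hbc | rfl | hbc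
    · exact k1 _ _ _ _ hbc hcd
    · exact s2 _ _ _
    rw [h2]
    rcases lt_trichotomy b d with hbd | rfl | hbd
    · rw [k1 _ _ _ _ hbc hbd, neg_zero]
    · rw [s3, neg_zero]
    rw [h3, k1 _ _ _ _ hcd hbd]; simp
  have k3 : ∀ a b c d, F (e a) (e b) (e c) (e d) = 0 := fun a b c d => by
    rcases lt_trichotomy c d with hcd | rfl | hcd
    · exact k2 _ _ _ _ hcd
    · exact s3 _ _ _
    rw [h3, k2 _ _ _ _ hcd, neg_zero]
  have step : ∀ b c d, (∀ i, F (e i) b c d = 0) → ∀ a, F a b c d = 0 := fun b c d H a =>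
    eq_zero_of_frame he (fun a => F a b c d) (fun a a' => hadd a a' b c d)
      (fun r a => hsmul r a b c d) H a
  have k4 : ∀ a b c d, F a (e b) (e c) (e d) = 0 := fun a b c d =>
    step _ _ _ (fun i => k3 i b c d) a
  have k5 : ∀ a b c d, F a b (e c) (e d) = 0 := fun a b c d =>
    step _ _ _ (fun i => by rw [h1, k4, neg_zero]) a
  have k6 : ∀ a b c d, F a b c (e d) = 0 := fun a b c d =>
    step _ _ _ (fun i => by rw [h1, h2, k5]; simp) a
  exact step _ _ _ (fun i => by rw [h1, h2, h3, k6]; simp) a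

/-- The six terms of the determinant `elemZ` contribute equally, since f is alternating. -/
lemma sum_elemZ (f : Fin 7 → Fin 7 → Fin 7 → ℝ) (h1 : ∀ i j k, f j i k = -f i j k)
    (h2 : ∀ i j k, f i k j = -f i j k) (a b c : Fin 7) :
    ∑ i, ∑ j, ∑ k, f i j k * elemZ a b c i j k = 6 * f a b c := by
  have key : ∀ a b c : Fin 7, ∑ i, ∑ j, ∑ k, f i j k * ((dlt a i * dlt b j * dlt c k : ℤ) : ℝ) =
      f a b c := fun a b c => by
    push_cast
    simp only [dlt_cast]
    simp [← mul_assoc]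
  have reindex : ∀ {F G : Fin 7 → Fin 7 → Fin 7 → ℝ}, (∀ i j k, F i j k = G i j k) →
      ∑ i, ∑ j, ∑ k, F i j k = ∑ i, ∑ j, ∑ k, G i j k := fun H => by simp only [H]
  simp only [elemZ, Int.cast_sub, Int.cast_add, mul_sub, mul_add, Finset.sum_sub_distrib,
    Finset.sum_add_distrib, key]
  have e2 : ∑ i, ∑ j, ∑ k, f i j k * ((dlt a i * dlt b k * dlt c j : ℤ) : ℝ) = f a c b := by
    rw [← key a c b]; exact reindex fun _ _ _ => by push_cast; ring
  have e3 : ∑ i, ∑ j, ∑ k, f i j k * ((dlt a j * dlt b i * dlt c k : ℤ) : ℝ) = f b a c := by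
    rw [← key b a c]; exact reindex fun _ _ _ => by push_cast; ring
  have e4 : ∑ i, ∑ j, ∑ k, f i j k * ((dlt a j * dlt b k * dlt c i : ℤ) : ℝ) = f c a b := by
    rw [← key c a b]; exact reindex fun _ _ _ => by push_cast; ring
  have e5 : ∑ i, ∑ j, ∑ k, f i j k * ((dlt a k * dlt b i * dlt c j : ℤ) : ℝ) = f b c a := by
    rw [← key b c a]; exact reindex fun _ _ _ => by push_cast; ring
  have e6 : ∑ i, ∑ j, ∑ k, f i j k * ((dlt a k * dlt b j * dlt c i : ℤ) : ℝ) = f c b a := by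
    rw [← key c b a]; exact reindex fun _ _ _ => by push_cast; ring
  rw [e2, e3, e4, e5, e6, h2 a b c, h1 a b c, h2 b a c, h1 a b c, h1 a c b, h2 a b c, h2 c a b,
    h1 a c b, h2 a b c]
  ring

lemma exists_alternating_det {ι : Type*} [Fintype ι] [DecidableEq ι] (F : ι → V →ₗ[ℝ] ℝ) :
    ∃ f : V [⋀^ι]→ₗ[ℝ] ℝ, ∀ v, f v = Matrix.det (Matrix.of fun a b => F a (v b)) := by
  refine ⟨Matrix.detRowAlternating.compLinearMap (LinearMap.pi F), fun v => ?_⟩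
  have e : (fun i => LinearMap.pi F (v i)) =
    (Matrix.of fun a b => F a (v b)).transpose := rfl
  rw [← Matrix.det_transpose, AlternatingMap.compLinearMap_apply, e, Matrix.det]

namespace IsOct

variable {S : G2Point V} (h : IsOct S)
include h

lemma exists_volAlt : ∃ f : V [⋀^Fin 7]→ₗ[ℝ] ℝ, ∀ v, f v = S.vol v :=
  exists_alternating_det fun a => h.ipl (S.e a)

lemma vol_add (x y z a a' b c d : V) : S.vol ![x, y, z, a + a', b, c, d] =
    S.vol ![x, y, z, a, b, c, d] + S.vol ![x, y, z, a', b, c, d] := by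
  obtain ⟨f, hf⟩ := h.exists_volAlt
  have key : ∀ w, Function.update ![x, y, z, 0, b, c, d] 3 w = ![x, y, z, w, b, c, d] := by
    intro w; funext i; fin_cases i <;> rfl
  simpa only [key, hf] using f.map_update_add ![x, y, z, 0, b, c, d] 3 a a'

lemma vol_smul (r : ℝ) (x y z a b c d : V) : S.vol ![x, y, z, r • a, b, c, d] =
    r * S.vol ![x, y, z, a, b, c, d] := by
  obtain ⟨f, hf⟩ := h.exists_volAlt
  have key : ∀ w, Function.update ![x, y, z, 0, b, c, d] 3 w = ![x, y, z, w, b, c, d] := by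
    intro w; funext i; fin_cases i <;> rfl
  simpa only [key, hf, smul_eq_mul] using f.map_update_smul ![x, y, z, 0, b, c, d] 3 r a

lemma vol_swap (x y z a b c d : V) :
    S.vol ![x, y, z, b, a, c, d] = -S.vol ![x, y, z, a, b, c, d] ∧
    S.vol ![x, y, z, a, c, b, d] = -S.vol ![x, y, z, a, b, c, d] ∧
    S.vol ![x, y, z, a, b, d, c] = -S.vol ![x, y, z, a, b, c, d] := by
  obtain ⟨f, hf⟩ := h.exists_volAlt
  simp only [← hf]
  refine ⟨?_, ?_, ?_⟩
  · rw [← f.map_swap _ (show (3 : Fin 7) ≠ 4 by decide)]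
    congr 1; funext i; fin_cases i <;> rfl
  · rw [← f.map_swap _ (show (4 : Fin 7) ≠ 5 by decide)]
    congr 1; funext i; fin_cases i <;> rfl
  · rw [← f.map_swap _ (show (5 : Fin 7) ≠ 6 by decide)]
    congr 1; funext i; fin_cases i <;> rfl

lemma vol_frame (v : Fin 7 → Fin 7) : 24883200 * S.vol (fun r => S.e (v r)) =
    vd7 (v 0).val (v 1).val (v 2).val (v 3).val (v 4).val (v 5).val (v 6).val := by
  rw [← det_indicator, G2Point.vol]
  simp only [h.orth]

/-- On an increasing quadruple only the complementary triple contributes; its six orderings cancel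
the factor 1/6 in the Hodge dual. -/
lemma star3_frame (η : V → V → V → ℝ) (h1 : ∀ i j k, η j i k = -η i j k)
    (h2 : ∀ i j k, η i k j = -η i j k) {t} (ht : t ∈ splits) :
    S.star3 η (S.e t.2.2.2.1) (S.e t.2.2.2.2.1) (S.e t.2.2.2.2.2.1) (S.e t.2.2.2.2.2.2) =
      -(-1) ^ (t.1.val + t.2.1.val + t.2.2.1.val) * η (S.e t.1) (S.e t.2.1) (S.e t.2.2.1) := by
  have key : ∀ i j k, S.vol ![S.e i, S.e j, S.e k, S.e t.2.2.2.1, S.e t.2.2.2.2.1,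
      S.e t.2.2.2.2.2.1, S.e t.2.2.2.2.2.2] =
      -(-1) ^ (t.1.val + t.2.1.val + t.2.2.1.val) * elemZ t.1 t.2.1 t.2.2.1 i j k := by
    intro i j k
    have e1 := h.vol_frame ![i, j, k, t.2.2.2.1, t.2.2.2.2.1, t.2.2.2.2.2.1, t.2.2.2.2.2.2]
    have e2 : (fun r => S.e (![i, j, k, t.2.2.2.1, t.2.2.2.2.1, t.2.2.2.2.2.1,
        t.2.2.2.2.2.2] r)) = ![S.e i, S.e j, S.e k, S.e t.2.2.2.1, S.e t.2.2.2.2.1,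
        S.e t.2.2.2.2.2.1, S.e t.2.2.2.2.2.2] := by
      funext r; fin_cases r <;> rfl
    have e3 : (vd7 _ _ _ _ _ _ _ : ℝ) = _ := congrArg (Int.cast) (vd7_splits t ht i j k)
    rw [e2] at e1
    have e4 := e1.trans e3
    push_cast at e4
    linarith
  have e5 := sum_elemZ (fun i j k => η (S.e i) (S.e j) (S.e k)) (fun _ _ _ => h1 _ _ _)
    (fun _ _ _ => h2 _ _ _) t.1 t.2.1 t.2.2.1
  simp only [G2Point.star3, key, mul_left_comm _ (-(-1 : ℝ) ^ _), ← Finset.mul_sum, e5]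
  ring

/-- The 4-form `|X|² ψ_X`. -/
def _root_.OctKilling.G2Point.quartic (S : G2Point V) (X : Oct V) (a b c d : V) : ℝ :=
  S.oip (S.mul (delta a) (S.mul (delta b) X)) (S.mul (delta c) (S.mul (delta d) X)) -
    S.normSq X * (S.ip a b * S.ip c d + S.ip a c * S.ip b d - S.ip a d * S.ip b c)

lemma quartic_swap (X : Oct V) (a b c d : V) :
    S.quartic X b a c d = -S.quartic X a b c d := by
  have h1 : S.oip X (S.mul (delta c) (S.mul (delta d) X)) = -(S.normSq X * S.ip c d) := by
    rw [← h.oip_self_delta, h.oip_L, neg_neg]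
  rw [G2Point.quartic, G2Point.quartic, h.clifford_apply b a, h.oip_sub, h.oip_neg, h.oip_smul, h1, h.ip_comm b a]
  ring

lemma quartic_swap₃ (X : Oct V) (a b c d : V) :
    S.quartic X a b d c = -S.quartic X a b c d := by
  have h1 : S.oip (S.mul (delta a) (S.mul (delta b) X)) X = -(S.normSq X * S.ip a b) := by
    rw [← h.oip_self_delta, h.oip_L, h.oip_comm]
  rw [G2Point.quartic, G2Point.quartic, h.clifford_apply d c, h.oip_sub', h.oip_neg', h.oip_smul', h1,
    h.ip_comm d c]
  ring

/-- Moving δ_c to the other side gives a product of three vectors; the Clifford relation exchanges b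
and c there, and the traces it creates are those subtracted in `quartic`. -/
lemma quartic_swap₂ (X : Oct V) (a b c d : V) :
    S.quartic X a c b d = -S.quartic X a b c d := by
  have e : ∀ b c : V,
      S.oip (S.mul (delta a) (S.mul (delta b) X)) (S.mul (delta c) (S.mul (delta d) X)) =
      -S.oip (S.mul (delta c) (S.mul (delta a) (S.mul (delta b) X))) (S.mul (delta d) X) :=
    fun b c => by rw [h.oip_L c, neg_neg]
  have e1 : S.mul (delta c) (S.mul (delta a) (S.mul (delta b) X)) =
      -S.mul (delta b) (S.mul (delta a) (S.mul (delta c) X)) + (2 * S.ip b c) • S.mul (delta a) X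
        - (2 * S.ip a c) • S.mul (delta b) X - (2 * S.ip a b) • S.mul (delta c) X := by
    rw [h.clifford_apply c a, h.clifford_apply c b, h.mul_sub, h.mul_neg, h.mul_smul,
      h.clifford_apply a b, h.ip_comm c a, h.ip_comm c b]
    module
  rw [G2Point.quartic, G2Point.quartic, e, e, e1]
  simp only [h.oip_sub, h.oip_add, h.oip_neg, h.oip_smul, h.oip_self_delta, h.ip_comm c b]
  ring

/-- If `|X|² η(u, v, w) = ⟨u(vX), wX⟩` then `|X|² ⋆η` is the 4-form `quartic X`. -/
lemma normSq_mul_star3 (hph : ∀ i j k, S.ph (S.e i) (S.e j) (S.e k) = phi0 i j k) {X : Oct V}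
    (hX : X ≠ 0) (η : V → V → V → ℝ) (hη : ∀ u v w, S.normSq X * η u v w =
      S.oip (S.mul (delta u) (S.mul (delta v) X)) (S.mul (delta w) X)) (a b c d : V) :
    S.normSq X * S.star3 η a b c d = S.quartic X a b c d := by
  have hN := h.normSq_ne_zero hX
  have h1 : ∀ u v w, η v u w = -η u v w := fun u v w => by
    rw [← mul_right_inj' hN, _root_.mul_neg, hη, hη, h.clifford_apply v u, h.oip_sub, h.oip_neg,
      h.oip_smul, h.oip_self_mul_delta]
    ring
  have h2 : ∀ u v w, η u w v = -η u v w := fun u v w => by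
    rw [← mul_right_inj' hN, _root_.mul_neg, hη, hη, h.oip_L, h.oip_comm]
  rw [← sub_eq_zero]
  -- Both sides are alternating 4-forms, so increasing quadruples of frame vectors suffice.
  refine alternating_four_eq_zero h.expand
    (fun a b c d => S.normSq X * S.star3 η a b c d - S.quartic X a b c d)
    ?_ ?_ ?_ ?_ ?_ ?_ a b c d
  · intro a a' b c d
    simp only [G2Point.star3, h.vol_add, _root_.mul_add, Finset.sum_add_distrib, G2Point.quartic, h.delta_add,
      h.add_mul, h.oip_add, h.ip_add]
    ring
  · intro r a b c d
    simp only [G2Point.star3, h.vol_smul, mul_left_comm _ r, ← Finset.mul_sum, G2Point.quartic,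
      h.delta_smul, h.smul_mul, h.oip_smul, h.ip_smul]
    ring
  · intro a b c d
    simp only [G2Point.star3, (h.vol_swap _ _ _ a b c d).1, _root_.mul_neg, Finset.sum_neg_distrib,
      h.quartic_swap X a b c d]
    ring
  · intro a b c d
    simp only [G2Point.star3, (h.vol_swap _ _ _ a b c d).2.1, _root_.mul_neg, Finset.sum_neg_distrib,
      h.quartic_swap₂ X a b c d]
    ring
  · intro a b c d
    simp only [G2Point.star3, (h.vol_swap _ _ _ a b c d).2.2, _root_.mul_neg, Finset.sum_neg_distrib,
      h.quartic_swap₃ X a b c d]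
    ring
  · intro a b c d hab hbc hcd
    obtain ⟨t, ht, hte⟩ := exists_split a b c d hab hbc hcd
    obtain ⟨rfl, rfl, rfl, rfl⟩ : t.2.2.2.1 = a ∧ t.2.2.2.2.1 = b ∧ t.2.2.2.2.2.1 = c ∧
      t.2.2.2.2.2.2 = d := by rw [hte]; simp
    -- The relation between complementary products of left multiplications, checked coordinate by
    -- coordinate. Pairing it with X turns |X|² η on the triple into `quartic` on the quadruple.
    have hL : (-1 : ℝ) ^ (t.1.val + t.2.1.val + t.2.2.1.val) •
        S.mul (delta (S.e t.2.2.1)) (S.mul (delta (S.e t.1)) (S.mul (delta (S.e t.2.1)) X)) =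
        S.mul (delta (S.e t.2.2.2.2.2.2)) (S.mul (delta (S.e t.2.2.2.2.2.1))
          (S.mul (delta (S.e t.2.2.2.1)) (S.mul (delta (S.e t.2.2.2.2.1)) X))) := by
      refine h.oc_ext fun n => ?_
      have hs : ∀ (r : ℝ) (A : Oct V), S.oc (r • A) n = r * S.oc A n := fun r A => by
        refine Fin.cases ?_ (fun m => ?_) n <;> simp [G2Point.oc, h.ip_smul]
      obtain ⟨q1, q2⟩ := lmul_splits t ht n
      have q3 := congrArg (fun z : ℤ => (z : ℝ)) q2
      push_cast at q3
      rw [hs]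
      simp only [h.oc_mul hph]
      rw [q1]
      linear_combination S.oc X _ * q3
    have n1 : ∀ x y : Fin 7, x < y → S.ip (S.e x) (S.e y) = 0 := fun x y hxy => by
      rw [h.orth, if_neg hxy.ne]
    have e1 : ∀ x y z : V, S.oip (S.mul (delta x) (S.mul (delta y) X)) (S.mul (delta z) X) =
        -S.oip (S.mul (delta z) (S.mul (delta x) (S.mul (delta y) X))) X := fun x y z => by
      rw [h.oip_L z, neg_neg]
    have e2 : ∀ x y z w : V, S.oip (S.mul (delta x) (S.mul (delta y) X))
        (S.mul (delta z) (S.mul (delta w) X)) = S.oip (S.mul (delta w) (S.mul (delta z)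
          (S.mul (delta x) (S.mul (delta y) X)))) X := fun x y z w => by
      rw [h.oip_L w, h.oip_L z, neg_neg]
    rw [h.star3_frame η h1 h2 ht, mul_left_comm, hη, G2Point.quartic, e1, e2, ← hL, h.oip_smul,
      n1 _ _ hab, n1 _ _ (hab.trans hbc), n1 _ _ (hab.trans (hbc.trans hcd))]
    ring

/-- A 3-form which is standard in the positive orthonormal frame is a `G₂`-structure. -/
lemma isG2_of_frame (hph : ∀ i j k, S.ph (S.e i) (S.e j) (S.e k) = phi0 i j k) : IsG2 S := by
  refine ⟨h, fun a b c d => ?_⟩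
  have hX : ((1 : ℝ), (0 : V)) ≠ 0 := by simp
  have hN : S.normSq ((1 : ℝ), (0 : V)) = 1 := by simp [G2Point.normSq, h.ip_zero]
  -- For X = 1 the 3-form is φ itself and `quartic` reduces to `cpsi`.
  have h1 := h.normSq_mul_star3 hph hX S.ph (fun u v w => by
    rw [hN, h.mul_one, h.mul_one, h.mul_delta_delta, h.oip_delta, h.ip_cross]; ring) a b c d
  rw [hN] at h1
  rw [G2Point.psi, ← _root_.one_mul (S.star3 _ _ _ _ _), h1, G2Point.quartic, h.mul_one, h.mul_one,
    h.mul_delta_delta, h.mul_delta_delta, hN, G2Point.oip, G2Point.cpsi]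
  ring

end IsOct

namespace IsG2

variable {S : G2Point V} (h : IsG2 S)
include h

/-- The frame is adapted to φ and not to φ_X, so `isG2_of_frame` does not apply directly. `quartic`
computes the Hodge dual of φ_X in the old frame, and the product of φ_X identifies it with the
4-form of the new cross product. -/
lemma gauge_isG2 (hph : ∀ i j k, S.ph (S.e i) (S.e j) (S.e k) = phi0 i j k) {X : Oct V}
    (hX : X ≠ 0) : IsG2 (S.gauge X) := by
  refine ⟨h.gauge_isOct hX, fun a b c d => ?_⟩
  have h1 := h.normSq_mul_star3 hph hX (S.sigma X) (h.normSq_mul_sigma hX) a b c d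
  rw [← mul_right_inj' (h.normSq_ne_zero hX)]
  refine h1.trans ?_
  have hm : ∀ u v, (S.gauge X).mul (delta u) (delta v) = (-S.ip u v, (S.gauge X).cross u v) :=
    fun u v => by simp [G2Point.mul, delta, G2Point.gauge]
  rw [G2Point.quartic, h.gauge_mul_delta hX, h.gauge_mul_delta hX, hm, hm, h.oip_mul_mul,
    G2Point.oip, G2Point.cpsi]
  change _ = S.normSq X * (S.ip ((S.gauge X).cross a b) ((S.gauge X).cross c d) -
    S.ip a c * S.ip b d + S.ip a d * S.ip b c)
  ring

end IsG2
end Pointwise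
end OctKilling
end

noncomputable section

namespace OctKilling

section Pointwise

variable {V : Type*} [AddCommGroup V] [Module ℝ V]

/-! ### Clifford action of 4-forms -/

/-- `G_{bcde} δ^b(δ^c(δ^d(δ^e A)))` for an octonion `A`. -/
def G2Point.cl4 (S : G2Point V) (G : V → V → V → V → ℝ) (A : Oct V) : Oct V :=
  ∑ i, ∑ j, ∑ k, ∑ l, G (S.e i) (S.e j) (S.e k) (S.e l) •
    S.mul (delta (S.e i)) (S.mul (delta (S.e j)) (S.mul (delta (S.e k))
      (S.mul (delta (S.e l)) A)))

/-- `u^a G_{abcd} δ^b(δ^c(δ^d A))` for an octonion `A`. -/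
def G2Point.cl3 (S : G2Point V) (G : V → V → V → V → ℝ) (u : V) (A : Oct V) : Oct V :=
  ∑ i, ∑ j, ∑ k, G u (S.e i) (S.e j) (S.e k) •
    S.mul (delta (S.e i)) (S.mul (delta (S.e j)) (S.mul (delta (S.e k)) A))

lemma G2Point.cliff4_eq (S : G2Point V) (G : V → V → V → V → ℝ) (Z : COct V) :
    S.cliff4 G Z = (S.cl4 G Z.1, S.cl4 G Z.2) := by
  simp only [G2Point.cliff4, G2Point.cl4, G2Point.lmul]
  refine Prod.ext ?_ ?_ <;> simp only [Prod.fst_sum, Prod.snd_sum] <;> rfl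

lemma G2Point.cliff3_eq (S : G2Point V) (G : V → V → V → V → ℝ) (u : V) (Z : COct V) :
    S.cliff3 G u Z = (S.cl3 G u Z.1, S.cl3 G u Z.2) := by
  simp only [G2Point.cliff3, G2Point.cl3, G2Point.lmul]
  refine Prod.ext ?_ ?_ <;> simp only [Prod.fst_sum, Prod.snd_sum] <;> rfl

namespace IsOct

variable {S : G2Point V} (h : IsOct S)
include h

lemma sum_ip_smul (m : V) : ∑ j, S.ip (S.e j) m • S.e j = m := by
  conv_rhs => rw [← h.expand m]
  simp only [h.ip_comm m]

lemma sum_ip_self_smul {W : Type*} [AddCommGroup W] [Module ℝ W] (m : W) :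
    ∑ j, S.ip (S.e j) (S.e j) • m = (7 : ℝ) • m := by
  rw [← Finset.sum_smul, h.sum_ip_self]

lemma sum_ph_smul (m n : V) : ∑ j, S.ph m n (S.e j) • S.e j = S.cross m n := rfl

lemma cross_cross' (m e : V) : S.cross e (S.cross m e) = S.ip e e • m - S.ip e m • e := by
  rw [h.cross_anti e m, h.cross_neg, h.cross_cross]; abel

lemma sum_cross_cross (m : V) : ∑ j, S.cross (S.e j) (S.cross m (S.e j)) = (6 : ℝ) • m := by
  simp only [h.cross_cross', Finset.sum_sub_distrib, h.sum_ip_self_smul, h.sum_ip_smul]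
  module

/-- The polarized identity moves A to the outside of the double product, after which the sum is an
elementary contraction. -/
lemma sum_cross_cross_cross (m A : V) :
    ∑ j, S.cross (S.e j) (S.cross (S.cross m (S.e j)) A) = (-3 : ℝ) • S.cross m A := by
  have key : ∀ e, S.cross e (S.cross (S.cross m e) A) =
      S.ip e e • S.cross A m - S.cross A (S.ip e m • e) - S.ph A m e • e
        + 2 • S.cross m (S.ip e A • e) := by
    intro e
    have h1 := h.cross_cross_polar e A (S.cross m e)
    rw [h.cross_cross', h.ip_cross', h.ip_cross', h.ph_self', h.ph_cyc A m] at h1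
    rw [h.cross_anti A (S.cross m e), h.cross_neg, eq_sub_of_add_eq h1, h.cross_sub, h.cross_smul,
      h.cross_smul, h.cross_smul]
    module
  have hs : ∀ f : Fin 7 → V, ∀ x : V, ∑ j, S.cross x (f j) = S.cross x (∑ j, f j) := fun f x =>
    (map_sum (LinearMap.mk₂ ℝ S.cross h.add_cross h.smul_cross h.cross_add h.cross_smul x) f _).symm
  simp only [key, Finset.sum_add_distrib, Finset.sum_sub_distrib, h.sum_ip_self_smul, hs,
    h.sum_ip_smul, h.sum_ph_smul, ← Finset.smul_sum, h.cross_anti m A]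
  module

/-- `φ(m, b, c) δ^b(δ^c A)`. -/
lemma sum_ph_mul_mul (m : V) (A : Oct V) :
    ∑ j, ∑ k, S.ph m (S.e j) (S.e k) • S.mul (delta (S.e j)) (S.mul (delta (S.e k)) A) =
      (-6 * S.ip m A.2, (6 * A.1) • m - (2 : ℝ) • S.cross m A.2) := by
  have e1 : ∀ j, ∑ k, S.ph m (S.e j) (S.e k) •
      S.mul (delta (S.e j)) (S.mul (delta (S.e k)) A) =
      S.mul (delta (S.e j)) (S.mul (delta (S.cross m (S.e j))) A) := fun j => by
    have := h.contract (h.L (S.e j) ∘ₗ h.L.flip A) (S.cross m (S.e j))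
    simpa only [h.ip_cross] using! this
  simp only [e1]
  have e2 : ∀ e, S.mul (delta e) (S.mul (delta (S.cross m e)) A) =
      (-S.ip (S.cross e (S.cross m e)) A.2, -(S.ph A.2 m e • e) + A.1 • S.cross e (S.cross m e)
        + S.cross e (S.cross (S.cross m e) A.2)) := fun e => by
    refine Prod.ext ?_ ?_
    · simp only [G2Point.mul, delta, h.ip_add', h.ip_smul', h.ip_cross', h.ph_self',
        h.ip_cross]
      rw [h.ph_cyc e]
      ring
    · simp only [G2Point.mul, delta, h.ip_cross, h.cross_add, h.cross_smul, h.ph_cyc A.2 m]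
      module
  simp only [e2]
  refine Prod.ext ?_ ?_
  · simp only [Prod.fst_sum, Finset.sum_neg_distrib, ← h.ip_sum, h.sum_cross_cross, h.ip_smul]
    ring
  · simp only [Prod.snd_sum, Finset.sum_add_distrib, Finset.sum_neg_distrib, ← Finset.smul_sum,
      h.sum_cross_cross, h.sum_cross_cross_cross, h.sum_ph_smul, h.cross_anti m A.2]
    module

lemma sum_mul_mul_mul (a : V) (A : Oct V) :
    ∑ j, S.mul (delta (S.e j)) (S.mul (delta a) (S.mul (delta (S.e j)) A)) =
      (5 : ℝ) • S.mul (delta a) A := by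
  have e1 : ∀ e, S.mul (delta e) (S.mul (delta a) (S.mul (delta e) A)) =
      S.ip e e • S.mul (delta a) A - (2 : ℝ) • S.mul (delta (S.ip e a • e)) A := fun e => by
    rw [h.clifford_apply e a, h.delta_mul_delta_mul, h.mul_smul, h.delta_smul, h.smul_mul]
    module
  have hs : ∑ j, S.mul (delta (S.ip (S.e j) a • S.e j)) A = S.mul (delta a) A := by
    conv_rhs => rw [← h.sum_ip_smul a]
    exact (map_sum (h.L.flip A) (fun j => S.ip (S.e j) a • S.e j) _).symm
  simp only [e1, Finset.sum_sub_distrib, h.sum_ip_self_smul, ← Finset.smul_sum, hs]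
  module

/-- `ψ(a, b, c, d) δ^b(δ^c(δ^d A))`. -/
lemma sum_psi_mul_mul_mul (a : V) (A : Oct V) :
    S.cl3 S.cpsi a A = (24 * S.ip a A.2, (24 * A.1) • a) := by
  -- By its definition, `cpsi` with a, b fixed is φ contracted with a × b plus metric terms; these
  -- are summed separately, and the remaining index is summed afterwards.
  have e1 : ∀ b, ∑ k, ∑ l, S.cpsi a b (S.e k) (S.e l) •
      S.mul (delta (S.e k)) (S.mul (delta (S.e l)) A) =
      (-6 * S.ip (S.cross a b) A.2, (6 * A.1) • S.cross a b - (2 : ℝ) • S.cross (S.cross a b) A.2)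
        - S.mul (delta a) (S.mul (delta b) A) + S.mul (delta b) (S.mul (delta a) A) := fun b => by
    have e2 : ∀ x y : V, ∑ k, ∑ l, (S.ip x (S.e k) * S.ip y (S.e l)) •
        S.mul (delta (S.e k)) (S.mul (delta (S.e l)) A) =
        S.mul (delta x) (S.mul (delta y) A) := fun x y => by
      have f1 : ∀ k, ∑ l, S.ip y (S.e l) • S.mul (delta (S.e k)) (S.mul (delta (S.e l)) A) =
          S.mul (delta (S.e k)) (S.mul (delta y) A) := fun k =>
        h.contract (h.L (S.e k) ∘ₗ h.L.flip A) y
      simp only [SemigroupAction.mul_smul, ← Finset.smul_sum, f1]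
      exact h.contract (h.L.flip (S.mul (delta y) A)) x
    simp only [G2Point.cpsi, add_smul, sub_smul, Finset.sum_add_distrib, Finset.sum_sub_distrib,
      h.ip_cross', h.ph_cyc (S.cross a b), h.sum_ph_mul_mul, e2]
    congr 1
    rw [← e2 b a]
    simp only [mul_comm]
  have e3 : S.cl3 S.cpsi a A = ∑ j, S.mul (delta (S.e j)) (∑ k, ∑ l,
      S.cpsi a (S.e j) (S.e k) (S.e l) • S.mul (delta (S.e k)) (S.mul (delta (S.e l)) A)) := by
    simp only [h.mul_sum, h.mul_smul]; rfl
  rw [e3]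
  simp only [e1, h.mul_add, h.mul_sub, Finset.sum_add_distrib, Finset.sum_sub_distrib,
    h.sum_mul_mul_mul, h.delta_mul_delta_mul, neg_smul, Finset.sum_neg_distrib, h.sum_ip_self_smul]
  have e4 : ∀ e, S.mul (delta e) (-6 * S.ip (S.cross a e) A.2,
      (6 * A.1) • S.cross a e - (2 : ℝ) • S.cross (S.cross a e) A.2) =
      (2 * S.ip (S.cross e (S.cross a e)) A.2, -((6 : ℝ) • (S.ph A.2 a e • e))
        + (6 * A.1) • S.cross e (S.cross a e)
        - (2 : ℝ) • S.cross e (S.cross (S.cross a e) A.2)) := fun e => by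
    refine Prod.ext ?_ ?_
    · simp only [G2Point.mul, delta, h.ip_sub', h.ip_smul', h.ip_cross', h.ph_self', h.ip_cross]
      rw [h.ph_cyc e]
      ring
    · simp only [G2Point.mul, delta, h.ip_cross, h.cross_sub, h.cross_smul, h.ph_cyc A.2 a]
      module
  simp only [e4]
  refine Prod.ext ?_ ?_
  · simp only [Prod.fst_add, Prod.fst_sub, Prod.fst_neg, Prod.smul_fst, Prod.fst_sum,
      ← Finset.mul_sum, ← h.ip_sum, h.sum_cross_cross, h.ip_smul, G2Point.mul, delta, smul_eq_mul]
    ring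
  · simp only [Prod.snd_add, Prod.snd_sub, Prod.snd_neg, Prod.smul_snd, Prod.snd_sum,
      Finset.sum_add_distrib, Finset.sum_sub_distrib, Finset.sum_neg_distrib, ← Finset.smul_sum,
      h.sum_cross_cross, h.sum_cross_cross_cross, h.sum_ph_smul, h.cross_anti a A.2, G2Point.mul,
      delta]
    module

end IsOct
end Pointwise
end OctKilling
end

/-! ### Clifford action of the components 1, 7 and 27 of a 4-form -/

noncomputable section

namespace OctKilling

section Pointwise

variable {V : Type*} [AddCommGroup V] [Module ℝ V]

/-- The operator by which a 4-form with components `Q₀, Q₁, Q₂` acts on octonions, up to a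
factor `144`. -/
def G2Point.pop (S : G2Point V) (Q0 : ℝ) (Q1 : V) (Q2 : V →ₗ[ℝ] V) (A : Oct V) : Oct V :=
  (-(7 / 6) * Q0 * A.1 - (2 / 3) * S.ip Q1 A.2,
    -((2 / 3) * A.1) • Q1 + ((1 / 6) * Q0) • A.2 + (2 / 3 : ℝ) • Q2 A.2)

lemma sum_swap {W : Type*} [AddCommGroup W] [Module ℝ W] (F F' : Fin 7 → Fin 7 → W)
    (H : Fin 7 → W) (hF : ∀ i j, F i j = -F' i j - if i = j then (2 : ℝ) • H i else 0) :
    ∑ i, ∑ j, F i j = -(∑ j, ∑ i, F' i j) - (2 : ℝ) • ∑ i, H i := by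
  rw [Finset.sum_comm (f := fun j i => F' i j)]
  simp [hF, Finset.smul_sum]

lemma sum_rotate {W : Type*} [AddCommGroup W] (F : Fin 7 → Fin 7 → Fin 7 → W) :
    ∑ i, ∑ k, ∑ l, F i k l = ∑ k, ∑ l, ∑ i, F i k l := by
  rw [Finset.sum_comm]
  exact Finset.sum_congr rfl fun k _ => Finset.sum_comm

lemma ite_smul_sum {W ι : Type*} [AddCommGroup W] [Module ℝ W] [Fintype ι] (p : Prop) [Decidable p]
    (f : ι → W) : (if p then (2 : ℝ) • ∑ k, f k else 0) = ∑ k, if p then (2 : ℝ) • f k else 0 := by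
  split_ifs <;> simp [Finset.smul_sum]

namespace IsOct

variable {S : G2Point V} (h : IsOct S)
include h

/-- The coefficients of Q are symmetric and those of B skew, so the contraction equals its own
negative. -/
lemma sum_skew_symm {W : Type*} [AddCommGroup W] [Module ℝ W] (B : V →ₗ[ℝ] V →ₗ[ℝ] W)
    (hB : ∀ u v, B v u = -B u v) (Q : V →ₗ[ℝ] V) (hQ : ∀ u v, S.ip (Q u) v = S.ip u (Q v)) :
    ∑ i, B (S.e i) (Q (S.e i)) = 0 := by
  have e1 : ∑ i, B (S.e i) (Q (S.e i)) =
      ∑ i, ∑ j, S.ip (Q (S.e i)) (S.e j) • B (S.e i) (S.e j) :=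
    Finset.sum_congr rfl fun i _ => (h.contract (B (S.e i)) _).symm
  have e2 : ∑ i, ∑ j, S.ip (Q (S.e i)) (S.e j) • B (S.e i) (S.e j) =
      -∑ i, ∑ j, S.ip (Q (S.e i)) (S.e j) • B (S.e i) (S.e j) := by
    conv_lhs => rw [Finset.sum_comm]
    simp only [← Finset.sum_neg_distrib]
    refine Finset.sum_congr rfl fun i _ => Finset.sum_congr rfl fun j _ => ?_
    rw [hB (S.e i), hQ, h.ip_comm, smul_neg]
  rw [e1]
  have e3 : (2 : ℝ) • ∑ i, ∑ j, S.ip (Q (S.e i)) (S.e j) • B (S.e i) (S.e j) = 0 := by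
    rw [two_smul]; nth_rw 1 [e2]; exact neg_add_cancel _
  exact (smul_eq_zero.mp e3).resolve_left two_ne_zero

lemma cl4_add (t t' : V → V → V → V → ℝ) (A : Oct V) :
    S.cl4 (fun a b c d => t a b c d + t' a b c d) A = S.cl4 t A + S.cl4 t' A := by
  simp only [G2Point.cl4, add_smul, Finset.sum_add_distrib]

lemma cl4_smul (r : ℝ) (t : V → V → V → V → ℝ) (A : Oct V) :
    S.cl4 (fun a b c d => r * t a b c d) A = r • S.cl4 t A := by
  simp only [G2Point.cl4, SemigroupAction.mul_smul, Finset.smul_sum]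

lemma cl4_neg (t : V → V → V → V → ℝ) (A : Oct V) :
    S.cl4 (fun a b c d => -t a b c d) A = -S.cl4 t A := by
  simp only [G2Point.cl4, neg_smul, Finset.sum_neg_distrib]

lemma frame_mul_mul (i j : Fin 7) (A : Oct V) : S.mul (delta (S.e i)) (S.mul (delta (S.e j)) A) =
    -S.mul (delta (S.e j)) (S.mul (delta (S.e i)) A) - (if i = j then (2 : ℝ) else 0) • A := by
  rw [h.clifford_apply, h.orth]; congr 2; split_ifs <;> simp

/-- The Clifford relation for two adjacent factors: their exchange costs a sign and a trace. The
tensor t need not be alternating, so the terms of q♭ ∧ φ and of ι_ψ(Q) can be treated one at a time.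
-/
lemma cl4_swap₁ (t : V → V → V → V → ℝ) (A : Oct V) :
    S.cl4 t A = -S.cl4 (fun a b c d => t b a c d) A - (2 : ℝ) • ∑ k, ∑ l,
      (∑ i, t (S.e i) (S.e i) (S.e k) (S.e l)) • S.mul (delta (S.e k)) (S.mul (delta (S.e l)) A) := by
  have e1 := sum_swap
    (fun i j => ∑ k, ∑ l, t (S.e i) (S.e j) (S.e k) (S.e l) • S.mul (delta (S.e i))
      (S.mul (delta (S.e j)) (S.mul (delta (S.e k)) (S.mul (delta (S.e l)) A))))
    (fun i j => ∑ k, ∑ l, t (S.e i) (S.e j) (S.e k) (S.e l) • S.mul (delta (S.e j))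
      (S.mul (delta (S.e i)) (S.mul (delta (S.e k)) (S.mul (delta (S.e l)) A))))
    (fun i => ∑ k, ∑ l, t (S.e i) (S.e i) (S.e k) (S.e l) •
      S.mul (delta (S.e k)) (S.mul (delta (S.e l)) A)) (fun i j => by
      simp only [← Finset.sum_neg_distrib, ite_smul_sum, ← Finset.sum_sub_distrib]
      refine Finset.sum_congr rfl fun k _ => Finset.sum_congr rfl fun l _ => ?_
      rw [h.frame_mul_mul i j]
      split_ifs with hij
      · subst hij; module
      · module)
  simp only [G2Point.cl4]
  rw [e1, sum_rotate (fun i k l => t (S.e i) (S.e i) (S.e k) (S.e l) •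
    S.mul (delta (S.e k)) (S.mul (delta (S.e l)) A))]
  simp only [Finset.sum_smul]

lemma cl4_swap₂ (t : V → V → V → V → ℝ) (A : Oct V) :
    S.cl4 t A = -S.cl4 (fun a b c d => t a c b d) A - (2 : ℝ) • ∑ k, ∑ l,
      (∑ i, t (S.e k) (S.e i) (S.e i) (S.e l)) • S.mul (delta (S.e k)) (S.mul (delta (S.e l)) A) := by
  have e1 : ∀ i, _ := fun i => sum_swap
    (fun j k => ∑ l, t (S.e i) (S.e j) (S.e k) (S.e l) • S.mul (delta (S.e i))
      (S.mul (delta (S.e j)) (S.mul (delta (S.e k)) (S.mul (delta (S.e l)) A))))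
    (fun j k => ∑ l, t (S.e i) (S.e j) (S.e k) (S.e l) • S.mul (delta (S.e i))
      (S.mul (delta (S.e k)) (S.mul (delta (S.e j)) (S.mul (delta (S.e l)) A))))
    (fun j => ∑ l, t (S.e i) (S.e j) (S.e j) (S.e l) •
      S.mul (delta (S.e i)) (S.mul (delta (S.e l)) A)) (fun j k => by
      simp only [← Finset.sum_neg_distrib, ite_smul_sum, ← Finset.sum_sub_distrib]
      refine Finset.sum_congr rfl fun l _ => ?_
      rw [h.frame_mul_mul j k, h.mul_sub, h.mul_neg, h.mul_smul]
      split_ifs with hij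
      · subst hij; module
      · module)
  simp only [G2Point.cl4]
  simp only [e1, Finset.sum_sub_distrib, Finset.sum_neg_distrib, ← Finset.smul_sum]
  congr 2
  refine Finset.sum_congr rfl fun i _ => ?_
  rw [Finset.sum_comm]
  simp only [Finset.sum_smul]

lemma cl4_swap₃ (t : V → V → V → V → ℝ) (A : Oct V) :
    S.cl4 t A = -S.cl4 (fun a b c d => t a b d c) A - (2 : ℝ) • ∑ k, ∑ l,
      (∑ i, t (S.e k) (S.e l) (S.e i) (S.e i)) • S.mul (delta (S.e k)) (S.mul (delta (S.e l)) A) := by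
  have e1 : ∀ i j, _ := fun i j => sum_swap
    (fun k l => t (S.e i) (S.e j) (S.e k) (S.e l) • S.mul (delta (S.e i))
      (S.mul (delta (S.e j)) (S.mul (delta (S.e k)) (S.mul (delta (S.e l)) A))))
    (fun k l => t (S.e i) (S.e j) (S.e k) (S.e l) • S.mul (delta (S.e i))
      (S.mul (delta (S.e j)) (S.mul (delta (S.e l)) (S.mul (delta (S.e k)) A))))
    (fun k => t (S.e i) (S.e j) (S.e k) (S.e k) •
      S.mul (delta (S.e i)) (S.mul (delta (S.e j)) A)) (fun k l => by
      rw [h.frame_mul_mul k l, h.mul_sub, h.mul_sub, h.mul_neg, h.mul_neg, h.mul_smul, h.mul_smul]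
      split_ifs with hij
      · subst hij; module
      · module)
  simp only [G2Point.cl4]
  simp only [e1, Finset.sum_sub_distrib, Finset.sum_neg_distrib, ← Finset.smul_sum,
    Finset.sum_smul]

lemma cl4_eq_sum_cl3 (t : V → V → V → V → ℝ) (A : Oct V) :
    S.cl4 t A = ∑ i, S.mul (delta (S.e i)) (S.cl3 t (S.e i) A) := by
  simp only [G2Point.cl3, h.mul_sum, h.mul_smul]; rfl

lemma cl4_cpsi (A : Oct V) : S.cl4 S.cpsi A = (-168 * A.1, (24 : ℝ) • A.2) := by
  have e : ∀ e, S.mul (delta e) (24 * S.ip e A.2, (24 * A.1) • e) =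
      (-(24 * A.1) * S.ip e e, (24 : ℝ) • (S.ip e A.2 • e)) := fun e => by
    refine Prod.ext ?_ ?_
    · simp only [G2Point.mul, delta, h.ip_smul']; ring
    · simp only [G2Point.mul, delta, h.cross_smul, h.cross_self]; module
  simp only [h.cl4_eq_sum_cl3, h.sum_psi_mul_mul_mul, e]
  refine Prod.ext ?_ ?_
  · simp only [Prod.fst_sum, ← Finset.mul_sum, h.sum_ip_self]; ring
  · simp only [Prod.snd_sum, ← Finset.smul_sum, h.sum_ip_smul]

/-- Contracting the last three slots with ψ leaves one sum over e_i. Its real part is the trace of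
Q, and its cross product part vanishes because Q is symmetric. -/
lemma cl4_cpsi_endo (Q : V →ₗ[ℝ] V) (hQ : ∀ u v, S.ip (Q u) v = S.ip u (Q v))
    (htr : ∑ i, S.ip (Q (S.e i)) (S.e i) = 0) (A : Oct V) :
    S.cl4 (fun a b c d => S.cpsi (Q a) b c d) A = (0, (24 : ℝ) • Q A.2) := by
  have e0 : ∀ a, S.cl3 (fun a b c d => S.cpsi (Q a) b c d) a A = S.cl3 S.cpsi (Q a) A :=
    fun a => rfl
  have e : ∀ e, S.mul (delta e) (24 * S.ip (Q e) A.2, (24 * A.1) • Q e) =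
      (-(24 * A.1) * S.ip (Q e) e, (24 : ℝ) • (S.ip e (Q A.2) • e) +
        (24 * A.1) • S.cross e (Q e)) := fun e => by
    refine Prod.ext ?_ ?_
    · simp only [G2Point.mul, delta, h.ip_smul', h.ip_comm e]; ring
    · simp only [G2Point.mul, delta, h.cross_smul, hQ]; module
  have e2 : ∑ i, S.cross (S.e i) (Q (S.e i)) = 0 :=
    h.sum_skew_symm (LinearMap.mk₂ ℝ S.cross h.add_cross h.smul_cross h.cross_add h.cross_smul)
      (fun u v => h.cross_anti u v) Q hQ
  simp only [h.cl4_eq_sum_cl3, e0, h.sum_psi_mul_mul_mul, e]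
  refine Prod.ext ?_ ?_
  · simp only [Prod.fst_sum, ← Finset.mul_sum, htr]; ring
  · simp only [Prod.snd_sum, Finset.sum_add_distrib, ← Finset.smul_sum, h.sum_ip_smul, e2]
    simp

lemma cpsi_add₂ (a b b' c d : V) : S.cpsi a (b + b') c d = S.cpsi a b c d + S.cpsi a b' c d := by
  rw [h.cpsi_swap, h.cpsi_add, h.cpsi_swap a b, h.cpsi_swap a b']; ring

lemma cpsi_smul₂ (r : ℝ) (a b c d : V) : S.cpsi a (r • b) c d = r * S.cpsi a b c d := by
  rw [h.cpsi_swap, h.cpsi_smul, h.cpsi_swap a b]; ring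

lemma sum_cpsi_endo (Q : V →ₗ[ℝ] V) (hQ : ∀ u v, S.ip (Q u) v = S.ip u (Q v)) (c d : V) :
    ∑ i, S.cpsi (S.e i) (Q (S.e i)) c d = 0 :=
  h.sum_skew_symm (LinearMap.mk₂ ℝ (fun a b => S.cpsi a b c d) (fun _ _ _ => h.cpsi_add _ _ _ _ _)
      (fun _ _ _ => h.cpsi_smul _ _ _ _ _) (fun _ _ _ => h.cpsi_add₂ _ _ _ _ _)
      (fun _ _ _ => h.cpsi_smul₂ _ _ _ _ _))
    (fun u v => h.cpsi_swap u v c d) Q hQ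

/-- The four terms act identically: the traces in the swap formulas contract ψ with a symmetric
endomorphism and vanish. Hence 96 = 4 · 24. -/
lemma cl4_iota (Q : V →ₗ[ℝ] V) (hQ : ∀ u v, S.ip (Q u) v = S.ip u (Q v))
    (htr : ∑ i, S.ip (Q (S.e i)) (S.e i) = 0) (A : Oct V) :
    S.cl4 (fun a b c d => S.cpsi (Q a) b c d + S.cpsi a (Q b) c d + S.cpsi a b (Q c) d
      + S.cpsi a b c (Q d)) A = (0, (96 : ℝ) • Q A.2) := by
  have t2 : S.cl4 (fun a b c d => S.cpsi a (Q b) c d) A =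
      S.cl4 (fun a b c d => S.cpsi (Q a) b c d) A := by
    rw [h.cl4_swap₁]
    simp only [h.sum_cpsi_endo Q hQ, zero_smul, Finset.sum_const_zero, smul_zero, sub_zero]
    simp only [fun a b c d => h.cpsi_swap (Q a) b c d, h.cl4_neg, neg_neg]
  have t3 : S.cl4 (fun a b c d => S.cpsi a b (Q c) d) A =
      S.cl4 (fun a b c d => S.cpsi a (Q b) c d) A := by
    rw [h.cl4_swap₂]
    have e : ∀ a b d, S.cpsi a b (Q b) d = -S.cpsi b (Q b) d a := fun a b d => by
      rw [h.cpsi_cyc a b (Q b) d, neg_neg]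
    simp only [e, Finset.sum_neg_distrib, h.sum_cpsi_endo Q hQ,
      fun a b c d => h.cpsi_swap₂ a (Q b) c d, h.cl4_neg]
    simp
  have t4 : S.cl4 (fun a b c d => S.cpsi a b c (Q d)) A =
      S.cl4 (fun a b c d => S.cpsi a b (Q c) d) A := by
    rw [h.cl4_swap₃]
    have e : ∀ a b d, S.cpsi a d b (Q b) = S.cpsi b (Q b) a d := fun a b d => by
      rw [h.cpsi_cyc, h.cpsi_cyc]; ring
    simp only [e, Finset.sum_neg_distrib, h.sum_cpsi_endo Q hQ,
      fun a b c d => h.cpsi_swap₃ a b (Q c) d, h.cl4_neg]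
    simp
  rw [h.cl4_add, h.cl4_add, h.cl4_add, t4, t3, t2, h.cl4_cpsi_endo Q hQ htr]
  refine Prod.ext ?_ ?_
  · simp
  · simp only [Prod.snd_add]; module

/-- The term q_a φ_{bcd} acts as δ_q after the action of φ, which is −42 on real and 6 on imaginary
octonions. Each further term differs from the previous one by twice the action of q ⌟ φ; in the
total the cross products with q cancel. -/
lemma cl4_wedge (q : V) (A : Oct V) :
    S.cl4 (S.wedgePhi q) A = (-96 * S.ip q A.2, -(96 * A.1) • q) := by
  have ce : ∀ m n, ∑ i, S.ip q (S.e i) * S.ph m n (S.e i) = S.ph m n q := fun m n =>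
    h.contract (h.phl m n) q
  have om := h.sum_ph_mul_mul q A
  have t1 : S.cl4 (fun a b c d => S.ip q a * S.ph b c d) A =
      S.mul (delta q) (-42 * A.1, (6 : ℝ) • A.2) := by
    have e1 : S.cl4 (fun a b c d => S.ip q a * S.ph b c d) A =
        ∑ i, S.ip q (S.e i) • S.mul (delta (S.e i)) (∑ j, S.mul (delta (S.e j)) (∑ k, ∑ l,
          S.ph (S.e j) (S.e k) (S.e l) • S.mul (delta (S.e k)) (S.mul (delta (S.e l)) A))) := by
      simp only [G2Point.cl4, h.mul_sum, h.mul_smul, Finset.smul_sum, SemigroupAction.mul_smul]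
    have e2 : ∀ e, S.mul (delta e) (-6 * S.ip e A.2, (6 * A.1) • e - (2 : ℝ) • S.cross e A.2) =
        (-(6 * A.1) * S.ip e e, -((8 : ℝ) • (S.ip e A.2 • e)) + S.ip e e • (2 : ℝ) • A.2) :=
        fun e => by
      refine Prod.ext ?_ ?_
      · simp only [G2Point.mul, delta, h.ip_sub', h.ip_smul', h.ip_cross', h.ph_swap' e e,
          h.ph_self]
        ring
      · simp only [G2Point.mul, delta, h.cross_sub, h.cross_smul, h.cross_self, h.cross_cross]
        module
    have e3 : ∑ j, S.mul (delta (S.e j)) (∑ k, ∑ l,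
        S.ph (S.e j) (S.e k) (S.e l) • S.mul (delta (S.e k)) (S.mul (delta (S.e l)) A)) =
        (-42 * A.1, (6 : ℝ) • A.2) := by
      simp only [h.sum_ph_mul_mul, e2]
      refine Prod.ext ?_ ?_
      · simp only [Prod.fst_sum, ← Finset.mul_sum, h.sum_ip_self]; ring
      · simp only [Prod.snd_sum, Finset.sum_add_distrib, Finset.sum_neg_distrib,
          ← Finset.smul_sum, h.sum_ip_smul, h.sum_ip_self_smul]
        module
    rw [e1, e3]
    exact h.contract (h.L.flip _) q
  have t2 : S.cl4 (fun a b c d => -(S.ip q b * S.ph a c d)) A =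
      S.cl4 (fun a b c d => S.ip q a * S.ph b c d) A + (2 : ℝ) • (-6 * S.ip q A.2,
        (6 * A.1) • q - (2 : ℝ) • S.cross q A.2) := by
    rw [h.cl4_swap₁]
    have e : ∀ c d, ∑ i, -(S.ip q (S.e i) * S.ph (S.e i) c d) = -S.ph q c d := fun c d => by
      simp only [Finset.sum_neg_distrib, ← fun x => h.ph_cyc x c d, ce c d]
    simp only [e, neg_smul, Finset.sum_neg_distrib, om, h.cl4_neg]
    module
  have t3 : S.cl4 (fun a b c d => S.ip q c * S.ph a b d) A =
      S.cl4 (fun a b c d => -(S.ip q b * S.ph a c d)) A + (2 : ℝ) • (-6 * S.ip q A.2,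
        (6 * A.1) • q - (2 : ℝ) • S.cross q A.2) := by
    rw [h.cl4_swap₂]
    have e : ∀ c d, ∑ i, S.ip q (S.e i) * S.ph c (S.e i) d = -S.ph q c d := fun c d => by
      simp only [h.ph_swap' c d, _root_.mul_neg, Finset.sum_neg_distrib, ce c d, h.ph_cyc q c d]
    simp only [e, neg_smul, Finset.sum_neg_distrib, om, h.cl4_neg]
    module
  have t4 : S.cl4 (fun a b c d => -(S.ip q d * S.ph a b c)) A =
      S.cl4 (fun a b c d => S.ip q c * S.ph a b d) A + (2 : ℝ) • (-6 * S.ip q A.2,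
        (6 * A.1) • q - (2 : ℝ) • S.cross q A.2) := by
    rw [h.cl4_swap₃]
    have e : ∀ c d, ∑ i, -(S.ip q (S.e i) * S.ph c d (S.e i)) = -S.ph q c d := fun c d => by
      simp only [Finset.sum_neg_distrib, ce c d, h.ph_cyc q c d]
    simp only [e, neg_smul, Finset.sum_neg_distrib, om, h.cl4_neg]
    module
  have t5 : S.cl4 (S.wedgePhi q) A = S.cl4 (fun a b c d => S.ip q a * S.ph b c d) A +
      S.cl4 (fun a b c d => -(S.ip q b * S.ph a c d)) A +
      S.cl4 (fun a b c d => S.ip q c * S.ph a b d) A +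
      S.cl4 (fun a b c d => -(S.ip q d * S.ph a b c)) A := by
    rw [← h.cl4_add, ← h.cl4_add, ← h.cl4_add]
    congr 1
  rw [t5, t4, t3, t2, t1]
  refine Prod.ext ?_ ?_
  · simp only [Prod.fst_add, Prod.smul_fst, G2Point.mul, delta, h.ip_smul', smul_eq_mul]; ring
  · simp only [Prod.snd_add, Prod.smul_snd, G2Point.mul, delta, h.cross_smul]; module

end IsOct

/-- The eigenvalues −168 and 24 of ψ and the factor 96 of the two other components, divided by 144,
are the coefficients in `pop`; the 144 cancels the 1/144 in the Killing equations. -/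
lemma IsG2.cl4_eq {S : G2Point V} (h : IsG2 S) {G : V → V → V → V → ℝ} {Q0 : ℝ} {Q1 : V}
    {Q2 : V →ₗ[ℝ] V} (hG : S.IsFourFormDecomp G Q0 Q1 Q2) (A : Oct V) :
    S.cl4 G A = (144 : ℝ) • S.pop Q0 Q1 Q2 A := by
  have hp : S.psi = S.cpsi := by funext a b c d; exact h.psi_eq a b c d
  have e : G = fun a b c d => Q0 * S.cpsi a b c d + S.wedgePhi Q1 a b c d +
      (S.cpsi (Q2 a) b c d + S.cpsi a (Q2 b) c d + S.cpsi a b (Q2 c) d + S.cpsi a b c (Q2 d)) := by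
    funext a b c d
    rw [hG.eq, G2Point.iotaPsi, hp]; ring
  rw [e, h.cl4_add, h.cl4_add, h.cl4_smul, h.cl4_cpsi, h.cl4_wedge,
    h.cl4_iota Q2 hG.symm hG.traceless]
  refine Prod.ext ?_ ?_
  · simp only [G2Point.pop, Prod.fst_add, Prod.smul_fst, smul_eq_mul]; ring
  · simp only [G2Point.pop, Prod.snd_add, Prod.smul_snd]; module

end Pointwise
end OctKilling
end

/-! ### Faithfulness of the Clifford action and existence of the components -/

noncomputable section

namespace OctKilling

section Pointwise

variable {V : Type*} [AddCommGroup V] [Module ℝ V]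

/-- Alternating 4-forms as functions of four vectors. -/
structure IsAlt4 (G : V → V → V → V → ℝ) : Prop where
  add : ∀ a a' b c d, G (a + a') b c d = G a b c d + G a' b c d
  smul : ∀ (r : ℝ) a b c d, G (r • a) b c d = r * G a b c d
  swap₁ : ∀ a b c d, G b a c d = -G a b c d
  swap₂ : ∀ a b c d, G a c b d = -G a b c d
  swap₃ : ∀ a b c d, G a b d c = -G a b c d

namespace IsAlt4

variable {G G' : V → V → V → V → ℝ} (hG : IsAlt4 G) (hG' : IsAlt4 G')
include hG

lemma add₂ (a b b' c d : V) : G a (b + b') c d = G a b c d + G a b' c d := by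
  rw [hG.swap₁, hG.add, hG.swap₁ a b, hG.swap₁ a b']; ring

lemma smul₂ (r : ℝ) (a b c d : V) : G a (r • b) c d = r * G a b c d := by
  rw [hG.swap₁, hG.smul, hG.swap₁ a b]; ring

lemma add₃ (a b c c' d : V) : G a b (c + c') d = G a b c d + G a b c' d := by
  rw [hG.swap₂, hG.add₂, hG.swap₂ a b c, hG.swap₂ a b c']; ring

lemma smul₃ (r : ℝ) (a b c d : V) : G a b (r • c) d = r * G a b c d := by
  rw [hG.swap₂, hG.smul₂, hG.swap₂ a b c]; ring

lemma add₄ (a b c d d' : V) : G a b c (d + d') = G a b c d + G a b c d' := by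
  rw [hG.swap₃, hG.add₃, hG.swap₃ a b c d, hG.swap₃ a b c d']; ring

lemma smul₄ (r : ℝ) (a b c d : V) : G a b c (r • d) = r * G a b c d := by
  rw [hG.swap₃, hG.smul₃, hG.swap₃ a b c d]; ring

lemma self₁ (a c d : V) : G a a c d = 0 := by
  have := hG.swap₁ a a c d; linarith

include hG'

lemma add_form : IsAlt4 fun a b c d => G a b c d + G' a b c d where
  add a a' b c d := by rw [hG.add, hG'.add]; ring
  smul r a b c d := by rw [hG.smul, hG'.smul]; ring
  swap₁ a b c d := by rw [hG.swap₁ a b, hG'.swap₁ a b]; ring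
  swap₂ a b c d := by rw [hG.swap₂ a b, hG'.swap₂ a b]; ring
  swap₃ a b c d := by rw [hG.swap₃ a b, hG'.swap₃ a b]; ring

omit hG' in
lemma smul_form (r : ℝ) : IsAlt4 fun a b c d => r * G a b c d where
  add a a' b c d := by rw [hG.add]; ring
  smul s a b c d := by rw [hG.smul]; ring
  swap₁ a b c d := by rw [hG.swap₁ a b]; ring
  swap₂ a b c d := by rw [hG.swap₂ a b]; ring
  swap₃ a b c d := by rw [hG.swap₃ a b]; ring

end IsAlt4

/-- Partial Clifford contractions of a 4-form. -/
def G2Point.cl1 (S : G2Point V) (G : V → V → V → V → ℝ) (a b c : V) (A : Oct V) : Oct V :=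
  ∑ l, G a b c (S.e l) • S.mul (delta (S.e l)) A

/-- Partial Clifford contractions of a 4-form. -/
def G2Point.cl2 (S : G2Point V) (G : V → V → V → V → ℝ) (a b : V) (A : Oct V) : Oct V :=
  ∑ k, S.mul (delta (S.e k)) (S.cl1 G a b (S.e k) A)

namespace IsOct

variable {S : G2Point V} (h : IsOct S) {G : V → V → V → V → ℝ} (hG : IsAlt4 G)
include h

lemma cl3_eq (a : V) (A : Oct V) :
    S.cl3 G a A = ∑ j, S.mul (delta (S.e j)) (S.cl2 G a (S.e j) A) := by
  simp only [G2Point.cl3, G2Point.cl2, G2Point.cl1, h.mul_sum, h.mul_smul]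

include hG

lemma contract_smul {W : Type*} [AddCommGroup W] [Module ℝ W] (f : V → W)
    (hadd : ∀ u v, f (u + v) = f u + f v) (hsmul : ∀ (r : ℝ) u, f (r • u) = r • f u) (v : V) :
    ∑ i, S.ip v (S.e i) • f (S.e i) = f v :=
  h.contract { toFun := f, map_add' := hadd, map_smul' := hsmul } v

lemma cl1_add (a b c c' : V) (A : Oct V) :
    S.cl1 G a b (c + c') A = S.cl1 G a b c A + S.cl1 G a b c' A := by
  simp only [G2Point.cl1, hG.add₃, add_smul, Finset.sum_add_distrib]

lemma cl1_smul (r : ℝ) (a b c : V) (A : Oct V) :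
    S.cl1 G a b (r • c) A = r • S.cl1 G a b c A := by
  simp only [G2Point.cl1, hG.smul₃, SemigroupAction.mul_smul, Finset.smul_sum]

lemma cl2_add (a b b' : V) (A : Oct V) :
    S.cl2 G a (b + b') A = S.cl2 G a b A + S.cl2 G a b' A := by
  simp only [G2Point.cl2, G2Point.cl1, hG.add₂, add_smul, Finset.sum_add_distrib, h.mul_add]

lemma cl2_smul (r : ℝ) (a b : V) (A : Oct V) :
    S.cl2 G a (r • b) A = r • S.cl2 G a b A := by
  simp only [G2Point.cl2, G2Point.cl1, hG.smul₂, SemigroupAction.mul_smul, ← Finset.smul_sum,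
    h.mul_smul]

lemma cl3_add (b b' : V) (A : Oct V) :
    S.cl3 G (b + b') A = S.cl3 G b A + S.cl3 G b' A := by
  simp only [G2Point.cl3, hG.add, add_smul, Finset.sum_add_distrib]

lemma cl3_smul (r : ℝ) (b : V) (A : Oct V) : S.cl3 G (r • b) A = r • S.cl3 G b A := by
  simp only [G2Point.cl3, hG.smul, SemigroupAction.mul_smul, ← Finset.smul_sum]

lemma cl1_swap (a b c : V) (A : Oct V) : S.cl1 G a c b A = -S.cl1 G a b c A := by
  simp only [G2Point.cl1, hG.swap₂ a b c, neg_smul, Finset.sum_neg_distrib]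

lemma cl2_swap (a b : V) (A : Oct V) : S.cl2 G b a A = -S.cl2 G a b A := by
  simp only [G2Point.cl2, G2Point.cl1, hG.swap₁ a b, neg_smul, Finset.sum_neg_distrib, h.mul_neg]

lemma sum_mul_mul_frame (v : V) (f : V → Oct V) (hadd : ∀ u v, f (u + v) = f u + f v)
    (hsmul : ∀ (r : ℝ) u, f (r • u) = r • f u) :
    S.mul (delta v) (∑ k, S.mul (delta (S.e k)) (f (S.e k))) =
      -(∑ k, S.mul (delta (S.e k)) (S.mul (delta v) (f (S.e k)))) - (2 : ℝ) • f v := by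
  have e : ∀ k, S.mul (delta v) (S.mul (delta (S.e k)) (f (S.e k))) =
      -S.mul (delta (S.e k)) (S.mul (delta v) (f (S.e k)))
        - (2 : ℝ) • (S.ip v (S.e k) • f (S.e k)) := fun k => by
    rw [h.clifford_apply]; module
  simp only [h.mul_sum, e, Finset.sum_sub_distrib, Finset.sum_neg_distrib, ← Finset.smul_sum,
    h.contract_smul hG f hadd hsmul]

/-- The first of four steps: moving δ_v past a contraction of degree k costs the sign (−1)^k and 2k
times the contraction with v in one more slot, for k = 1, …, 4. -/
lemma mul_cl1 (v a b c : V) (A : Oct V) : S.mul (delta v) (S.cl1 G a b c A) =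
    -S.cl1 G a b c (S.mul (delta v) A) - (2 * G a b c v) • A := by
  have e : ∀ l, S.mul (delta v) (G a b c (S.e l) • S.mul (delta (S.e l)) A) =
      -(G a b c (S.e l) • S.mul (delta (S.e l)) (S.mul (delta v) A))
        - (2 : ℝ) • (S.ip v (S.e l) • (G a b c (S.e l) • A)) := fun l => by
    rw [h.mul_smul, h.clifford_apply]; module
  simp only [G2Point.cl1, h.mul_sum, e, Finset.sum_sub_distrib, Finset.sum_neg_distrib,
    ← Finset.smul_sum]
  rw [h.contract_smul hG (fun x => G a b c x • A) (fun u v => by rw [hG.add₄, add_smul])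
    (fun r u => by rw [hG.smul₄, SemigroupAction.mul_smul])]
  module

lemma mul_cl2 (v a b : V) (A : Oct V) : S.mul (delta v) (S.cl2 G a b A) =
    S.cl2 G a b (S.mul (delta v) A) - (4 : ℝ) • S.cl1 G a b v A := by
  rw [G2Point.cl2, h.sum_mul_mul_frame hG v (fun x => S.cl1 G a b x A)
    (fun u v => h.cl1_add hG a b u v A) (fun r u => h.cl1_smul hG r a b u A)]
  simp only [h.mul_cl1 hG v, h.mul_sub, h.mul_neg, h.mul_smul, Finset.sum_sub_distrib,
    Finset.sum_neg_distrib]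
  have e : ∑ k, (2 * G a b (S.e k) v) • S.mul (delta (S.e k)) A = (-2 : ℝ) • S.cl1 G a b v A := by
    simp only [G2Point.cl1, Finset.smul_sum, hG.swap₃ a b v]
    exact Finset.sum_congr rfl fun k _ => by module
  rw [e, ← G2Point.cl2]
  module

lemma mul_cl3 (v a : V) (A : Oct V) : S.mul (delta v) (S.cl3 G a A) =
    -S.cl3 G a (S.mul (delta v) A) - (6 : ℝ) • S.cl2 G a v A := by
  rw [h.cl3_eq, h.cl3_eq, h.sum_mul_mul_frame hG v (fun x => S.cl2 G a x A)
    (fun u v => h.cl2_add hG a u v A) (fun r u => h.cl2_smul hG r a u A)]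
  simp only [h.mul_cl2 hG v, h.mul_sub, h.mul_neg, h.mul_smul, Finset.sum_sub_distrib,
    Finset.sum_neg_distrib, h.cl1_swap hG a v, ← Finset.smul_sum]
  rw [← G2Point.cl2]
  module

/-- The commutator of a vector and a 4-form in the Clifford algebra. -/
lemma mul_cl4 (v : V) (A : Oct V) : S.mul (delta v) (S.cl4 G A) =
    S.cl4 G (S.mul (delta v) A) - (8 : ℝ) • S.cl3 G v A := by
  rw [h.cl4_eq_sum_cl3, h.cl4_eq_sum_cl3, h.sum_mul_mul_frame hG v (fun x => S.cl3 G x A)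
    (fun u v => h.cl3_add hG u v A) (fun r u => h.cl3_smul hG r u A)]
  simp only [h.mul_cl3 hG v, h.mul_sub, h.mul_neg, h.mul_smul, Finset.sum_sub_distrib,
    Finset.sum_neg_distrib, h.cl2_swap hG v, ← Finset.smul_sum]
  rw [← h.cl3_eq]
  module

/-- Commuting with vectors fills the slots of G one at a time; after four steps the scalar G(a, b,
c, d) itself must vanish. So a 4-form is determined by its action on octonions. -/
lemma eq_zero_of_cl4 (H : ∀ A, S.cl4 G A = 0) (a b c d : V) : G a b c d = 0 := by
  have h3 : ∀ v A, S.cl3 G v A = 0 := fun v A => by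
    have := h.mul_cl4 hG v A
    rw [H, H, h.mul_zero, zero_sub, zero_eq_neg] at this
    exact (smul_eq_zero.mp this).resolve_left (by norm_num)
  have h2 : ∀ a v A, S.cl2 G a v A = 0 := fun a v A => by
    have := h.mul_cl3 hG v a A
    rw [h3, h3, h.mul_zero, neg_zero, zero_sub, zero_eq_neg] at this
    exact (smul_eq_zero.mp this).resolve_left (by norm_num)
  have h1 : ∀ a b v A, S.cl1 G a b v A = 0 := fun a b v A => by
    have := h.mul_cl2 hG v a b A
    rw [h2, h2, h.mul_zero, zero_sub, zero_eq_neg] at this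
    exact (smul_eq_zero.mp this).resolve_left (by norm_num)
  have h0 := h.mul_cl1 hG d a b c (1, 0)
  rw [h1, h1, h.mul_zero, neg_zero, zero_sub, zero_eq_neg] at h0
  have := congrArg Prod.fst h0
  simpa using this

/-- Each of the four left multiplications is skew, so the adjoint reverses their order without sign;
reversing four indices is an even permutation. -/
lemma cl4_oip (A B : Oct V) : S.oip (S.cl4 G A) B = S.oip A (S.cl4 G B) := by
  have hr : ∀ F : Fin 7 → Fin 7 → Fin 7 → Fin 7 → ℝ,
      ∑ i, ∑ j, ∑ k, ∑ l, F i j k l = ∑ i, ∑ j, ∑ k, ∑ l, F l k j i := fun F => by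
    have e1 : ∀ f : Fin 7 → Fin 7 → Fin 7 → ℝ, ∑ i, ∑ j, ∑ k, f i j k = ∑ k, ∑ j, ∑ i, f i j k :=
      fun f => by
        rw [Finset.sum_comm]
        exact (Finset.sum_congr rfl fun j _ => Finset.sum_comm).trans Finset.sum_comm
    simp only [fun i => e1 (fun j k l => F i j k l)]
    rw [Finset.sum_comm]
    refine Finset.sum_congr rfl fun l _ => ?_
    rw [Finset.sum_comm]
    refine Finset.sum_congr rfl fun k _ => ?_
    rw [Finset.sum_comm]
  have hs : ∀ a b c d, G d c b a = G a b c d := fun a b c d => by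
    rw [hG.swap₁ c d, hG.swap₂ c b d, hG.swap₃ c b a, hG.swap₁ b c, hG.swap₂ b a c, hG.swap₁ a b]
    ring
  simp only [G2Point.cl4, h.oip_sum, h.oip_sum', h.oip_smul, h.oip_smul', h.oip_L]
  rw [hr]
  refine Finset.sum_congr rfl fun i _ => Finset.sum_congr rfl fun j _ =>
    Finset.sum_congr rfl fun k _ => Finset.sum_congr rfl fun l _ => ?_
  rw [hs]; ring

/-- Conjugating a Clifford element of degree 4 by the seven frame vectors returns the element
itself. Its real part at A = 1 says that the operator is traceless. -/
lemma sum_mul_cl4_mul (A : Oct V) :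
    ∑ i, S.mul (delta (S.e i)) (S.cl4 G (S.mul (delta (S.e i)) A)) = S.cl4 G A := by
  have hn : ∀ B, S.cl4 G (-B) = -S.cl4 G B := fun B => by
    simp only [G2Point.cl4, h.mul_neg, smul_neg, Finset.sum_neg_distrib]
  have hm : ∀ (r : ℝ) B, S.cl4 G (r • B) = r • S.cl4 G B := fun r B => by
    simp only [G2Point.cl4, h.mul_smul, Finset.smul_sum, smul_comm r]
  have e : ∀ e, S.mul (delta e) (S.cl4 G (S.mul (delta e) A)) =
      -(S.ip e e • S.cl4 G A) + (8 : ℝ) • S.mul (delta e) (S.cl3 G e A) := fun e => by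
    have e1 := h.mul_cl3 hG e e A
    have e2 : S.cl2 G e e A = 0 := by
      simp only [G2Point.cl2, G2Point.cl1, hG.self₁, zero_smul, Finset.sum_const_zero, h.mul_zero]
    rw [h.mul_cl4 hG, h.delta_mul_delta_mul, e1, e2, neg_smul, hn, hm]
    module
  simp only [e, Finset.sum_add_distrib, Finset.sum_neg_distrib, h.sum_ip_self_smul,
    ← Finset.smul_sum, ← h.cl4_eq_sum_cl3]
  module

omit hG in
lemma isAlt4_cpsi : IsAlt4 S.cpsi :=
  ⟨h.cpsi_add, h.cpsi_smul, h.cpsi_swap, h.cpsi_swap₂, h.cpsi_swap₃⟩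

omit hG in
lemma isAlt4_wedge (q : V) : IsAlt4 (S.wedgePhi q) where
  add a a' b c d := by simp only [G2Point.wedgePhi, h.ip_add', h.ph_add]; ring
  smul r a b c d := by simp only [G2Point.wedgePhi, h.ip_smul', h.ph_smul]; ring
  swap₁ a b c d := by simp only [G2Point.wedgePhi, h.ph_swap a b]; ring
  swap₂ a b c d := by simp only [G2Point.wedgePhi, h.ph_swap b c, h.ph_swap' a b c]; ring
  swap₃ a b c d := by simp only [G2Point.wedgePhi, h.ph_swap' _ c d]; ring

omit h in
lemma _root_.OctKilling.IsAlt4.derivation (Q : V →ₗ[ℝ] V) :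
    IsAlt4 fun a b c d => G (Q a) b c d + G a (Q b) c d + G a b (Q c) d + G a b c (Q d) where
  add a a' b c d := by simp only [map_add, hG.add]; ring
  smul r a b c d := by simp only [map_smul, hG.smul]; ring
  swap₁ a b c d := by
    simp only [hG.swap₁ (Q a) b, hG.swap₁ a (Q b), hG.swap₁ a b]; ring
  swap₂ a b c d := by
    simp only [hG.swap₂ _ (Q b) c, hG.swap₂ _ b (Q c), hG.swap₂ _ b c]; ring
  swap₃ a b c d := by
    simp only [hG.swap₃ _ _ (Q c) d, hG.swap₃ _ _ c (Q d), hG.swap₃ _ _ c d]; ring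

end IsOct

/-- Every 4-form has components `Q₀, Q₁, Q₂`. -/
lemma IsG2.exists_fourFormDecomp {S : G2Point V} (h : IsG2 S) {G : V → V → V → V → ℝ}
    (hG : IsAlt4 G) : ∃ Q0 Q1 Q2, S.IsFourFormDecomp G Q0 Q1 Q2 := by
  have hadd : ∀ A B, S.cl4 G (A + B) = S.cl4 G A + S.cl4 G B := fun A B => by
    simp only [G2Point.cl4, h.mul_add, smul_add, Finset.sum_add_distrib]
  have hsmul : ∀ (r : ℝ) A, S.cl4 G (r • A) = r • S.cl4 G A := fun r A => by
    simp only [G2Point.cl4, h.mul_smul, Finset.smul_sum, smul_comm r]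
  -- The components are read off from the action on 1 and on δ_v by inverting `cl4_eq`: −168 and −96
  -- are the factors on 1, and on δ_v the part 24 Q₀ v is removed before dividing by 96.
  let Q0 : ℝ := -(1 / 168) * (S.cl4 G (1, 0)).1
  let Q1 : V := (-(1 / 96) : ℝ) • (S.cl4 G (1, 0)).2
  let Q2 : V →ₗ[ℝ] V :=
    { toFun := fun v => (1 / 96 : ℝ) • (S.cl4 G (delta v)).2 - ((1 / 4) * Q0) • v
      map_add' := fun u v => by simp only [h.delta_add, hadd, Prod.snd_add]; module
      map_smul' := fun r v => by
        simp only [h.delta_smul, hsmul, Prod.smul_snd, RingHom.id_apply]; module }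
  have hQ2 : ∀ v, Q2 v = (1 / 96 : ℝ) • (S.cl4 G (delta v)).2 - ((1 / 4) * Q0) • v := fun v => rfl
  have hsym : ∀ u v, S.ip (Q2 u) v = S.ip u (Q2 v) := fun u v => by
    have := h.cl4_oip hG (delta u) (delta v)
    rw [h.oip_delta, h.oip_delta_left] at this
    simp only [hQ2, h.ip_sub, h.ip_sub', h.ip_smul, h.ip_smul', this]
  have htr : ∑ i, S.ip (Q2 (S.e i)) (S.e i) = 0 := by
    have e1 := congrArg Prod.fst (h.sum_mul_cl4_mul hG (1, 0))
    have e2 : ∀ i, (S.mul (delta (S.e i)) (S.cl4 G (S.mul (delta (S.e i)) (1, 0)))).1 =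
        -S.ip (S.cl4 G (delta (S.e i))).2 (S.e i) := fun i => by
      rw [h.mul_one, h.ip_comm]; simp [G2Point.mul, delta]
    simp only [Prod.fst_sum, e2, Finset.sum_neg_distrib] at e1
    simp only [hQ2, h.ip_sub, h.ip_smul, Finset.sum_sub_distrib, ← Finset.mul_sum, h.sum_ip_self]
    simp only [Q0]
    linarith
  have hp : S.psi = S.cpsi := by funext a b c d; exact h.psi_eq a b c d
  let G' : V → V → V → V → ℝ := fun a b c d =>
    Q0 * S.psi a b c d + S.wedgePhi Q1 a b c d + 4 * S.iotaPsi Q2 a b c d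
  have hdec : S.IsFourFormDecomp G' Q0 Q1 Q2 := ⟨hsym, htr, fun _ _ _ _ => rfl⟩
  have hG' : IsAlt4 G' := by
    have e : G' = fun a b c d => (Q0 * S.cpsi a b c d + S.wedgePhi Q1 a b c d) +
        (S.cpsi (Q2 a) b c d + S.cpsi a (Q2 b) c d + S.cpsi a b (Q2 c) d
          + S.cpsi a b c (Q2 d)) := by
      funext a b c d; simp only [G', G2Point.iotaPsi, hp]; ring
    rw [e]
    exact ((h.isAlt4_cpsi.smul_form Q0).add_form (h.isAlt4_wedge Q1)).add_form
      (h.isAlt4_cpsi.derivation Q2)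
  have hcl : ∀ A, S.cl4 G A = S.cl4 G' A := fun A => by
    rw [h.cl4_eq hdec]
    nth_rw 1 [oct_eq A]
    rw [hadd, hsmul]
    have e1 : (S.cl4 G (delta A.2)).1 = S.ip A.2 (S.cl4 G (1, 0)).2 := by
      have := h.cl4_oip hG (delta A.2) (1, 0)
      rwa [h.oip_one, h.oip_delta_left] at this
    refine Prod.ext ?_ ?_
    · simp only [Prod.fst_add, Prod.smul_fst, e1, G2Point.pop, smul_eq_mul, Q0, Q1, h.ip_smul,
        h.ip_comm A.2]
      ring
    · simp only [Prod.snd_add, Prod.smul_snd, G2Point.pop, hQ2, Q1]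
      module
  refine ⟨Q0, Q1, Q2, hsym, htr, fun a b c d => ?_⟩
  -- G and the form rebuilt from its components act in the same way, so their difference is zero by
  -- faithfulness.
  have hdiff := hG.add_form (hG'.smul_form (-1))
  have := h.eq_zero_of_cl4 hdiff (fun A => by
    rw [h.cl4_add, h.cl4_smul, hcl]; module) a b c d
  change _ = G' a b c d
  linarith

end Pointwise
end OctKilling
end

noncomputable section

namespace OctKilling

section Pointwise

variable {V : Type*} [AddCommGroup V] [Module ℝ V]

/-! ### Components of the torsion -/

/-- `∑ T(e_i, e_j) e_i × e_j`. -/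
def G2Point.vec7 (S : G2Point V) (T : V → V → ℝ) : V :=
  ∑ i, ∑ j, T (S.e i) (S.e j) • S.cross (S.e i) (S.e j)

namespace IsOct

variable {S : G2Point V} (h : IsOct S)
include h

/-- The cross product as a bilinear map. -/
def crossl : V →ₗ[ℝ] V →ₗ[ℝ] V := LinearMap.mk₂ ℝ S.cross h.add_cross h.smul_cross h.cross_add h.cross_smul

lemma cross_sum {ι : Type*} (s : Finset ι) (f : ι → V) (u : V) :
    S.cross u (∑ i ∈ s, f i) = ∑ i ∈ s, S.cross u (f i) := map_sum (h.crossl u) f s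

/-- The scalar product as a bilinear map. -/
def ipb : V →ₗ[ℝ] V →ₗ[ℝ] ℝ := LinearMap.mk₂ ℝ S.ip h.ip_add h.ip_smul
  (fun u v w => h.ip_add' v w u) (fun c u v => h.ip_smul' c v u)

/-- The 3-form with its first argument fixed, as a bilinear map. -/
def phb (u : V) : V →ₗ[ℝ] V →ₗ[ℝ] ℝ := LinearMap.mk₂ ℝ (S.ph u) (h.ph_add₂ u)
  (fun c v w => h.ph_smul₂ c u v w) (fun v w x => h.ph_add₃ u v w x)
  (fun c v w => h.ph_smul₃ c u v w)

lemma vec7_symm (T : V → V → ℝ) (hT : ∀ u v, T u v = T v u) : S.vec7 T = 0 := by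
  have e : S.vec7 T = -S.vec7 T := by
    conv_lhs => rw [G2Point.vec7, Finset.sum_comm]
    simp only [G2Point.vec7, ← Finset.sum_neg_distrib]
    refine Finset.sum_congr rfl fun i _ => Finset.sum_congr rfl fun j _ => ?_
    rw [hT, h.cross_anti, smul_neg]
  have e2 : (2 : ℝ) • S.vec7 T = 0 := by
    rw [two_smul]; nth_rw 1 [e]; exact neg_add_cancel _
  exact (smul_eq_zero.mp e2).resolve_left two_ne_zero

lemma vec7_ph (x : V) : S.vec7 (S.ph x) = (6 : ℝ) • x := by
  rw [← h.sum_cross_cross]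
  refine Finset.sum_congr rfl fun i _ => ?_
  have := h.contract (h.crossl (S.e i)) (S.cross x (S.e i))
  simpa only [h.ip_cross] using! this

lemma vec7_add (T T' : V → V → ℝ) :
    S.vec7 (fun u v => T u v + T' u v) = S.vec7 T + S.vec7 T' := by
  simp only [G2Point.vec7, add_smul, Finset.sum_add_distrib]

lemma vec7_smul (c : ℝ) (T : V → V → ℝ) : S.vec7 (fun u v => c * T u v) = c • S.vec7 T := by
  simp only [G2Point.vec7, SemigroupAction.mul_smul, Finset.smul_sum]

lemma vec7_eq_zero_iff (T : V → V → ℝ) :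
    S.vec7 T = 0 ↔ ∀ w, ∑ a, ∑ b, T (S.e a) (S.e b) * S.ph (S.e a) (S.e b) w = 0 := by
  have e : ∀ w, ∑ a, ∑ b, T (S.e a) (S.e b) * S.ph (S.e a) (S.e b) w = S.ip (S.vec7 T) w :=
    fun w => by simp only [G2Point.vec7, h.ip_sum, h.ip_smul, h.ip_cross]
  simp only [e]
  exact ⟨fun H w => by rw [H, h.ip_zero], fun H => h.ext fun w => by rw [H, h.ip_zero]⟩

section Decomp

variable {T : V → V → ℝ} {x1 : ℝ} {x7 : V} {x14 x27 : V →ₗ[ℝ] V →ₗ[ℝ] ℝ}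
  (H : S.IsTorsionDecomp T x1 x7 x14 x27)
include H

omit h in
lemma self14 (u : V) : x14 u u = 0 := self_eq_neg.mp (H.skew14 u u)

lemma sum_torsion_self : ∑ i, T (S.e i) (S.e i) = 7 * x1 := by
  simp only [H.eq, Finset.sum_add_distrib, ← Finset.mul_sum, h.sum_ip_self, h.ph_self', self14 H,
    H.trace27, Finset.sum_const_zero]
  ring

/-- The contraction with the cross product kills symmetric tensors and Λ²₁₄ and is 6 on Λ²₇, so it
isolates τ₇. -/
lemma vec7_torsion : S.vec7 T = (6 : ℝ) • x7 := by
  have e : T = fun u v => (x1 * S.ip u v + x27 u v) + (S.ph x7 u v + x14 u v) := by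
    funext u v; rw [H.eq]; ring
  rw [e, h.vec7_add, h.vec7_add (S.ph x7), h.vec7_ph,
    h.vec7_symm _ fun u v => by rw [h.ip_comm, H.symm27], (h.vec7_eq_zero_iff _).2 H.phi14]
  simp

lemma torsion_add (u v : V) : T u v + T v u = 2 * x1 * S.ip u v + 2 * x27 u v := by
  rw [H.eq, H.eq, H.skew14 v, H.symm27 v, h.ph_swap' x7 u v, h.ip_comm v]; ring

lemma torsion_sub (u v : V) : T u v - T v u = 2 * S.ph x7 u v + 2 * x14 u v := by
  rw [H.eq, H.eq, H.skew14 v, H.symm27 v, h.ph_swap' x7 u v, h.ip_comm v]; ring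

end Decomp

lemma exists_torsionDecomp (T : V →ₗ[ℝ] V →ₗ[ℝ] ℝ) :
    ∃ x1 x7 x14 x27, S.IsTorsionDecomp (fun u v => T u v) x1 x7 x14 x27 := by
  let x1 : ℝ := (1 / 7) * ∑ i, T (S.e i) (S.e i)
  let x7 : V := (1 / 6 : ℝ) • S.vec7 fun u v => T u v
  refine ⟨x1, x7, (1 / 2 : ℝ) • (T - T.flip) - h.phb x7, (1 / 2 : ℝ) • (T + T.flip) - x1 • h.ipb,
    ?_, ?_, ?_, ?_, ?_⟩
  · intro u v
    simp [phb, ipb]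
    ring
  · intro u v
    simp [phb, h.ph_swap' x7 u v]
    ring
  · rw [← h.vec7_eq_zero_iff fun u v => ((1 / 2 : ℝ) • (T - T.flip) - h.phb x7) u v]
    have e : (fun u v => ((1 / 2 : ℝ) • (T - T.flip) - h.phb x7) u v) = fun u v =>
        (-(1 / 2 : ℝ) * (T u v + T v u) + T u v) + (-1) * S.ph x7 u v := by
      funext u v
      simp [phb]
      ring
    rw [e, h.vec7_add, h.vec7_add, h.vec7_smul (-1), h.vec7_ph,
      h.vec7_symm _ fun u v => by rw [add_comm (T u v)]]
    simp only [x7]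
    module
  · intro u v
    simp [ipb, h.ip_comm u v]
    ring
  · simp only [LinearMap.sub_apply, LinearMap.smul_apply, LinearMap.add_apply,
      LinearMap.flip_apply, smul_eq_mul, Finset.sum_sub_distrib, ← Finset.mul_sum, ipb,
      LinearMap.mk₂_apply, h.sum_ip_self, Finset.sum_add_distrib, x1]
    ring

/-! ### Products with a fixed octonion -/

lemma oip_mul_self (W : Oct V) (a : V) : S.oip W (S.mul (delta a) W) = 0 := by
  have := h.oip_L a W W
  rw [h.oip_comm] at this; linarith

lemma oip_mul_self' (W : Oct V) (a : V) : S.oip (S.mul (delta a) W) W = 0 := by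
  rw [h.oip_comm, h.oip_mul_self]

lemma oip_mul_delta_mul (W : Oct V) (a b : V) :
    S.oip (S.mul (delta a) W) (S.mul (delta b) W) = S.normSq W * S.ip a b := by
  rw [h.oip_mul_mul, h.oip_delta]; rfl

lemma fst_mul (W : Oct V) (a : V) : (S.mul (delta a) W).1 = -S.ip a W.2 := by
  simp [G2Point.mul, delta]

lemma ip_snd_mul (W : Oct V) (a b : V) :
    S.ip (S.mul (delta a) W).2 b = W.1 * S.ip a b + S.ph a W.2 b := by
  simp [G2Point.mul, delta, h.ip_add, h.ip_smul, h.ip_cross]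

lemma mk_mul (x : ℝ) (v : V) (A : Oct V) : S.mul (x, v) A = x • A + S.mul (delta v) A := by
  rw [oct_eq (x, v), h.add_mul, h.smul_mul, h.one_mul]

/-! ### The operator of a 4-form -/

section Pop

variable (Q0 : ℝ) (Q1 : V) (Q2 : V →ₗ[ℝ] V)

variable (hQ : ∀ u v, S.ip (Q2 u) v = S.ip u (Q2 v))
include hQ

lemma pop_oip (A B : Oct V) : S.oip (S.pop Q0 Q1 Q2 A) B = S.oip A (S.pop Q0 Q1 Q2 B) := by
  simp only [G2Point.pop, G2Point.oip, h.ip_add, h.ip_smul, h.ip_add', h.ip_smul', hQ,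
    h.ip_comm Q1 A.2]
  ring

lemma sum_cross_endo : ∑ i, S.cross (S.e i) (Q2 (S.e i)) = 0 :=
  h.sum_skew_symm h.crossl (fun u v => h.cross_anti u v) Q2 hQ

/-- Symmetry of Q turns the inner sum over i into (w × Q e_j) × e_j; the polarized identity then
leaves −Qw + 2Qw, the remaining terms vanishing because Q is symmetric and traceless. -/
lemma sum_cross_endo_cross (hQt : ∑ i, S.ip (Q2 (S.e i)) (S.e i) = 0) (w : V) :
    ∑ i, S.cross (S.e i) (Q2 (S.cross (S.e i) w)) = Q2 w := by
  have e1 : ∀ i, S.cross (S.e i) (Q2 (S.cross (S.e i) w)) =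
      ∑ j, S.ip (S.cross w (Q2 (S.e j))) (S.e i) • S.cross (S.e i) (S.e j) := fun i => by
    refine (h.contract (h.crossl (S.e i)) (Q2 (S.cross (S.e i) w))).symm.trans ?_
    refine Finset.sum_congr rfl fun j _ => ?_
    rw [hQ, h.ip_cross, h.ip_cross, h.ph_cyc (Q2 (S.e j)), h.ph_cyc w]
    rfl
  simp only [e1]
  rw [Finset.sum_comm]
  have e2 : ∀ j, ∑ i, S.ip (S.cross w (Q2 (S.e j))) (S.e i) • S.cross (S.e i) (S.e j) =
      S.cross w (S.cross (S.e j) (Q2 (S.e j))) - S.ip (Q2 (S.e j)) (S.e j) • w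
        - S.ip (Q2 w) (S.e j) • S.e j + (2 : ℝ) • Q2 (S.ip w (S.e j) • S.e j) := fun j => by
    have e3 := h.contract (h.crossl.flip (S.e j)) (S.cross w (Q2 (S.e j)))
    have e4 := h.cross_cross_polar w (S.e j) (Q2 (S.e j))
    refine e3.trans ?_
    change S.cross (S.cross w (Q2 (S.e j))) (S.e j) = _
    rw [h.cross_anti (S.e j), eq_sub_of_add_eq' e4, map_smul, hQ w, h.ip_comm (S.e j) (Q2 (S.e j))]
    module
  simp only [e2, Finset.sum_add_distrib, Finset.sum_sub_distrib, ← h.cross_sum,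
    h.sum_cross_endo Q2 hQ, ← Finset.sum_smul, hQt, h.expand, ← Finset.smul_sum, ← map_sum,
    h.cross_zero]
  module

/-- The contraction which evaluates the 7-component of the torsion of φ_Y in `sum_cross_gauge`. -/
lemma sum_mul_pop (hQt : ∑ i, S.ip (Q2 (S.e i)) (S.e i) = 0) :
    ∑ i, S.mul (delta (S.e i)) (S.pop Q0 Q1 Q2 (delta (S.e i))) = S.pop Q0 Q1 Q2 (1, 0) := by
  refine Prod.ext ?_ ?_
  · simp only [Prod.fst_sum, G2Point.pop, G2Point.mul, delta, h.ip_add', h.ip_smul', h.ip_zero',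
      ← hQ, Finset.sum_sub_distrib, Finset.sum_add_distrib, ← Finset.mul_sum, hQt, h.sum_ip_self,
      zero_mul, MulZeroClass.mul_zero, MulZeroClass.zero_mul, Finset.sum_const_zero]
    ring
  · simp only [Prod.snd_sum, G2Point.pop, G2Point.mul, delta, h.cross_add, h.cross_smul, zero_smul,
      h.cross_self, MulZeroClass.mul_zero, neg_zero, zero_add, zero_sub, smul_zero, map_zero,
      Finset.sum_add_distrib, ← Finset.smul_sum, h.sum_cross_endo Q2 hQ, Finset.sum_const_zero]
    have e : ∀ i, (-((2 / 3) * S.ip Q1 (S.e i))) • S.e i = (-(2 / 3) : ℝ) • (S.ip Q1 (S.e i) • S.e i) :=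
      fun i => by module
    simp only [neg_mul_eq_neg_mul, SemigroupAction.mul_smul, ← Finset.smul_sum, h.expand]
    module

end Pop

end IsOct

/-- The 3-form `φ_W` in terms of octonions. -/
lemma IsG2.normSq_mul_gauge {S : G2Point V} (h : IsG2 S) {W : Oct V} (hW : W ≠ 0) (u v w : V) :
    S.normSq W * (S.gauge W).ph u v w =
      S.oip (S.mul (delta u) (S.mul (delta v) W)) (S.mul (delta w) W) :=
  h.normSq_mul_sigma hW u v w

/-- For W = (w₀, w), contraction with w kills w ⌟ ψ and turns the quadratic terms of `σ_W` into |w|²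
(w ⌟ φ), so w₀² − |w|² is completed to |W|². The terms in W.2 of the two torsions can thus be
compared. -/
lemma IsG2.gauge_ph_self {S : G2Point V} (h : IsG2 S) {W : Oct V} (hW : W ≠ 0) (u v : V) :
    (S.gauge W).ph W.2 u v = S.ph W.2 u v := by
  have e1 := h.normSq_mul_gauge hW W.2 u v
  have e2 : S.cpsi W.2 W.2 u v = 0 := by
    have := h.cpsi_swap W.2 W.2 u v; linarith
  rw [h.oip_delta_delta, e2, h.ph_self, h.ph_self] at e1
  refine mul_left_cancel₀ (h.normSq_ne_zero hW) (e1.trans ?_)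
  rw [G2Point.normSq]; ring

/-- Two successive changes of gauge. -/
lemma IsG2.gauge_gauge {S : G2Point V} (h : IsG2 S) {X W : Oct V} (hX : X ≠ 0)
    (h' : IsG2 (S.gauge X)) (hW : W ≠ 0) (hWX : S.mul W X ≠ 0) :
    (S.gauge X).gauge W = S.gauge (S.mul W X) := by
  have hp : (S.gauge X).sigma W = S.sigma (S.mul W X) := by
    funext u v w
    have e1 := h'.normSq_mul_sigma hW u v w
    have e2 := h.normSq_mul_sigma hWX u v w
    rw [h.gauge_mul_delta hX, h.gauge_mul_delta hX, h.gauge_mul_delta hX, h.oip_mul_mul, h.normSq_eq,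
      h.oip_mul_mul, ← h.normSq_eq, mul_assoc] at e2
    have e3 := mul_left_cancel₀ (h.normSq_ne_zero hX) e2
    exact mul_left_cancel₀ (h'.normSq_ne_zero hW) (e1.trans e3.symm)
  simp only [G2Point.gauge] at hp ⊢
  rw [hp]

/-- The case of an imaginary left factor is `gauge_mul_delta`; the real part acts as a scalar for
both products. -/
lemma IsG2.gauge_mul {S : G2Point V} (h : IsG2 S) {X : Oct V} (hX : X ≠ 0) (A B : Oct V) :
    S.mul A (S.mul B X) = S.mul ((S.gauge X).mul A B) X := by
  have h' := h.gauge_isOct hX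
  obtain ⟨x, v⟩ := A
  rw [h.mk_mul, h'.mk_mul, h.gauge_mul_delta hX, ← h.smul_mul, ← h.add_mul]

end Pointwise
end OctKilling
end

noncomputable section

namespace OctKilling

section Pointwise

variable {V : Type*} [AddCommGroup V] [Module ℝ V]

/-! ### The Killing equations at one point, after division by `X` -/

/-- The right-hand side of the equation for `(D_a X) X⁻¹`. -/
def G2Point.killX (S : G2Point V) (P : Oct V → Oct V) (W : Oct V) (u : V) (s l1 l2 : ℝ) (a : V) :
    Oct V :=
  (3 / 2 : ℝ) • P (S.mul (delta a) W) + ((1 / 2) * l2 * s) • delta a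
    - ((1 / 2) * l1 * s) • S.mul (delta a) W + (1 / 4 : ℝ) • S.mul (delta a) (delta u)

/-- The right-hand side of the equation for `(D_a Y) X⁻¹`. -/
def G2Point.killY (S : G2Point V) (P : Oct V → Oct V) (W : Oct V) (u : V) (s l1 l2 : ℝ) (a : V) :
    Oct V :=
  -((3 / 2 : ℝ) • P (delta a)) - ((1 / 2) * l1 * s) • delta a
    - ((1 / 2) * l2 * s) • S.mul (delta a) W
    + (1 / 4 : ℝ) • S.mul (delta a) (S.mul (delta u) W)

namespace IsOct

variable {S : G2Point V} (h : IsOct S)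
include h

section Alg

variable (P : Oct V → Oct V) (W : Oct V) (u : V) (s n l1 l2 : ℝ)
  (hPs : ∀ A B, S.oip (P A) B = S.oip A (P B))
  (hP1 : P (1, 0) = -(l1 * s, 0) - (l2 * s) • W + S.mul (s * n, (1 / 2 : ℝ) • u) W)
  (hPW : P W = (-(l2 * s), 0) + (l1 * s) • W - (s * n, (1 / 2 : ℝ) • u))

include hP1 in
omit h in
lemma pop_one' (h : IsOct S) : P (1, 0) = (-(l1 * s)) • ((1 : ℝ), (0 : V)) + (s * n - l2 * s) • W
    + (1 / 2 : ℝ) • S.mul (delta u) W := by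
  rw [hP1, h.mk_mul, h.delta_smul, h.smul_mul]
  refine Prod.ext ?_ ?_
  · simp; ring
  · simp; module

include hPW in
omit h in
lemma pop_quot' : P W = (-(l2 * s) - s * n) • ((1 : ℝ), (0 : V)) + (l1 * s) • W
    - (1 / 2 : ℝ) • delta u := by
  rw [hPW]
  refine Prod.ext ?_ ?_
  · simp [delta]; ring
  · simp [delta]

lemma oip_mul_one (a : V) : S.oip (S.mul (delta a) W) (1, 0) = -S.ip a W.2 := by
  rw [h.oip_one, h.fst_mul]

lemma oip_mul_delta (a b : V) :
    S.oip (S.mul (delta a) W) (delta b) = W.1 * S.ip a b + S.ph a W.2 b := by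
  rw [h.oip_delta, h.ip_snd_mul]

lemma oip_delta_mul (a b : V) :
    S.oip (delta b) (S.mul (delta a) W) = W.1 * S.ip a b + S.ph a W.2 b := by
  rw [h.oip_comm, h.oip_mul_delta]

lemma oip_delta_delta_right (a b c : V) :
    S.oip (S.mul (delta a) (delta b)) (delta c) = S.ph a b c := by
  rw [h.mul_delta_delta, h.oip_delta, h.ip_cross]

lemma oip_delta_delta_one (a b : V) :
    S.oip (S.mul (delta a) (delta b)) (1, 0) = -S.ip a b := by
  rw [h.mul_delta_delta, h.oip_one]

lemma oip_delta_one (a : V) : S.oip (delta a) (1, 0) = 0 := by rw [h.oip_one]; rfl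

lemma oip_self_left (a : V) : S.oip (delta a) W = S.ip a W.2 := h.oip_delta_left _ _

include hPs hP1 in
/-- The real part of `(D_a X) X⁻¹`. -/
lemma oip_killX_one (a : V) : S.oip (S.killX P W u s l1 l2 a) (1, 0) =
    2 * l1 * s * S.ip a W.2 + ((3 / 4) * S.normSq W - 1 / 4) * S.ip a u := by
  simp only [G2Point.killX, h.oip_add, h.oip_sub, h.oip_smul, hPs,
    pop_one' P W u s n l1 l2 hP1 h, h.oip_add', h.oip_smul', h.oip_mul_one W, h.oip_delta_one,
    h.oip_delta_delta_one, h.oip_mul_delta_mul, h.oip_mul_self', h.oip_self_left W]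
  ring

include hPs hPW in
-- Symmetry of P moves it onto W, where the algebraic equation gives its value. The same device
-- gives the other scalar equations, with 1 in place of W where needed.
lemma oip_killY_quot (a : V) : S.oip (S.killY P W u s l1 l2 a) W =
    -(2 * l1 * s * S.ip a W.2) + (3 / 4 - (1 / 4) * S.normSq W) * S.ip a u := by
  simp only [G2Point.killY, h.oip_add, h.oip_sub, h.oip_smul, h.oip_neg, hPs,
    pop_quot' P W u s n l1 l2 hPW, h.oip_add', h.oip_sub', h.oip_smul', h.oip_mul_one W,
    h.oip_delta_one, h.oip_self_left W, h.oip_L a (S.mul (delta u) W), h.oip_mul_delta_mul,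
    h.oip_mul_self']
  rw [h.oip_delta, h.ip_comm u a, delta]
  ring

include hPs hP1 hPW in
-- The left side is the derivative of ⟨Y, X⟩ divided by |X|², from which dw₀ is obtained.
lemma oip_killY_one (a : V) : S.oip (S.killY P W u s l1 l2 a) (1, 0) +
    S.oip W (S.killX P W u s l1 l2 a) = 4 * l2 * s * S.ip a W.2 - 2 * W.1 * S.ip a u := by
  have e : S.oip (S.mul (delta a) (S.mul (delta u) W)) (1, 0) =
      -(W.1 * S.ip a u + S.ph a u W.2) := by
    rw [h.oip_L, h.mul_one, h.oip_mul_delta W, h.ip_comm u, h.ph_cyc a u]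
  rw [h.oip_comm W]
  simp only [G2Point.killX, G2Point.killY, h.oip_add, h.oip_sub, h.oip_smul, h.oip_neg, hPs,
    pop_quot' P W u s n l1 l2 hPW, pop_one' P W u s n l1 l2 hP1 h, h.oip_add', h.oip_sub',
    h.oip_smul', h.oip_mul_one W, h.oip_delta_one, h.oip_self_left W, e, h.oip_mul_delta_mul,
    h.oip_mul_self', h.oip_delta_delta_one, h.oip_mul_delta W, h.oip_delta_mul W]
  have e2 : S.oip (S.mul (delta a) (delta u)) W = -(W.1 * S.ip a u) + S.ph a u W.2 := by
    rw [h.mul_delta_delta, G2Point.oip, h.ip_cross]; ring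
  rw [e2, h.ip_comm u a, h.ph_cyc a u, h.ph_swap' a u]
  ring

/-- `T(a, c)` for the torsion `T = -Im K` of `φ_X`. -/
lemma oip_killX_delta (a c : V) : -S.oip (S.killX P W u s l1 l2 a) (delta c) =
    -(3 / 2) * S.oip (P (S.mul (delta a) W)) (delta c) - (1 / 2) * l2 * s * S.ip a c
      + (1 / 2) * l1 * s * (W.1 * S.ip a c - S.ph W.2 a c) + (1 / 4) * S.ph u a c := by
  have e : S.oip (delta a) (delta c) = S.ip a c := h.oip_delta _ _
  simp only [G2Point.killX, h.oip_add, h.oip_sub, h.oip_smul, h.oip_mul_delta W, e,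
    h.oip_delta_delta_right, h.ph_swap W.2 a c, h.ph_swap u a c]
  ring

lemma oip_killY_mul (φ : V → V → V → ℝ)
    (hφ : ∀ a b c, S.normSq W * φ a b c = S.oip (S.mul (delta a) (S.mul (delta b) W)) (S.mul (delta c) W))
    (hs : ∀ a b c, φ a b c = -φ b a c)
    (a c : V) : -S.oip (S.killY P W u s l1 l2 a) (S.mul (delta c) W) =
    (3 / 2) * S.oip (P (delta a)) (S.mul (delta c) W)
      + (1 / 2) * l1 * s * (W.1 * S.ip a c + S.ph W.2 a c) + (1 / 2) * l2 * s * S.normSq W * S.ip a c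
      + (1 / 4) * S.normSq W * φ u a c := by
  have e1 : S.ph c W.2 a = S.ph W.2 a c := by rw [h.ph_cyc, h.ph_cyc] 
  simp only [G2Point.killY, h.oip_add, h.oip_sub, h.oip_smul, h.oip_neg, h.oip_delta_mul W, ← hφ,
    h.oip_mul_delta_mul, hs a u, h.ip_comm c a, e1]
  ring

include hPs in
-- With φ the 3-form φ_W, the terms with P in T^X(a, c) and in |W|² T^Y(c, a) cancel because P is
-- symmetric, and the 3-forms drop out on symmetrization. The coefficient of the metric is then
-- given by the relation `hn`.
lemma killX_killY_symm (φ : V → V → V → ℝ)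
    (hφ : ∀ a b c, S.normSq W * φ a b c = S.oip (S.mul (delta a) (S.mul (delta b) W)) (S.mul (delta c) W))
    (hs : ∀ a b c, φ a b c = -φ b a c) (hs' : ∀ a b c, φ a c b = -φ a b c)
    (hn : 2 * W.1 * l1 - l2 * (1 - S.normSq W) = n * (1 + S.normSq W)) (a c : V) :
    -S.oip (S.killX P W u s l1 l2 a) (delta c) - S.oip (S.killX P W u s l1 l2 c) (delta a)
      - S.oip (S.killY P W u s l1 l2 a) (S.mul (delta c) W)
      - S.oip (S.killY P W u s l1 l2 c) (S.mul (delta a) W) =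
    s * n * (1 + S.normSq W) * S.ip a c := by
  have e1 := h.oip_killX_delta P W u s l1 l2 a c
  have e2 := h.oip_killX_delta P W u s l1 l2 c a
  have e3 := h.oip_killY_mul P W u s l1 l2 φ hφ hs a c
  have e4 := h.oip_killY_mul P W u s l1 l2 φ hφ hs c a
  rw [hPs, h.oip_comm (S.mul (delta a) W)] at e1
  rw [hPs, h.oip_comm (S.mul (delta c) W)] at e2
  rw [h.ip_comm c a, h.ph_swap' W.2 a c, h.ph_swap' u a c] at e2
  rw [h.ip_comm c a, h.ph_swap' W.2 a c, hs' u a c] at e4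
  linear_combination e1 + e2 + e3 + e4 + s * S.ip a c * hn

include hPs in
-- The skew counterpart: P cancels from the difference of the skew parts of T^X and |W|² T^Y, and
-- the multiples of the metric drop out.
lemma killX_killY_skew (φ : V → V → V → ℝ)
    (hφ : ∀ a b c, S.normSq W * φ a b c = S.oip (S.mul (delta a) (S.mul (delta b) W)) (S.mul (delta c) W))
    (hs : ∀ a b c, φ a b c = -φ b a c) (hs' : ∀ a b c, φ a c b = -φ a b c) (a c : V) :
    (-S.oip (S.killX P W u s l1 l2 a) (delta c) + S.oip (S.killX P W u s l1 l2 c) (delta a))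
      - (-S.oip (S.killY P W u s l1 l2 a) (S.mul (delta c) W)
        + S.oip (S.killY P W u s l1 l2 c) (S.mul (delta a) W)) =
    -2 * l1 * s * S.ph W.2 a c + (1 / 2) * S.ph u a c - (1 / 2) * S.normSq W * φ u a c := by
  have e1 := h.oip_killX_delta P W u s l1 l2 a c
  have e2 := h.oip_killX_delta P W u s l1 l2 c a
  have e3 := h.oip_killY_mul P W u s l1 l2 φ hφ hs a c
  have e4 := h.oip_killY_mul P W u s l1 l2 φ hφ hs c a
  rw [hPs, h.oip_comm (S.mul (delta a) W)] at e1
  rw [hPs, h.oip_comm (S.mul (delta c) W)] at e2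
  rw [h.ip_comm c a, h.ph_swap' W.2 a c, h.ph_swap' u a c] at e2
  rw [h.ip_comm c a, h.ph_swap' W.2 a c, hs' u a c] at e4
  linear_combination e1 - e2 - e3 + e4

include hPs hPW in
/-- The transposed torsion of `φ_X`, as an octonion-valued 1-form. -/
lemma torsionTranspose_rhs (m : V) :
    let R := S.mul (-(3 / 2 : ℝ) • P (delta m) + ((1 / 2) * l1 * s) • delta m) (oconj W)
      + (1 / 4 : ℝ) • S.mul (delta m) (delta u)
      + (l1 * s * S.ip W.2 m - (1 / 2) * S.ip u m, -((1 / 2) * l2 * s) • m)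
    R.1 = 0 ∧ ∀ a, S.ip R.2 a = -S.oip (S.killX P W u s l1 l2 a) (delta m) := by
  intro R
  have hR : R = S.mul (-(3 / 2 : ℝ) • P (delta m) + ((1 / 2) * l1 * s) • delta m) (oconj W)
      + (1 / 4 : ℝ) • S.mul (delta m) (delta u)
      + ((l1 * s * S.ip W.2 m - (1 / 2) * S.ip u m) • ((1 : ℝ), (0 : V))
        + (-((1 / 2) * l2 * s)) • delta m) := by
    simp only [R]
    congr 1
    simp [delta]
  -- Right multiplication by the conjugate of W is moved to the test octonion B. Then B = 1 brings
  -- in PW, which gives real part zero, and B = δ_a reproduces `killX`.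
  have key : ∀ B, S.oip R B = -(3 / 2) * S.oip (delta m) (P (S.mul B W))
      + (1 / 2) * l1 * s * S.oip (delta m) (S.mul B W)
      + (1 / 4) * S.oip (S.mul (delta m) (delta u)) B
      + (l1 * s * S.ip W.2 m - (1 / 2) * S.ip u m) * B.1 - (1 / 2) * l2 * s * S.oip (delta m) B := by
    intro B
    rw [hR, h.oip_add, h.oip_add, h.oip_mul_right, h.conj_conj]
    simp only [h.oip_add, h.oip_smul, hPs, h.oip_one_left]
    ring
  refine ⟨?_, fun a => ?_⟩
  · rw [← h.oip_one R, key, h.one_mul, pop_quot' P W u s n l1 l2 hPW, h.oip_delta_delta_one]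
    simp only [h.oip_add', h.oip_sub', h.oip_smul', h.oip_delta_one, h.oip_self_left W]
    have e : S.oip (delta m) (delta u) = S.ip m u := h.oip_delta _ _
    rw [e, h.ip_comm W.2, h.ip_comm u]
    ring
  · have e : S.oip (delta m) (delta a) = S.ip a m := (h.oip_delta _ _).trans (h.ip_comm _ _)
    rw [← h.oip_delta, key, h.oip_killX_delta, h.oip_delta_delta_right, h.oip_delta_mul W,
      h.oip_comm (P _), e, h.ph_swap W.2 a, h.ph_cyc m u a]
    simp only [delta]
    ring

end Alg

end IsOct
end Pointwise
end OctKilling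
end

/-! ### The algebraic equations in components, and the 7-components of the torsions -/

noncomputable section

namespace OctKilling

section Pointwise

variable {V : Type*} [AddCommGroup V] [Module ℝ V]

namespace IsOct

variable {S : G2Point V} (h : IsOct S)
include h

section Alg

variable (Q0 : ℝ) (Q1 : V) (Q2 : V →ₗ[ℝ] V) (W : Oct V) (u : V) (s n l1 l2 : ℝ)
  (hQ : ∀ u v, S.ip (Q2 u) v = S.ip u (Q2 v))

include hQ

/-- The algebraic Killing equation in terms of the components of the 4-form. -/
lemma pop_eqs_iff (hs : s ≠ 0) :
    (S.pop Q0 Q1 Q2 (1, 0) = -(l1 * s, 0) - (l2 * s) • W + S.mul (s * n, (1 / 2 : ℝ) • u) W ∧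
      S.pop Q0 Q1 Q2 W = (-(l2 * s), 0) + (l1 * s) • W - (s * n, (1 / 2 : ℝ) • u)) ↔
    (2 * W.1 * l1 - l2 * (1 - S.normSq W) = n * (1 + S.normSq W) ∧
      Q2 W.2 = W.1 • Q1 - ((1 / 4) * (Q0 - 6 * l1 * s)) • W.2 - (3 / 4 : ℝ) • u ∧
      (((7 / 3) * Q0, (4 / 3 : ℝ) • Q1) : Oct V) =
        S.mul (2 * s * (l2 - n), -u) W + (2 * l1 * s, 0)) := by
  have e1 : S.pop Q0 Q1 Q2 (1, 0) = (-(1 / 2) : ℝ) • ((7 / 3) * Q0, (4 / 3 : ℝ) • Q1) := by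
    refine Prod.ext ?_ ?_
    · simp [G2Point.pop, h.ip_zero']; ring
    · simp [G2Point.pop]; module
  have e2 : -(l1 * s, 0) - (l2 * s) • W + S.mul (s * n, (1 / 2 : ℝ) • u) W =
      (-(1 / 2) : ℝ) • (S.mul (2 * s * (l2 - n), -u) W + (2 * l1 * s, 0)) := by
    refine Prod.ext ?_ ?_
    · simp [G2Point.mul, h.ip_smul, h.ip_neg]; ring
    · simp [G2Point.mul, h.smul_cross, h.neg_cross]; module
  have e3 : (-(1 / 2) : ℝ) ≠ 0 := by norm_num
  have i1 : S.pop Q0 Q1 Q2 (1, 0) = -(l1 * s, 0) - (l2 * s) • W + S.mul (s * n, (1 / 2 : ℝ) • u) W ↔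
      (((7 / 3) * Q0, (4 / 3 : ℝ) • Q1) : Oct V) =
        S.mul (2 * s * (l2 - n), -u) W + (2 * l1 * s, 0) := by
    rw [e1, e2]
    exact ⟨fun H => smul_right_injective _ e3 H, fun H => by rw [H]⟩
  have i2 : (S.pop Q0 Q1 Q2 W).2 = ((-(l2 * s), 0) + (l1 * s) • W - (s * n, (1 / 2 : ℝ) • u)).2 ↔
      Q2 W.2 = W.1 • Q1 - ((1 / 4) * (Q0 - 6 * l1 * s)) • W.2 - (3 / 4 : ℝ) • u := by
    simp only [G2Point.pop, Prod.snd_add, Prod.snd_sub, Prod.smul_snd, zero_add]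
    constructor
    · intro H
      have : Q2 W.2 = (3 / 2 : ℝ) • ((-((2 / 3) * W.1)) • Q1 + ((1 / 6) * Q0) • W.2
          + (2 / 3 : ℝ) • Q2 W.2) + W.1 • Q1 - ((1 / 4) * Q0) • W.2 := by module
      rw [this, H]; module
    · intro H
      rw [H]; module
  -- Only the real part of the equation for PW depends on the equation for P1: by symmetry of P it
  -- equals ⟨W, P1⟩.
  have i3 : S.pop Q0 Q1 Q2 (1, 0) = -(l1 * s, 0) - (l2 * s) • W + S.mul (s * n, (1 / 2 : ℝ) • u) W →
      ((S.pop Q0 Q1 Q2 W).1 = ((-(l2 * s), 0) + (l1 * s) • W - (s * n, (1 / 2 : ℝ) • u)).1 ↔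
        2 * W.1 * l1 - l2 * (1 - S.normSq W) = n * (1 + S.normSq W)) := by
    intro H
    rw [← h.oip_one (S.pop Q0 Q1 Q2 W), h.pop_oip Q0 Q1 Q2 hQ,
      pop_one' _ W u s n l1 l2 H h]
    simp only [h.oip_add', h.oip_smul', h.oip_one, h.oip_mul_self, ← h.normSq_eq, Prod.fst_add,
      Prod.fst_sub, Prod.smul_fst, smul_eq_mul]
    constructor
    · intro H
      refine mul_left_cancel₀ hs ?_
      linear_combination -H
    · intro H
      linear_combination -s * H
  constructor
  · rintro ⟨H1, H2⟩
    exact ⟨(i3 H1).1 (congrArg Prod.fst H2), i2.1 (congrArg Prod.snd H2), i1.1 H1⟩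
  · rintro ⟨H1, H2, H3⟩
    have := i1.2 H3
    exact ⟨this, Prod.ext ((i3 this).2 H1) (i2.2 H2)⟩

variable (hQt : ∑ i, S.ip (Q2 (S.e i)) (S.e i) = 0)
  (h2 : Q2 W.2 = W.1 • Q1 - ((1 / 4) * (Q0 - 6 * l1 * s)) • W.2 - (3 / 4 : ℝ) • u)
  (h3 : (((7 / 3) * Q0, (4 / 3 : ℝ) • Q1) : Oct V) =
        S.mul (2 * s * (l2 - n), -u) W + (2 * l1 * s, 0))

include hQt h2 h3 in
-- The sum is computed block by block in P. The relations for Q₂(w), Q₁ and Q₀ then remove all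
-- components of the 4-form and leave a multiple of u.
lemma sum_cross_pop : ∑ i, S.cross (S.e i) (S.pop Q0 Q1 Q2 (S.mul (delta (S.e i)) W)).2 =
    (-(1 / 2) * (1 + S.normSq W)) • u := by
  have e1 : ∀ i, S.cross (S.e i) (S.pop Q0 Q1 Q2 (S.mul (delta (S.e i)) W)).2 =
      (2 / 3 : ℝ) • S.cross (S.ip W.2 (S.e i) • S.e i) Q1
        + ((1 / 6) * Q0) • (-S.cross (S.e i) (S.cross W.2 (S.e i)))
        + ((2 / 3) * W.1) • S.cross (S.e i) (Q2 (S.e i))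
        + (2 / 3 : ℝ) • S.cross (S.e i) (Q2 (S.cross (S.e i) W.2)) := fun i => by
    rw [h.cross_anti (S.e i) W.2]
    simp only [G2Point.pop, G2Point.mul, delta, h.cross_add, h.cross_smul, h.smul_cross, map_add,
      map_smul, h.cross_self, h.cross_neg, h.ip_comm (S.e i)]
    simp
    module
  have e2 : ∑ i, S.cross (S.ip W.2 (S.e i) • S.e i) Q1 = S.cross W.2 Q1 := by
    have := map_sum (h.crossl.flip Q1) (fun i => S.ip W.2 (S.e i) • S.e i) Finset.univ
    rw [h.expand] at this
    exact this.symm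
  simp only [e1, Finset.sum_add_distrib, ← Finset.smul_sum, e2, Finset.sum_neg_distrib,
    h.sum_cross_cross, h.sum_cross_endo Q2 hQ, h.sum_cross_endo_cross Q2 hQ hQt]
  have e3 : Q1 = (3 / 4 : ℝ) • ((2 * s * (l2 - n)) • W.2 - W.1 • u - S.cross u W.2) := by
    have := congrArg Prod.snd h3
    simp only [G2Point.mul, Prod.snd_add, h.neg_cross] at this
    have e : Q1 = (3 / 4 : ℝ) • ((4 / 3 : ℝ) • Q1) := by module
    rw [e, this]; module
  have e4 : S.ip u W.2 = (7 / 3) * Q0 - 2 * s * (l2 - n) * W.1 - 2 * l1 * s := by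
    have := congrArg Prod.fst h3
    simp only [G2Point.mul, Prod.fst_add, h.ip_neg] at this
    linarith
  rw [h2, e3]
  simp only [h.cross_smul, h.cross_sub, h.cross_self, h.cross_cross', h.cross_anti u W.2, G2Point.normSq, 
    h.cross_neg, h.cross_cross, h.ip_comm W.2 u, e4]
  module

include hQt h2 h3 in
-- Six times the 7-component of the torsion of φ_X. It is needed by itself: `Cond4` fixes only the
-- sum of the two 7-components, whereas the skew part involves their difference.
lemma vec7_killX : S.vec7 (fun a c => -S.oip (S.killX (S.pop Q0 Q1 Q2) W u s l1 l2 a) (delta c)) =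
    (9 / 4 + (3 / 4) * S.normSq W) • u - (3 * l1 * s) • W.2 := by
  have e1 : (fun a c => -S.oip (S.killX (S.pop Q0 Q1 Q2) W u s l1 l2 a) (delta c)) = fun a c =>
      ((-(3 / 2) * S.oip (S.pop Q0 Q1 Q2 (S.mul (delta a) W)) (delta c)
        + (-(1 / 2) * l1 * s) * S.ph W.2 a c) + (1 / 4) * S.ph u a c)
        + ((1 / 2) * l1 * s * W.1 - (1 / 2) * l2 * s) * S.ip a c := by
    funext a c; rw [h.oip_killX_delta]; ring
  have e2 : S.vec7 (fun a c => S.oip (S.pop Q0 Q1 Q2 (S.mul (delta a) W)) (delta c)) =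
      (-(1 / 2) * (1 + S.normSq W)) • u := by
    rw [← h.sum_cross_pop Q0 Q1 Q2 W u s n l1 l2 hQ hQt h2 h3]
    refine Finset.sum_congr rfl fun i _ => ?_
    have := h.contract (h.crossl (S.e i)) (S.pop Q0 Q1 Q2 (S.mul (delta (S.e i)) W)).2
    simp only [h.oip_delta]
    exact this
  rw [e1, h.vec7_add, h.vec7_add, h.vec7_add, h.vec7_smul, h.vec7_smul, h.vec7_smul, h.vec7_smul, e2,
    h.vec7_ph, h.vec7_ph, h.vec7_symm _ h.ip_comm]
  module

end Alg
end IsOct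

namespace IsG2

variable {S : G2Point V} (h : IsG2 S)
include h

variable (P : Oct V → Oct V) (W : Oct V) (u : V) (s n l1 l2 : ℝ)
  (hPs : ∀ A B, S.oip (P A) B = S.oip A (P B))
  (hP1 : P (1, 0) = -(l1 * s, 0) - (l2 * s) • W + S.mul (s * n, (1 / 2 : ℝ) • u) W)
  (hPW : P W = (-(l2 * s), 0) + (l1 * s) • W - (s * n, (1 / 2 : ℝ) • u))
  (hPt : ∑ i, S.mul (delta (S.e i)) (P (delta (S.e i))) = P (1, 0)) (hW : W ≠ 0)

include hPs hP1 hPW hPt hW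

/-- The cross products are those of φ_W, so the sum is the imaginary part of an octonion Z formed
with its product. Multiplying Z by W returns to the product of φ, where the sum of δ_i P δ_i is P1.
-/
lemma sum_cross_gauge : ∑ i, ∑ j, S.oip (P (delta (S.e i))) (S.mul (delta (S.e j)) W) •
    (S.gauge W).cross (S.e i) (S.e j) = ((1 / 2) * (1 + S.normSq W)) • u := by
  have h' := h.gauge_isOct hW
  let v : Fin 7 → V := fun i => (S.mul (P (delta (S.e i))) (oconj W)).2
  have e1 : ∀ i, ∑ j, S.oip (P (delta (S.e i))) (S.mul (delta (S.e j)) W) •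
      (S.gauge W).cross (S.e i) (S.e j) = ((S.gauge W).mul (delta (S.e i)) (delta (v i))).2 := by
    intro i
    rw [h'.mul_delta_delta]
    refine Eq.trans (Finset.sum_congr rfl fun j _ => ?_) (h'.contract (h'.crossl (S.e i)) (v i))
    have : S.oip (P (delta (S.e i))) (S.mul (delta (S.e j)) W) = S.ip (v i) (S.e j) := by
      rw [← h.oip_delta, h.oip_mul_right, h.conj_conj]
    rw [this]; rfl
  let Z := ∑ i, (S.gauge W).mul (delta (S.e i)) (delta (v i))
  have e2 : ∑ i, ∑ j, S.oip (P (delta (S.e i))) (S.mul (delta (S.e j)) W) •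
    (S.gauge W).cross (S.e i) (S.e j) = Z.2 := by simp only [Z, e1, Prod.snd_sum]
  -- Here v_i is the imaginary part of Pδ_i times the conjugate of W. Multiplying by W restores |W|²
  -- Pδ_i, minus the contribution of the real part, which is ⟨PW, δ_i⟩.
  have e3 : ∀ i, S.mul (delta (v i)) W =
      S.normSq W • P (delta (S.e i)) - S.ip (P W).2 (S.e i) • W := fun i => by
    have f1 : S.mul (P (delta (S.e i))) (oconj W) =
        (S.ip (P W).2 (S.e i)) • ((1 : ℝ), (0 : V)) + delta (v i) := by
      nth_rw 1 [oct_eq (S.mul (P (delta (S.e i))) (oconj W))]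
      rw [← h.oip_one (S.mul (P (delta (S.e i))) (oconj W)), h.oip_mul_right, h.conj_conj,
        h.one_mul, hPs, h.oip_delta_left, h.ip_comm]
    have f2 := h.mul_mul_conj (oconj W) (P (delta (S.e i)))
    rw [h.conj_conj, h.normSq_conj, f1, h.add_mul, h.smul_mul, h.one_mul] at f2
    rw [← f2]; abel
  have e4 : S.mul Z W = S.normSq W • P (1, 0) - S.mul (delta (P W).2) W := by
    have f1 : ∑ i, S.mul (delta (S.ip (P W).2 (S.e i) • S.e i)) W = S.mul (delta (P W).2) W := by
      have := h.contract (h.L.flip W) (P W).2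
      simp only [h.delta_smul, h.smul_mul]
      exact this
    simp only [Z, h.sum_mul, ← h.gauge_mul_delta hW, e3, h.mul_sub, h.mul_smul,
      Finset.sum_sub_distrib, ← Finset.smul_sum, hPt, ← f1, h.delta_smul, h.smul_mul]
  have e5 : Z = (-(l1 * s)) • oconj W + (S.normSq W * (s * n - l2 * s)) • ((1 : ℝ), (0 : V))
      + (S.normSq W * (1 / 2)) • delta u - delta (P W).2 := by
    refine h.mul_right_cancel hW (e4.trans ?_)
    have f1 := h.conj_mul_mul W (1, 0)
    rw [h.mul_one] at f1
    rw [h.sub_mul, h.add_mul, h.add_mul, h.smul_mul, h.smul_mul, h.smul_mul, f1, h.one_mul,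
      IsOct.pop_one' P W u s n l1 l2 hP1 h.toIsOct]
    module
  rw [e2, e5, hPW]
  simp only [delta, oconj, Prod.snd_add, Prod.snd_sub, Prod.smul_snd]
  module

lemma vec7_killY : (S.gauge W).vec7
      (fun a c => -S.oip (S.killY P W u s l1 l2 a) (S.mul (delta c) W)) =
    (3 / 4 + (9 / 4) * S.normSq W) • u + (3 * l1 * s) • W.2 := by
  have h' := h.gauge_isOct hW
  have e1 : (fun a c => -S.oip (S.killY P W u s l1 l2 a) (S.mul (delta c) W)) = fun a c =>
      (((3 / 2) * S.oip (P (delta a)) (S.mul (delta c) W)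
        + ((1 / 2) * l1 * s) * (S.gauge W).ph W.2 a c)
        + ((1 / 4) * S.normSq W) * (S.gauge W).ph u a c)
        + ((1 / 2) * l1 * s * W.1 + (1 / 2) * l2 * s * S.normSq W) * S.ip a c := by
    funext a c
    rw [h.oip_killY_mul P W u s l1 l2 (S.gauge W).ph (h.normSq_mul_gauge hW)
      (fun a b c => h'.ph_swap b a c), h.gauge_ph_self hW]; ring
  have e2 := h.sum_cross_gauge P W u s n l1 l2 hPs hP1 hPW hPt hW
  change (S.gauge W).vec7 (fun a c => S.oip (P (delta a)) (S.mul (delta c) W)) = _ at e2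
  have e3 : (S.gauge W).vec7 S.ip = 0 := h'.vec7_symm _ h.ip_comm
  rw [e1, h'.vec7_add, h'.vec7_add, h'.vec7_add, h'.vec7_smul, h'.vec7_smul, h'.vec7_smul,
    h'.vec7_smul, e2, h'.vec7_ph, h'.vec7_ph, e3]
  module

end IsG2
end Pointwise
end OctKilling
end

/-! ### Equivalence of the equations and the conditions at one point -/

noncomputable section

namespace OctKilling

section Pointwise

variable {V : Type*} [AddCommGroup V] [Module ℝ V]

/-- The relations between the torsion components of `φ_X` and `φ_Y`, where `S` is the
`G₂`-structure `φ_X` and `S'` is `φ_Y`. -/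
def G2Point.TorsionRel (S S' : G2Point V) (W : Oct V) (u : V) (c : ℝ) (TX TY : V → V → ℝ) :
    Prop :=
  ∃ (x1 y1 : ℝ) (x7 y7 : V) (x14 x27 y14 y27 : V →ₗ[ℝ] V →ₗ[ℝ] ℝ),
    S.IsTorsionDecomp TX x1 x7 x14 x27 ∧ S'.IsTorsionDecomp TY y1 y7 y14 y27 ∧
    (x1 + S.normSq W * y1 = c * (1 + S.normSq W)) ∧
    (x7 + S.normSq W • y7 = ((1 / 2) * (1 + S.normSq W)) • u) ∧
    (∀ a : V, delta (S.sharp fun v => x14 a v - S.normSq W * y14 a v) =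
      -((1 / 8) * (S.normSq W + 1)) •
        S.mul (S.assoc (delta a) (delta u) W) (S.inv W)) ∧
    x27 + S.normSq W • y27 = 0

lemma IsOct.sharp_eq {S : G2Point V} (h : IsOct S) {f : V → ℝ} {x : V} (H : ∀ a, S.ip x a = f a) :
    S.sharp f = x := by
  simp only [G2Point.sharp, ← H, h.expand]

lemma IsOct.delta_sharp_eq_iff {S : G2Point V} (h : IsOct S) (f : V →ₗ[ℝ] ℝ) (R : Oct V) :
    delta (S.sharp f) = R ↔ R.1 = 0 ∧ ∀ a, S.ip R.2 a = f a := by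
  constructor
  · rintro rfl
    exact ⟨rfl, h.ip_sharp f⟩
  · rintro ⟨h1, h2⟩
    exact Prod.ext h1.symm (h.sharp_eq h2)

/-- W and the products δ_c W span the octonions, since right multiplication by W is invertible. E is
recovered from these components. -/
lemma IsOct.eq_of_oip_mul {S : G2Point V} (h : IsOct S) {W A B : Oct V} (hW : W ≠ 0)
    (h1 : S.oip A W = S.oip B W)
    (h2 : ∀ c, S.oip A (S.mul (delta c) W) = S.oip B (S.mul (delta c) W)) : A = B := by
  refine h.oext fun C => ?_
  rw [← h.mul_inv_mul hW C]
  generalize S.mul C (S.inv W) = D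
  obtain ⟨x, v⟩ := D
  rw [h.mk_mul, h.oip_add', h.oip_add', h.oip_smul', h.oip_smul', h1, h2]

namespace IsG2

variable {S : G2Point V} (h : IsG2 S)
include h

/-- The difference of a ∘ u for φ_W and a × u for φ, as an associator; in this form the difference
of the two 3-forms enters the relation for τ₁₄. -/
lemma assoc_mul_inv {W : Oct V} (hW : W ≠ 0) (a u : V) :
    (S.mul (S.assoc (delta a) (delta u) W) (S.inv W)).1 = 0 ∧
      ∀ c, S.ip (S.mul (S.assoc (delta a) (delta u) W) (S.inv W)).2 c =
        (S.gauge W).ph a u c - S.ph a u c := by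
  have key : ∀ B, S.oip (S.mul (S.assoc (delta a) (delta u) W) (S.inv W)) B = (S.normSq W)⁻¹ *
      (S.oip (S.mul (delta a) (S.mul (delta u) W)) (S.mul B W) -
        S.normSq W * S.oip (S.mul (delta a) (delta u)) B) := fun B => by
    have e : S.inv W = (S.normSq W)⁻¹ • oconj W := rfl
    rw [e, h.mul_smul, h.oip_smul, h.oip_mul_right, h.conj_conj, G2Point.assoc, h.oip_sub,
      h.oip_mul_mul]
  refine ⟨?_, fun c => ?_⟩
  · rw [← h.oip_one (S.mul _ _), key, h.one_mul, h.oip_L, h.oip_mul_delta_mul,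
      h.oip_delta_delta_one, h.ip_comm a u]
    ring
  · rw [← h.oip_delta, key, ← h.normSq_mul_gauge hW, h.oip_delta_delta_right, ← _root_.mul_sub,
      inv_mul_cancel_left₀ (h.normSq_ne_zero hW)]

variable {W : Oct V} (hW : W ≠ 0) (K E : V →ₗ[ℝ] Oct V) (Q0 : ℝ) (Q1 : V) (Q2 : V →ₗ[ℝ] V)
  (hQ : ∀ u v, S.ip (Q2 u) v = S.ip u (Q2 v)) (hQt : ∑ i, S.ip (Q2 (S.e i)) (S.e i) = 0)
  (u : V) (s n l1 l2 : ℝ) {TX TY : V → V → ℝ}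
  (hTX : ∀ a c, TX a c = -S.oip (K a) (delta c))
  (hTY : ∀ a c, S.normSq W * TY a c = -S.oip (E a) (S.mul (delta c) W))
  (hn : 2 * W.1 * l1 - l2 * (1 - S.normSq W) = n * (1 + S.normSq W))
  (h2 : Q2 W.2 = W.1 • Q1 - ((1 / 4) * (Q0 - 6 * l1 * s)) • W.2 - (3 / 4 : ℝ) • u)
  (h3 : (((7 / 3) * Q0, (4 / 3 : ℝ) • Q1) : Oct V) =
        S.mul (2 * s * (l2 - n), -u) W + (2 * l1 * s, 0))

section Rel

include hW hQ hQt hTX hTY hn h2 h3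

/-- The symmetric part of T^X + |W|² T^Y is a multiple of the metric: its trace gives τ₁, and the
rest says that the τ₂₇ cancel. The 7-components are known from the contractions `vec7_killX` and
`vec7_killY`, and subtracting them from the skew part leaves the relation for τ₁₄. -/
lemma torsionRel (hs : s ≠ 0) (hK : ∀ a, K a = S.killX (S.pop Q0 Q1 Q2) W u s l1 l2 a)
    (hE : ∀ a, E a = S.killY (S.pop Q0 Q1 Q2) W u s l1 l2 a) :
    S.TorsionRel (S.gauge W) W u ((1 / 2) * (s * n)) TX TY := by
  have h' := h.gauge_isOct hW
  have hN := h.normSq_ne_zero hW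
  obtain ⟨hP1, hPW⟩ := (h.pop_eqs_iff Q0 Q1 Q2 W u s n l1 l2 hQ hs).2 ⟨hn, h2, h3⟩
  have hPs := h.pop_oip Q0 Q1 Q2 hQ
  have hPt := h.sum_mul_pop Q0 Q1 Q2 hQ hQt
  let TX' : V →ₗ[ℝ] V →ₗ[ℝ] ℝ := LinearMap.mk₂ ℝ (fun a c => -S.oip (K a) (delta c))
    (fun a b c => by rw [map_add, h.oip_add]; ring)
    (fun r a c => by rw [map_smul, h.oip_smul, smul_eq_mul]; ring)
    (fun a b c => by rw [h.delta_add, h.oip_add']; ring)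
    (fun r a c => by rw [h.delta_smul, h.oip_smul', smul_eq_mul]; ring)
  let TY' : V →ₗ[ℝ] V →ₗ[ℝ] ℝ := LinearMap.mk₂ ℝ
    (fun a c => (S.normSq W)⁻¹ * -S.oip (E a) (S.mul (delta c) W))
    (fun a b c => by rw [map_add, h.oip_add]; ring)
    (fun r a c => by rw [map_smul, h.oip_smul, smul_eq_mul]; ring)
    (fun a b c => by rw [h.delta_add, h.add_mul, h.oip_add']; ring)
    (fun r a c => by rw [h.delta_smul, h.smul_mul, h.oip_smul', smul_eq_mul]; ring)
  have eX : TX = fun a c => TX' a c := by funext a c; exact hTX a c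
  have eY : TY = fun a c => TY' a c := by
    funext a c
    change _ = (S.normSq W)⁻¹ * -S.oip (E a) (S.mul (delta c) W)
    rw [← hTY, inv_mul_cancel_left₀ hN]
  obtain ⟨x1, x7, x14, x27, HX⟩ := h.exists_torsionDecomp TX'
  obtain ⟨y1, y7, y14, y27, HY⟩ := h'.exists_torsionDecomp TY'
  rw [← eX] at HX
  rw [← eY] at HY
  have hsym := h.killX_killY_symm (S.pop Q0 Q1 Q2) W u s n l1 l2 hPs (S.gauge W).ph
    (h.normSq_mul_gauge hW) (fun a b c => h'.ph_swap b a c) h'.ph_swap' hn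
  have hskew := h.killX_killY_skew (S.pop Q0 Q1 Q2) W u s l1 l2 hPs (S.gauge W).ph
    (h.normSq_mul_gauge hW) (fun a b c => h'.ph_swap b a c) h'.ph_swap'
  simp only [← hK, ← hE] at hsym hskew
  have c1 : x1 + S.normSq W * y1 = (1 / 2) * (s * n) * (1 + S.normSq W) := by
    have f1 := h.sum_torsion_self HX
    have f2 := h'.sum_torsion_self HY
    change ∑ i, TY (S.e i) (S.e i) = _ at f2
    have f3 : ∑ i, TX (S.e i) (S.e i) + S.normSq W * ∑ i, TY (S.e i) (S.e i) =
        (7 / 2) * (s * n * (1 + S.normSq W)) := by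
      have : ∀ i, TX (S.e i) (S.e i) + S.normSq W * TY (S.e i) (S.e i) =
          (1 / 2) * (s * n * (1 + S.normSq W) * S.ip (S.e i) (S.e i)) := fun i => by
        rw [← hsym, hTX, hTY]; ring
      rw [Finset.mul_sum, ← Finset.sum_add_distrib]
      simp only [this, ← Finset.mul_sum, h.sum_ip_self]
      ring
    rw [f1, f2] at f3
    linarith
  have v1 : x7 = (1 / 6 : ℝ) • ((9 / 4 + (3 / 4) * S.normSq W) • u - (3 * l1 * s) • W.2) := by
    rw [← h.vec7_killX Q0 Q1 Q2 W u s n l1 l2 hQ hQt h2 h3]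
    have := h.vec7_torsion HX
    have e : TX = fun a c => -S.oip (S.killX (S.pop Q0 Q1 Q2) W u s l1 l2 a) (delta c) := by
      funext a c; rw [← hK, hTX]
    rw [← e, this]; module
  have v2 : S.normSq W • y7 =
      (1 / 6 : ℝ) • ((3 / 4 + (9 / 4) * S.normSq W) • u + (3 * l1 * s) • W.2) := by
    rw [← h.vec7_killY _ W u s n l1 l2 hPs hP1 hPW hPt hW]
    have := h'.vec7_torsion HY
    have e : (fun a c => S.normSq W * TY a c) = fun a c =>
        -S.oip (S.killY (S.pop Q0 Q1 Q2) W u s l1 l2 a) (S.mul (delta c) W) := by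
      funext a c; rw [← hE, hTY]
    rw [← e, h'.vec7_smul, this]; module
  refine ⟨x1, y1, x7, y7, x14, x27, y14, y27, HX, HY, c1, ?_, fun a => ?_, ?_⟩
  · rw [v1, v2]; module
  · obtain ⟨a1, a2⟩ := h.assoc_mul_inv hW a u
    refine (h.delta_sharp_eq_iff (x14 a - S.normSq W • y14 a) _).2 ⟨?_, fun c => ?_⟩
    · rw [Prod.smul_fst, a1, smul_zero]
    · rw [Prod.smul_snd, h.ip_smul, a2]
      -- The skew parts are 2(τ₇ ⌟ φ + τ₁₄), with φ replaced by φ_W for Y. The terms with W.2 cancel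
      -- by `gauge_ph_self`, and u contributes (1 + |W|²)/8 times the difference of the two 3-forms.
      have g1 := h.torsion_sub HX a c
      have g2 := h'.torsion_sub HY a c
      have g3 := hskew a c
      have g4 : S.normSq W * (S.gauge W).ph y7 a c =
          (1 / 6) * ((3 / 4 + (9 / 4) * S.normSq W) * (S.gauge W).ph u a c
            + (3 * l1 * s) * S.ph W.2 a c) := by
        rw [← h'.ph_smul, v2, h'.ph_smul, h'.ph_add, h'.ph_smul, h'.ph_smul, h.gauge_ph_self hW]
      have g5 : S.ph x7 a c = (1 / 6) * ((9 / 4 + (3 / 4) * S.normSq W) * S.ph u a c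
          - (3 * l1 * s) * S.ph W.2 a c) := by
        rw [v1, h.ph_smul, sub_eq_add_neg, ← neg_smul, h.ph_add, h.ph_smul, h.ph_smul]; ring
      have g6 := hTX a c
      have g7 := hTX c a
      have g8 := hTY a c
      have g9 := hTY c a
      rw [h.ph_swap u a c, h'.ph_swap u a c]
      simp only [LinearMap.sub_apply, LinearMap.smul_apply, smul_eq_mul]
      linear_combination (1 / 2) * g1 - (1 / 2) * S.normSq W * g2 - (1 / 2) * g3 - g4 + g5
        - (1 / 2) * g6 + (1 / 2) * g7 + (1 / 2) * g8 - (1 / 2) * g9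
  · ext a c
    have g1 := h.torsion_add HX a c
    have g2 := h'.torsion_add HY a c
    change _ = 2 * y1 * S.ip a c + _ at g2
    have g3 := hsym a c
    simp only [LinearMap.add_apply, LinearMap.smul_apply, smul_eq_mul, LinearMap.zero_apply]
    linear_combination -(1 / 2) * g1 - (1 / 2) * S.normSq W * g2 + (1 / 2) * g3
      + (1 / 2) * hTX a c + (1 / 2) * hTX c a + (1 / 2) * hTY a c + (1 / 2) * hTY c a
      - S.ip a c * c1

/-- The equation for K fixes T^X and in particular its 7-component, so the relation for τ₇ gives
that of T^Y. The four relations then determine T^Y(a, c), and the P-free identities for `killX` and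
`killY` show that it has the required value. -/
lemma oip_eq_of_torsionRel
    (hK : ∀ a, K a = S.killX (S.pop Q0 Q1 Q2) W u s l1 l2 a)
    (H : S.TorsionRel (S.gauge W) W u ((1 / 2) * (s * n)) TX TY) (a c : V) :
    S.oip (E a) (S.mul (delta c) W) =
      S.oip (S.killY (S.pop Q0 Q1 Q2) W u s l1 l2 a) (S.mul (delta c) W) := by
  have h' := h.gauge_isOct hW
  have hPs := h.pop_oip Q0 Q1 Q2 hQ
  obtain ⟨x1, y1, x7, y7, x14, x27, y14, y27, HX, HY, c1, c7, c14, c27⟩ := H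
  have hsym := h.killX_killY_symm (S.pop Q0 Q1 Q2) W u s n l1 l2 hPs (S.gauge W).ph
    (h.normSq_mul_gauge hW) (fun a b c => h'.ph_swap b a c) h'.ph_swap' hn a c
  have hskew := h.killX_killY_skew (S.pop Q0 Q1 Q2) W u s l1 l2 hPs (S.gauge W).ph
    (h.normSq_mul_gauge hW) (fun a b c => h'.ph_swap b a c) h'.ph_swap' a c
  simp only [← hK, ← hTX] at hsym hskew
  have v1 : x7 = (1 / 6 : ℝ) • ((9 / 4 + (3 / 4) * S.normSq W) • u - (3 * l1 * s) • W.2) := by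
    rw [← h.vec7_killX Q0 Q1 Q2 W u s n l1 l2 hQ hQt h2 h3]
    have := h.vec7_torsion HX
    have e : TX = fun a c => -S.oip (S.killX (S.pop Q0 Q1 Q2) W u s l1 l2 a) (delta c) := by
      funext a c; rw [← hK, hTX]
    rw [← e, this]; module
  have v2 : S.normSq W • y7 =
      (1 / 6 : ℝ) • ((3 / 4 + (9 / 4) * S.normSq W) • u + (3 * l1 * s) • W.2) := by
    rw [eq_sub_of_add_eq' c7, v1]; module
  have g4 : S.normSq W * (S.gauge W).ph y7 a c =
      (1 / 6) * ((3 / 4 + (9 / 4) * S.normSq W) * (S.gauge W).ph u a c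
        + (3 * l1 * s) * S.ph W.2 a c) := by
    rw [← h'.ph_smul, v2, h'.ph_smul, h'.ph_add, h'.ph_smul, h'.ph_smul, h.gauge_ph_self hW]
  have g5 : S.ph x7 a c = (1 / 6) * ((9 / 4 + (3 / 4) * S.normSq W) * S.ph u a c
      - (3 * l1 * s) * S.ph W.2 a c) := by
    rw [v1, h.ph_smul, sub_eq_add_neg, ← neg_smul, h.ph_add, h.ph_smul, h.ph_smul]; ring
  have d14 : x14 a c - S.normSq W * y14 a c =
      (1 / 8) * (S.normSq W + 1) * ((S.gauge W).ph u a c - S.ph u a c) := by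
    have := ((h.delta_sharp_eq_iff (x14 a - S.normSq W • y14 a) _).1 (c14 a)).2 c
    rw [Prod.smul_snd, h.ip_smul, (h.assoc_mul_inv hW a u).2, h.ph_swap u a c,
      h'.ph_swap u a c] at this
    simp only [LinearMap.sub_apply, LinearMap.smul_apply, smul_eq_mul] at this
    linarith
  have d27 : x27 a c + S.normSq W * y27 a c = 0 :=
    congrArg (fun B : V →ₗ[ℝ] V →ₗ[ℝ] ℝ => B a c) c27
  have g1 := h.torsion_add HX a c
  have g2 := h'.torsion_add HY a c
  change _ = 2 * y1 * S.ip a c + _ at g2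
  have g6 := h.torsion_sub HX a c
  have g7 := h'.torsion_sub HY a c
  linear_combination (1 / 2) * hsym - (1 / 2) * hskew + hTY a c - (1 / 2) * S.normSq W * g2
    - (1 / 2) * S.normSq W * g7 - (1 / 2) * g1 + (1 / 2) * g6 + hTX c a - S.ip a c * c1 - d27 + d14
    - g4 + g5

end Rel

include hW hQ hQt hTX hTY

/-- The Killing equations and the four conditions at one point, for `W = Y X⁻¹`,
`K = (D X) X⁻¹` and `E = (D Y) X⁻¹`. -/
lemma killing_iff (hs : s ≠ 0) :
    (S.pop Q0 Q1 Q2 (1, 0) = -(l1 * s, 0) - (l2 * s) • W + S.mul (s * n, (1 / 2 : ℝ) • u) W ∧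
      S.pop Q0 Q1 Q2 W = (-(l2 * s), 0) + (l1 * s) • W - (s * n, (1 / 2 : ℝ) • u) ∧
      (∀ a, K a = S.killX (S.pop Q0 Q1 Q2) W u s l1 l2 a) ∧
      ∀ a, E a = S.killY (S.pop Q0 Q1 Q2) W u s l1 l2 a) ↔
    ((2 * W.1 * l1 - l2 * (1 - S.normSq W) = n * (1 + S.normSq W) ∧
        (∀ a, S.oip (E a) (1, 0) + S.oip W (K a) - 2 * W.1 * S.oip (K a) (1, 0) =
          -(3 / 2) * (1 + S.normSq W) * W.1 * S.ip u a - 4 * (W.1 * l1 - l2) * s * S.ip W.2 a) ∧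
        ∀ a, (2 * S.oip (E a) W - 2 * S.normSq W * S.oip (K a) (1, 0)) / (1 + S.normSq W) =
          (3 / 2) * (1 - S.normSq W) * S.ip u a - 4 * l1 * s * S.ip W.2 a) ∧
      (Q2 W.2 = W.1 • Q1 - ((1 / 4) * (Q0 - 6 * l1 * s)) • W.2 - (3 / 4 : ℝ) • u ∧
        (((7 / 3) * Q0, (4 / 3 : ℝ) • Q1) : Oct V) =
          S.mul (2 * s * (l2 - n), -u) W + (2 * l1 * s, 0) ∧
        ∀ m, delta (S.sharp fun a => TX a m) =
          S.mul (S.ip Q1 m, -((1 / 4) * (Q0 - 2 * l1 * s)) • m - Q2 m) (oconj W)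
            + (1 / 4 : ℝ) • S.mul (delta m) (delta u)
            + (l1 * s * S.ip W.2 m - (1 / 2) * S.ip u m, -((1 / 2) * l2 * s) • m)) ∧
      S.TorsionRel (S.gauge W) W u ((1 / 2) * (s * n)) TX TY) ∧
      ∀ a, 2 * S.oip (K a) (1, 0) + 2 * S.oip (E a) W = (1 + S.normSq W) * S.ip u a := by
  have hPs := h.pop_oip Q0 Q1 Q2 hQ
  have hS : (1 + S.normSq W) ≠ 0 := by have := h.normSq_nonneg W; positivity
  have hR : ∀ m, ((S.ip Q1 m, -((1 / 4) * (Q0 - 2 * l1 * s)) • m - Q2 m) : Oct V) =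
      -(3 / 2 : ℝ) • S.pop Q0 Q1 Q2 (delta m) + ((1 / 2) * l1 * s) • delta m := fun m => by
    refine Prod.ext ?_ ?_
    · simp [G2Point.pop, delta]; ring
    · simp [G2Point.pop, delta]; module
  -- Given the equation for PW, the right side for the transposed torsion is imaginary, so the
  -- equation only compares the imaginary parts of K and of `killX`.
  have hT : ∀ m, S.pop Q0 Q1 Q2 W = (-(l2 * s), 0) + (l1 * s) • W - (s * n, (1 / 2 : ℝ) • u) →
      ((delta (S.sharp fun a => TX a m) =
          S.mul (S.ip Q1 m, -((1 / 4) * (Q0 - 2 * l1 * s)) • m - Q2 m) (oconj W)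
            + (1 / 4 : ℝ) • S.mul (delta m) (delta u)
            + (l1 * s * S.ip W.2 m - (1 / 2) * S.ip u m, -((1 / 2) * l2 * s) • m)) ↔
        ∀ a, S.oip (K a) (delta m) = S.oip (S.killX (S.pop Q0 Q1 Q2) W u s l1 l2 a) (delta m)) := by
    intro m hPW
    have e : (fun a => TX a m) = (-(h.oipl (delta m) ∘ₗ K) : V →ₗ[ℝ] ℝ) := by
      funext a; rw [hTX, h.oip_comm]; rfl
    obtain ⟨t1, t2⟩ := h.torsionTranspose_rhs (S.pop Q0 Q1 Q2) W u s n l1 l2 hPs hPW m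
    rw [hR, e, h.delta_sharp_eq_iff]
    constructor
    · rintro ⟨-, H⟩ a
      have := (t2 a).symm.trans (H a)
      rw [← congrFun e a, hTX] at this
      linarith
    · intro H
      refine ⟨t1, fun a => ?_⟩
      rw [t2, ← congrFun e a, hTX, H]
  constructor
  · rintro ⟨hP1, hPW, hK, hE⟩
    obtain ⟨c1, c2, c3⟩ := (h.pop_eqs_iff Q0 Q1 Q2 W u s n l1 l2 hQ hs).1 ⟨hP1, hPW⟩
    have f1 := h.oip_killX_one _ W u s n l1 l2 hPs hP1
    have f2 := h.oip_killY_quot _ W u s n l1 l2 hPs hPW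
    have f3 := h.oip_killY_one _ W u s n l1 l2 hPs hP1 hPW
    simp only [← hK, ← hE] at f1 f2 f3
    refine ⟨⟨⟨c1, fun a => ?_, fun a => ?_⟩, ⟨c2, c3, fun m => ?_⟩, ?_⟩, fun a => ?_⟩
    · rw [f3, f1, h.ip_comm u, h.ip_comm W.2]; ring
    · rw [div_eq_iff hS, f2, f1, h.ip_comm u, h.ip_comm W.2]; ring
    · exact (hT m hPW).2 fun a => by rw [hK]
    · exact h.torsionRel hW K E Q0 Q1 Q2 hQ hQt u s n l1 l2 hTX hTY c1 c2 c3 hs hK hE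
    · rw [f1, f2, h.ip_comm u]; ring
  · rintro ⟨⟨⟨c1, -, c1c⟩, ⟨c2, c3, c4⟩, c5⟩, c6⟩
    obtain ⟨hP1, hPW⟩ := (h.pop_eqs_iff Q0 Q1 Q2 W u s n l1 l2 hQ hs).2 ⟨c1, c2, c3⟩
    have f1 := h.oip_killX_one _ W u s n l1 l2 hPs hP1
    have f2 := h.oip_killY_quot _ W u s n l1 l2 hPs hPW
    -- The equations for d|W|² and for the norm are two linear equations for Re K and ⟨E, W⟩.
    -- Subtracting them leaves 2(1 + |W|²) Re K, and 1 + |W|² is not zero.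
    have g1 : ∀ a, S.oip (K a) (1, 0) =
        2 * l1 * s * S.ip a W.2 + ((3 / 4) * S.normSq W - 1 / 4) * S.ip a u := fun a => by
      have := c1c a
      rw [div_eq_iff hS] at this
      refine mul_left_cancel₀ hS ?_
      rw [h.ip_comm a, h.ip_comm a]
      linear_combination (1 / 2) * c6 a - (1 / 2) * this
    have hK : ∀ a, K a = S.killX (S.pop Q0 Q1 Q2) W u s l1 l2 a := fun a => by
      refine h.oext' ?_ fun m => (hT m hPW).1 (c4 m) a
      rw [← h.oip_one, ← h.oip_one, g1, f1]
    refine ⟨hP1, hPW, hK, fun a => h.eq_of_oip_mul hW ?_ fun c => ?_⟩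
    · rw [f2]
      have := c6 a
      rw [g1, h.ip_comm u] at this
      linarith
    · exact h.oip_eq_of_torsionRel hW K E Q0 Q1 Q2 hQ hQt u s n l1 l2 hTX hTY c1 c2 c3 hK c5 a c

end IsG2
end Pointwise
end OctKilling
end

/-! ### Division of the Killing equations by `X` -/

noncomputable section

namespace OctKilling

section Pointwise

variable {V : Type*} [AddCommGroup V] [Module ℝ V]

namespace IsG2

variable {R : G2Point V} (h : IsG2 R) {X : Oct V} (hX : X ≠ 0)
include h hX

lemma cl4_gauge (G : V → V → V → V → ℝ) (A : Oct V) :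
    R.cl4 G (R.mul A X) = R.mul ((R.gauge X).cl4 G A) X := by
  simp only [G2Point.cl4, h.gauge_mul_delta hX, h.sum_mul, h.smul_mul]
  rfl

lemma cl3_gauge (G : V → V → V → V → ℝ) (u : V) (A : Oct V) :
    R.cl3 G u (R.mul A X) = R.mul ((R.gauge X).cl3 G u A) X := by
  simp only [G2Point.cl3, h.gauge_mul_delta hX, h.sum_mul, h.smul_mul]
  rfl

lemma mul_eq_zero_iff (A : Oct V) : R.mul A X = 0 ↔ A = 0 :=
  ⟨fun H => h.mul_right_cancel hX (H.trans (h.zero_mul X).symm), fun H => by rw [H, h.zero_mul]⟩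

/-- The Killing equations at one point, divided by `X`. -/
lemma killing_div (hS : IsG2 (R.gauge X)) {G : V → V → V → V → ℝ} (hG : IsAlt4 G) {Q0 : ℝ} {Q1 : V}
    {Q2 : V →ₗ[ℝ] V} (hdec : (R.gauge X).IsFourFormDecomp G Q0 Q1 Q2) {Y W : Oct V}
    (hY : R.mul W X = Y) (DX DY K E : V → Oct V) (hK : ∀ a, R.mul (K a) X = DX a)
    (hE : ∀ a, R.mul (E a) X = DY a) (u : V) (s m n l1 l2 : ℝ) (hm : m = s * n) :
    (0 = csmul ((⟨l1, l2⟩ : ℂ) * (s : ℂ)) (cstar (X, Y))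
        + csmul Complex.I (R.lmul (m, (1 / 2 : ℝ) • u) (X, Y))
        + (1 / 144 : ℝ) • R.cliff4 G (X, Y) ∧
      ∀ a : V, ((DX a, DY a) : COct V) =
        -(((1 / 2 : ℝ) * m) • R.lmul (delta a) (X, Y))
        - csmul (Complex.I / 144) (R.lmul (delta a) (R.cliff4 G (X, Y)))
        - csmul (Complex.I / 12) (R.cliff3 G a (X, Y))) ↔
    ((R.gauge X).pop Q0 Q1 Q2 (1, 0) = -(l1 * s, 0) - (l2 * s) • W
        + (R.gauge X).mul (s * n, (1 / 2 : ℝ) • u) W ∧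
      (R.gauge X).pop Q0 Q1 Q2 W = (-(l2 * s), 0) + (l1 * s) • W - (s * n, (1 / 2 : ℝ) • u) ∧
      (∀ a, K a = (R.gauge X).killX ((R.gauge X).pop Q0 Q1 Q2) W u s l1 l2 a) ∧
      ∀ a, E a = (R.gauge X).killY ((R.gauge X).pop Q0 Q1 Q2) W u s l1 l2 a) := by
  subst hm
  set S := R.gauge X with hSdef
  set P := S.pop Q0 Q1 Q2 with hP
  have gm : ∀ A B, R.mul A (R.mul B X) = R.mul (S.mul A B) X := h.gauge_mul hX
  have hone : R.mul (1, 0) X = X := h.one_mul X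
  have c1 : R.cl4 G X = R.mul ((144 : ℝ) • P (1, 0)) X := by
    conv_lhs => rw [← hone, h.cl4_gauge hX, hS.cl4_eq hdec]
  have c2 : R.cl4 G Y = R.mul ((144 : ℝ) • P W) X := by
    rw [← hY, h.cl4_gauge hX, hS.cl4_eq hdec]
  -- The commutator identity solved for the action of a ⌟ G; 18 = 144/8.
  have c3 : ∀ a A, S.cl3 G a A = (18 : ℝ) • (P (S.mul (delta a) A) - S.mul (delta a) (P A)) := by
    intro a A
    have := hS.mul_cl4 hG a A
    rw [hS.cl4_eq hdec, hS.cl4_eq hdec, hS.mul_smul] at this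
    have e : S.cl3 G a A = (1 / 8 : ℝ) • ((144 : ℝ) • P (S.mul (delta a) A) -
        ((144 : ℝ) • P (S.mul (delta a) A) - (8 : ℝ) • S.cl3 G a A)) := by module
    rw [e, ← this]; module
  have c4 : ∀ a, R.cl3 G a X = R.mul ((18 : ℝ) • (P (delta a) - S.mul (delta a) (P (1, 0)))) X := by
    intro a
    conv_lhs => rw [← hone, h.cl3_gauge hX, c3, hS.mul_one]
  have c5 : ∀ a, R.cl3 G a Y =
      R.mul ((18 : ℝ) • (P (S.mul (delta a) W) - S.mul (delta a) (P W))) X := fun a => by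
    rw [← hY, h.cl3_gauge hX, c3]
  have i1 : (0 = csmul ((⟨l1, l2⟩ : ℂ) * (s : ℂ)) (cstar (X, Y))
        + csmul Complex.I (R.lmul (s * n, (1 / 2 : ℝ) • u) (X, Y))
        + (1 / 144 : ℝ) • R.cliff4 G (X, Y)) ↔
      (P (1, 0) = -(l1 * s, 0) - (l2 * s) • W + S.mul (s * n, (1 / 2 : ℝ) • u) W ∧
      P W = (-(l2 * s), 0) + (l1 * s) • W - (s * n, (1 / 2 : ℝ) • u)) := by
    have d1 : csmul ((⟨l1, l2⟩ : ℂ) * (s : ℂ)) (cstar (X, Y))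
        + csmul Complex.I (R.lmul (s * n, (1 / 2 : ℝ) • u) (X, Y))
        + (1 / 144 : ℝ) • R.cliff4 G (X, Y) =
        (R.mul (P (1, 0) - (-(l1 * s, 0) - (l2 * s) • W + S.mul (s * n, (1 / 2 : ℝ) • u) W)) X,
          R.mul (P W - ((-(l2 * s), 0) + (l1 * s) • W - (s * n, (1 / 2 : ℝ) • u))) X) := by
      have r : ∀ r : ℝ, R.mul (r, 0) X = r • X := fun r => h.real_mul r X
      rw [G2Point.cliff4_eq, c1, c2]
      refine Prod.ext ?_ ?_
      · simp only [csmul, cstar, G2Point.lmul, Prod.fst_add, Prod.smul_fst, h.sub_mul, h.add_mul,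
          h.neg_mul, h.smul_mul, hY, r, ← gm]
        simp
        module
      · simp only [csmul, cstar, G2Point.lmul, Prod.snd_add, Prod.smul_snd, h.sub_mul, h.add_mul,
          h.neg_mul, h.smul_mul, hY, r]
        have e : R.mul (-(l2 * s), 0) X = (-(l2 * s)) • X := r _
        simp
        module
    rw [d1, eq_comm, Prod.mk_eq_zero, h.mul_eq_zero_iff hX, h.mul_eq_zero_iff hX, sub_eq_zero,
      sub_eq_zero]
  rw [i1, and_assoc]
  refine and_congr_right fun hP1 => and_congr_right fun hPW => ?_
  rw [← forall_and]
  refine forall_congr' fun a => ?_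
  have hPW' := IsOct.pop_quot' P W u s n l1 l2 hPW
  have hP1' := IsOct.pop_one' P W u s n l1 l2 hP1 hS.toIsOct
  -- After `c3`, the coefficient of δ_a P is i(3/2 − 1). Inserting the values of P1 and PW removes
  -- these terms, and the contribution of μ cancels against −½ μ e^{-4Δ} δ_a, so that `killX` and
  -- `killY` do not contain μ.
  have d2 : -(((1 / 2 : ℝ) * (s * n)) • R.lmul (delta a) (X, Y))
        - csmul (Complex.I / 144) (R.lmul (delta a) (R.cliff4 G (X, Y)))
        - csmul (Complex.I / 12) (R.cliff3 G a (X, Y)) =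
      (R.mul (S.killX P W u s l1 l2 a) X, R.mul (S.killY P W u s l1 l2 a) X) := by
    have e1 : (Complex.I / 144).re = 0 := by simp
    have e2 : (Complex.I / 144).im = 1 / 144 := by simp
    have e3 : (Complex.I / 12).re = 0 := by simp
    have e4 : (Complex.I / 12).im = 1 / 12 := by simp
    have e5 : R.mul (delta a) Y = R.mul (S.mul (delta a) W) X := by rw [← hY, h.gauge_mul_delta hX]
    rw [G2Point.cliff4_eq, G2Point.cliff3_eq, c1, c2, c4, c5]
    refine Prod.ext ?_ ?_
    · simp only [csmul, G2Point.lmul, Prod.fst_sub, Prod.fst_neg, Prod.smul_fst, e1, e2, e3, e4,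
        gm]
      simp only [G2Point.killX, hPW', hS.mul_smul, hS.mul_sub, hS.mul_add, hS.mul_one,
        h.smul_mul, h.sub_mul, h.add_mul]
      module
    · simp only [csmul, G2Point.lmul, Prod.snd_sub, Prod.snd_neg, Prod.smul_snd, e1, e2, e3, e4,
        gm]
      simp only [G2Point.killY, hP1', hS.mul_smul, hS.mul_sub, hS.mul_add, hS.mul_one,
        h.smul_mul, h.sub_mul, h.add_mul, h.neg_mul, e5]
      module
  rw [d2, ← hK, ← hE, Prod.mk.injEq]
  exact and_congr ⟨fun H => h.mul_right_cancel hX H, fun H => by rw [H]⟩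
    ⟨fun H => h.mul_right_cancel hX H, fun H => by rw [H]⟩

end IsG2
end Pointwise
end OctKilling
end

/-! ### The pointwise structures defined by forms on the manifold -/

noncomputable section

namespace OctKilling

variable {M : Type*} [TopologicalSpace M] [ChartedSpace E7 M] [IsManifold (𝓡 7) ∞ M]

lemma alternating3_add {V : Type*} [AddCommGroup V] [Module ℝ V] (f : V [⋀^Fin 3]→ₗ[ℝ] ℝ)
    (a a' b c : V) : f ![a + a', b, c] = f ![a, b, c] + f ![a', b, c] :=
  f.map_vecCons_add ![b, c] a a'

lemma alternating3_smul {V : Type*} [AddCommGroup V] [Module ℝ V] (f : V [⋀^Fin 3]→ₗ[ℝ] ℝ)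
    (r : ℝ) (a b c : V) : f ![r • a, b, c] = r * f ![a, b, c] :=
  f.map_vecCons_smul ![b, c] r a

lemma alternating3_swap {V : Type*} [AddCommGroup V] [Module ℝ V] (f : V [⋀^Fin 3]→ₗ[ℝ] ℝ)
    (a b c : V) : f ![b, a, c] = -f ![a, b, c] := by
  rw [← f.map_swap ![a, b, c] (i := 0) (j := 1) (by decide)]
  congr 1; funext i; fin_cases i <;> rfl

lemma alternating3_swap' {V : Type*} [AddCommGroup V] [Module ℝ V] (f : V [⋀^Fin 3]→ₗ[ℝ] ℝ)
    (a b c : V) : f ![a, c, b] = -f ![a, b, c] := by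
  rw [← f.map_swap ![a, b, c] (i := 1) (j := 2) (by decide)]
  congr 1; funext i; fin_cases i <;> rfl

lemma isAlt4_alternating {V : Type*} [AddCommGroup V] [Module ℝ V] (f : V [⋀^Fin 4]→ₗ[ℝ] ℝ) :
    IsAlt4 (fun a b c d => f ![a, b, c, d]) where
  add a a' b c d := f.map_vecCons_add ![b, c, d] a a'
  smul r a b c d := f.map_vecCons_smul ![b, c, d] r a
  swap₁ a b c d := by
    rw [← f.map_swap ![a, b, c, d] (i := 0) (j := 1) (by decide)]
    congr 1; funext i; fin_cases i <;> rfl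
  swap₂ a b c d := by
    rw [← f.map_swap ![a, b, c, d] (i := 1) (j := 2) (by decide)]
    congr 1; funext i; fin_cases i <;> rfl
  swap₃ a b c d := by
    rw [← f.map_swap ![a, b, c, d] (i := 2) (j := 3) (by decide)]
    congr 1; funext i; fin_cases i <;> rfl

lemma isAlt4_form4 (G : FormField M 4) (p : M) : IsAlt4 (form4 G p) := isAlt4_alternating (G p)

/-- Seven orthonormal vectors are independent, hence a basis of the 7-dimensional tangent space. -/
lemma frame_expand (g : Metric7 M) {p : M} {e : Fin 7 → TangentSpace (𝓡 7) p}
    (he : ∀ i j, g.inner p (e i) (e j) = if i = j then 1 else 0) (v : TangentSpace (𝓡 7) p) :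
    ∑ i, g.inner p v (e i) • e i = v := by
  have hli : LinearIndependent ℝ e := by
    rw [Fintype.linearIndependent_iff]
    intro c hc i
    have := congrArg (fun v => g.inner p v (e i)) hc
    simpa [map_sum, he, sum_apply] using this
  have hcard : Fintype.card (Fin 7) = Module.finrank ℝ (TangentSpace (𝓡 7) p) := by
    change _ = Module.finrank ℝ E7
    simp
  let b := basisOfLinearIndependentOfCardEqFinrank hli hcard
  have hb : ∀ i, b i = e i := fun i => by simp [b]
  obtain ⟨c, rfl⟩ : ∃ c : Fin 7 → ℝ, ∑ i, c i • e i = v :=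
    ⟨b.repr v, by simpa [hb] using b.sum_repr v⟩
  refine Finset.sum_congr rfl fun i _ => ?_
  congr 1
  simp [map_sum, he, sum_apply]

section Structure

variable {g : Metric7 M} {φ : FormField M 3} (hφ : IsG2Structure g φ)
include hφ

lemma IsG2Structure.adaptedFrame (p : M) : IsAdaptedFrame g φ p (adaptedFrame g φ p) :=
  Classical.epsilon_spec (hφ.2 p)

lemma IsG2Structure.g2_ph (p : M) (i j k : Fin 7) :
    (g2 g φ p).ph ((g2 g φ p).e i) ((g2 g φ p).e j) ((g2 g φ p).e k) = phi0 i j k :=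
  (hφ.adaptedFrame p).2 i j k

lemma IsG2Structure.isG2 (p : M) : IsG2 (g2 g φ p) := by
  have ho : IsOct (g2 g φ p) := isOct_of_frame
    (fun u v w => by simp [g2]) (fun c u w => by simp [g2]) (fun u v => g.symm p u v)
    (hφ.adaptedFrame p).1 (frame_expand g (hφ.adaptedFrame p).1)
    (fun u u' v w => alternating3_add (φ p) u u' v w)
    (fun c u v w => alternating3_smul (φ p) c u v w)
    (fun u v w => alternating3_swap (φ p) u v w)
    (fun u v w => alternating3_swap' (φ p) u v w) (hφ.g2_ph p)
  exact ho.isG2_of_frame (hφ.g2_ph p)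

lemma IsG2Structure.gauge_isG2 {X : OctField M} {p : M} (hX : X p ≠ 0) :
    IsG2 (g2gauge g φ X p) :=
  (hφ.isG2 p).gauge_isG2 (hφ.g2_ph p) hX

end Structure
end OctKilling
end

/-! ### Vector fields in the chart at a point -/

noncomputable section
namespace OctKilling
variable {M : Type*} [TopologicalSpace M] [ChartedSpace E7 M] [IsManifold (𝓡 7) ∞ M]

/-- Differentiability of a function at a point. -/
abbrev DFun (f : M → ℝ) (p : M) : Prop := MDifferentiableAt (𝓡 7) 𝓘(ℝ) f p

/-- Differentiability of a vector field at a point. -/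
def DVec (U : ∀ q : M, TangentSpace (𝓡 7) q) (p : M) : Prop :=
  MDifferentiableAt (𝓡 7) (𝓡 7).tangent (fun q => (⟨q, U q⟩ : TangentBundle (𝓡 7) M)) p

lemma dVec_iff {U : ∀ q : M, TangentSpace (𝓡 7) q} {p : M} : DVec U p ↔
    MDifferentiableAt (𝓡 7) 𝓘(ℝ, E7)
      (fun q => (trivializationAt E7 (fun q : M => TangentSpace (𝓡 7) q) p ⟨q, U q⟩).2) p :=
  mdifferentiableAt_section (𝓡 7) U

lemma dVec_coordField {p : M} (v : TangentSpace (𝓡 7) p) : DVec (coordField v) p :=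
  FiberBundle.mdifferentiableAt_extend (𝓡 7) E7 v

lemma coordField_self {p : M} (v : TangentSpace (𝓡 7) p) : coordField v p = v :=
  FiberBundle.extend_apply_self E7 v

lemma eventually_mem_baseSet (p : M) : ∀ᶠ q in nhds p,
    q ∈ (trivializationAt E7 (fun q : M => TangentSpace (𝓡 7) q) p).baseSet :=
  (trivializationAt E7 (fun q : M => TangentSpace (𝓡 7) q) p).open_baseSet.mem_nhds
    (FiberBundle.mem_baseSet_trivializationAt' p)

/-- The constant identification of `T_pM` with the model space by the chart at `p`. -/
def chartEquiv (p : M) : TangentSpace (𝓡 7) p ≃L[ℝ] E7 :=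
  (trivializationAt E7 (fun q : M => TangentSpace (𝓡 7) q) p).continuousLinearEquivAt ℝ p
    (FiberBundle.mem_baseSet_trivializationAt' p)

lemma chartEquiv_symm (p : M) (v : E7) : (chartEquiv p).symm v =
  (trivializationAt E7 (fun q : M => TangentSpace (𝓡 7) q) p).symm p v := rfl

lemma exists_coordField_eq {p q : M}
    (hq : q ∈ (trivializationAt E7 (fun q : M => TangentSpace (𝓡 7) q) p).baseSet) :
    ∃ L : TangentSpace (𝓡 7) p →ₗ[ℝ] TangentSpace (𝓡 7) q, ∀ v, coordField v q = L v := by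
  refine ⟨((trivializationAt E7 (fun q : M => TangentSpace (𝓡 7) q) p).symmₗ ℝ q).comp
    (chartEquiv p).toLinearMap, fun v => ?_⟩
  simp only [LinearMap.comp_apply, Bundle.Trivialization.coe_symmₗ _ hq]
  rfl

/-- The components at `p` of a field in the chart at `p`. -/
def chartComp (U : ∀ q : M, TangentSpace (𝓡 7) q) (p q : M) : TangentSpace (𝓡 7) p :=
  (chartEquiv p).symm
    (trivializationAt E7 (fun q : M => TangentSpace (𝓡 7) q) p ⟨q, U q⟩).2

lemma coordField_chartComp (U : ∀ q : M, TangentSpace (𝓡 7) q) {p q : M}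
    (hq : q ∈ (trivializationAt E7 (fun q : M => TangentSpace (𝓡 7) q) p).baseSet) :
    coordField (chartComp U p q) q = U q := by
  have : coordField (chartComp U p q) q =
      (trivializationAt E7 (fun q : M => TangentSpace (𝓡 7) q) p).symm q
        (chartEquiv p (chartComp U p q)) := rfl
  rw [this, chartComp, ContinuousLinearEquiv.apply_symm_apply]
  exact Bundle.Trivialization.symm_apply_apply_mk _ hq _

lemma coordField_sum {p q : M}
    (hq : q ∈ (trivializationAt E7 (fun q : M => TangentSpace (𝓡 7) q) p).baseSet)
    (c : Fin 7 → ℝ) (e : Fin 7 → TangentSpace (𝓡 7) p) :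
    coordField (∑ m, c m • e m) q = ∑ m, c m • coordField (e m) q := by
  obtain ⟨L, hL⟩ := exists_coordField_eq hq
  simp [hL]

lemma coordField_add {p q : M}
    (hq : q ∈ (trivializationAt E7 (fun q : M => TangentSpace (𝓡 7) q) p).baseSet)
    (u v : TangentSpace (𝓡 7) p) :
    coordField (u + v) q = coordField u q + coordField v q := by
  obtain ⟨L, hL⟩ := exists_coordField_eq hq
  simp [hL]

lemma coordField_smul {p q : M}
    (hq : q ∈ (trivializationAt E7 (fun q : M => TangentSpace (𝓡 7) q) p).baseSet)
    (r : ℝ) (v : TangentSpace (𝓡 7) p) :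
    coordField (r • v) q = r • coordField v q := by
  obtain ⟨L, hL⟩ := exists_coordField_eq hq
  simp [hL]

/-- The components of a differentiable field in an orthonormal frame at `p`. -/
lemma DVec.exists_comp (g : Metric7 M) {p : M} {e : Fin 7 → TangentSpace (𝓡 7) p}
    (he : ∀ i j, g.inner p (e i) (e j) = if i = j then 1 else 0)
    {U : ∀ q : M, TangentSpace (𝓡 7) q} (hU : DVec U p) :
    ∃ u : Fin 7 → M → ℝ, (∀ m, DFun (u m) p) ∧
      (∀ᶠ q in nhds p, U q = ∑ m, u m q • coordField (e m) q) ∧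
      ∀ w, nablaVec g e U w =
        ∑ m, mvfderiv (𝓡 7) (u m) p w • e m + christoffel g e w (U p) := by
  rw [dVec_iff] at hU
  let F : M → E7 := fun q =>
    (trivializationAt E7 (fun q : M => TangentSpace (𝓡 7) q) p ⟨q, U q⟩).2
  -- The component functions are scalar products taken in the fixed space T_pM after identification
  -- by the chart, so each is a fixed linear map applied to the chart representation.
  let L : Fin 7 → E7 →L[ℝ] ℝ := fun m =>
    (g.inner p (e m)).comp (chartEquiv p).symm.toContinuousLinearMap
  have hL : ∀ m v, L m v = g.inner p ((chartEquiv p).symm v) (e m) := fun m v => g.symm _ _ _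
  refine ⟨fun m q => L m (F q), fun m => ?_, ?_, fun w => ?_⟩
  · exact ((L m).differentiableAt.comp_mdifferentiableAt (x := p) hU)
  · filter_upwards [eventually_mem_baseSet p] with q hq
    rw [← coordField_sum hq]
    simp only [hL]
    rw [frame_expand g he]
    exact (coordField_chartComp U hq).symm
  · unfold nablaVec
    congr 1
    have h1 : ∀ m, mvfderiv (𝓡 7) (fun q => L m (F q)) p w = L m (mvfderiv (𝓡 7) F p w) := by
      intro m
      have hLm : MDifferentiableAt 𝓘(ℝ, E7) 𝓘(ℝ) (L m) (F p) :=
        (L m).differentiableAt.mdifferentiableAt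
      have := mfderiv_comp_apply (I := 𝓡 7) (I' := 𝓘(ℝ, E7)) (I'' := 𝓘(ℝ)) p hLm hU w
      change mfderiv (𝓡 7) 𝓘(ℝ) (L m ∘ F) p w = _
      refine this.trans ?_
      rw [(L m).hasMFDerivAt.mfderiv]
      rfl
    have h2 : ∀ m, mvfderiv (𝓡 7) (fun q => L m (F q)) p w =
        g.inner p ((chartEquiv p).symm (mvfderiv (𝓡 7) F p w)) (e m) := fun m => by
      rw [h1, hL]
    rw [Finset.sum_congr rfl fun m _ => by rw [h2 m], frame_expand g he, chartEquiv_symm]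

end OctKilling
end

/-! ### The Levi-Civita connection and its Leibniz rules -/

noncomputable section

namespace OctKilling

variable {M : Type*} [TopologicalSpace M] [ChartedSpace E7 M] [IsManifold (𝓡 7) ∞ M]

lemma mvfderiv_congr {f f' : M → ℝ} {p : M} (hf : f =ᶠ[nhds p] f') (w : TangentSpace (𝓡 7) p) :
    mvfderiv (𝓡 7) f p w = mvfderiv (𝓡 7) f' p w := by
  have h := congrArg (fun L : E7 →L[ℝ] ℝ => L w) (hf.mfderiv_eq (I := 𝓡 7) (I' := 𝓘(ℝ)))
  exact h

lemma DFun.congr {f f' : M → ℝ} {p : M} (hf' : DFun f' p) (hf : f =ᶠ[nhds p] f') : DFun f p :=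
  hf'.congr_of_eventuallyEq hf

lemma DFun.mul {f f' : M → ℝ} {p : M} (hf : DFun f p) (hf' : DFun f' p) :
    DFun (fun q => f q * f' q) p := MDifferentiableAt.mul hf hf'

lemma DFun.add {f f' : M → ℝ} {p : M} (hf : DFun f p) (hf' : DFun f' p) :
    DFun (fun q => f q + f' q) p := MDifferentiableAt.add hf hf'

lemma DFun.sub {f f' : M → ℝ} {p : M} (hf : DFun f p) (hf' : DFun f' p) :
    DFun (fun q => f q - f' q) p := MDifferentiableAt.sub hf hf'

lemma dFun_sum {ι : Type*} [Fintype ι] {f : ι → M → ℝ} {p : M} (hf : ∀ i, DFun (f i) p) :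
    DFun (fun q => ∑ i, f i q) p := by
  classical
  have : ∀ s : Finset ι, DFun (fun q => ∑ i ∈ s, f i q) p := by
    intro s
    induction s using Finset.induction_on with
    | empty => simpa using (mdifferentiableAt_const : DFun (fun _ => (0 : ℝ)) p)
    | insert a s ha ih =>
      simp only [Finset.sum_insert ha]
      exact (hf a).add ih
  exact this _

lemma mvfderiv_sum {ι : Type*} [Fintype ι] {f : ι → M → ℝ} {p : M} (hf : ∀ i, DFun (f i) p)
    (w : TangentSpace (𝓡 7) p) :
    mvfderiv (𝓡 7) (fun q => ∑ i, f i q) p w = ∑ i, mvfderiv (𝓡 7) (f i) p w := by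
  classical
  have : ∀ s : Finset ι, DFun (fun q => ∑ i ∈ s, f i q) p ∧
      mvfderiv (𝓡 7) (fun q => ∑ i ∈ s, f i q) p w = ∑ i ∈ s, mvfderiv (𝓡 7) (f i) p w := by
    intro s
    induction s using Finset.induction_on with
    | empty => 
      simp only [Finset.sum_empty]
      exact ⟨mdifferentiableAt_const, by rw [mvfderiv_const]; rfl⟩
    | insert a s ha ih =>
      simp only [Finset.sum_insert ha]
      exact ⟨(hf a).add ih.1, by rw [mvfderiv_fun_add (hf a) ih.1, ← ih.2]; rfl⟩
  exact (this _).2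

lemma dmul {f f' : M → ℝ} {p : M} (hf : DFun f p) (hf' : DFun f' p) (w : TangentSpace (𝓡 7) p) :
    mvfderiv (𝓡 7) (fun q => f q * f' q) p w =
      f p * mvfderiv (𝓡 7) f' p w + f' p * mvfderiv (𝓡 7) f p w := by
  rw [mvfderiv_fun_mul hf hf']; rfl

lemma dadd {f f' : M → ℝ} {p : M} (hf : DFun f p) (hf' : DFun f' p) (w : TangentSpace (𝓡 7) p) :
    mvfderiv (𝓡 7) (fun q => f q + f' q) p w =
      mvfderiv (𝓡 7) f p w + mvfderiv (𝓡 7) f' p w := by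
  rw [mvfderiv_fun_add hf hf']; rfl

lemma dsub {f f' : M → ℝ} {p : M} (hf : DFun f p) (hf' : DFun f' p) (w : TangentSpace (𝓡 7) p) :
    mvfderiv (𝓡 7) (fun q => f q - f' q) p w =
      mvfderiv (𝓡 7) f p w - mvfderiv (𝓡 7) f' p w := by
  rw [mvfderiv_fun_sub hf hf']; rfl

lemma dconst_mul {f : M → ℝ} {p : M} (c : ℝ) (hf : DFun f p) (w : TangentSpace (𝓡 7) p) :
    mvfderiv (𝓡 7) (fun q => c * f q) p w = c * mvfderiv (𝓡 7) f p w := by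
  rw [dmul mdifferentiableAt_const hf, mvfderiv_const]; simp

lemma DVec.congr {U U' : ∀ q : M, TangentSpace (𝓡 7) q} {p : M} (h : DVec U' p)
    (hU : ∀ᶠ q in nhds p, U q = U' q) : DVec U p := by
  refine MDifferentiableAt.congr_of_eventuallyEq h ?_
  filter_upwards [hU] with q hq
  rw [hq]

lemma DVec.smul {f : M → ℝ} {U : ∀ q : M, TangentSpace (𝓡 7) q} {p : M} (hf : DFun f p)
    (hU : DVec U p) : DVec (fun q => f q • U q) p :=
  MDifferentiableAt.smul_section (I := 𝓡 7) (F := E7) hf hU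

lemma DVec.add {U U' : ∀ q : M, TangentSpace (𝓡 7) q} {p : M}
    (hU : DVec U p) (hU' : DVec U' p) : DVec (fun q => U q + U' q) p :=
  mdifferentiableAt_add_section (I := 𝓡 7) (F := E7) hU hU'

lemma DVec.sum {ι : Type*} [Fintype ι] {U : ι → ∀ q : M, TangentSpace (𝓡 7) q} {p : M}
    (hU : ∀ i, DVec (U i) p) : DVec (fun q => ∑ i, U i q) p :=
  MDifferentiableAt.sum_section (I := 𝓡 7) (F := E7) fun i _ => hU i

section Leibniz

variable (F : ∀ q : M, TangentSpace (𝓡 7) q →ₗ[ℝ] ℝ) {p : M}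

lemma mvfderiv_coordField_add {a b : TangentSpace (𝓡 7) p}
    (ha : DFun (fun q => F q (coordField a q)) p) (hb : DFun (fun q => F q (coordField b q)) p)
    (w : TangentSpace (𝓡 7) p) :
    mvfderiv (𝓡 7) (fun q => F q (coordField (a + b) q)) p w =
      mvfderiv (𝓡 7) (fun q => F q (coordField a q)) p w +
        mvfderiv (𝓡 7) (fun q => F q (coordField b q)) p w := by
  rw [← dadd ha hb]
  refine mvfderiv_congr ?_ w
  filter_upwards [eventually_mem_baseSet p] with q hq
  rw [coordField_add hq, map_add]

lemma mvfderiv_coordField_smul (r : ℝ) {a : TangentSpace (𝓡 7) p}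
    (ha : DFun (fun q => F q (coordField a q)) p) (w : TangentSpace (𝓡 7) p) :
    mvfderiv (𝓡 7) (fun q => F q (coordField (r • a) q)) p w =
      r * mvfderiv (𝓡 7) (fun q => F q (coordField a q)) p w := by
  rw [← dconst_mul r ha]
  refine mvfderiv_congr ?_ w
  filter_upwards [eventually_mem_baseSet p] with q hq
  rw [coordField_smul hq, map_smul, smul_eq_mul]

lemma mvfderiv_coordField_sum (c : Fin 7 → ℝ) {e : Fin 7 → TangentSpace (𝓡 7) p}
    (ha : ∀ m, DFun (fun q => F q (coordField (e m) q)) p) (w : TangentSpace (𝓡 7) p) :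
    mvfderiv (𝓡 7) (fun q => F q (coordField (∑ m, c m • e m) q)) p w =
      ∑ m, c m * mvfderiv (𝓡 7) (fun q => F q (coordField (e m) q)) p w := by
  have hd : ∀ m, DFun (fun q => c m * F q (coordField (e m) q)) p := fun m =>
    MDifferentiableAt.mul mdifferentiableAt_const (ha m)
  simp only [← dconst_mul _ (ha _)]
  rw [← mvfderiv_sum hd]
  refine mvfderiv_congr ?_ w
  filter_upwards [eventually_mem_baseSet p] with q hq
  rw [coordField_sum hq, map_sum]
  simp

variable (g : Metric7 M) {e : Fin 7 → TangentSpace (𝓡 7) p}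
  (he : ∀ i j, g.inner p (e i) (e j) = if i = j then 1 else 0)
include he

/-- The Leibniz rule in one slot. -/
lemma leibniz_slot (hF : ∀ v : TangentSpace (𝓡 7) p, DFun (fun q => F q (coordField v q)) p)
    {U : ∀ q : M, TangentSpace (𝓡 7) q} (hU : DVec U p) :
    DFun (fun q => F q (U q)) p ∧ ∀ w, mvfderiv (𝓡 7) (fun q => F q (U q)) p w =
      mvfderiv (𝓡 7) (fun q => F q (coordField (U p) q)) p w + F p (nablaVec g e U w)
        - F p (christoffel g e w (U p)) := by
  obtain ⟨u, hu, hUu, hn⟩ := hU.exists_comp g he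
  have h0 : U p = ∑ m, u m p • e m := by
    rw [hUu.self_of_nhds]; simp only [coordField_self]
  have hev : (fun q => F q (U q)) =ᶠ[nhds p] fun q => ∑ m, u m q * F q (coordField (e m) q) := by
    filter_upwards [hUu] with q hq
    rw [hq, map_sum]; simp
  have hd : ∀ m, DFun (fun q => u m q * F q (coordField (e m) q)) p := fun m =>
    (hu m).mul (hF _)
  refine ⟨(dFun_sum hd).congr hev, fun w => ?_⟩
  rw [mvfderiv_congr hev, mvfderiv_sum hd, hn, h0, mvfderiv_coordField_sum F _ fun m => hF _]
  simp only [dmul (hu _) (hF _), coordField_self, map_add, map_sum, map_smul, smul_eq_mul,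
    Finset.sum_add_distrib, mul_comm (F p (e _))]
  ring

end Leibniz

section Metric

variable (g : Metric7 M) {p : M}

lemma dFun_inner {U V : ∀ q : M, TangentSpace (𝓡 7) q} (hU : DVec U p) (hV : DVec V p) :
    DFun (fun q => g.inner q (U q) (V q)) p := by
  have h1 : MDifferentiableAt (𝓡 7) _ _ p := (g.contMDiff p).mdifferentiableAt (by simp)
  have := MDifferentiableAt.clm_bundle_apply₂ (F₁ := E7) (F₂ := E7) (F₃ := ℝ) h1 hU hV
  rw [mdifferentiableAt_totalSpace] at this
  exact this.2

lemma dFun_inner_left (v a : TangentSpace (𝓡 7) p) :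
    DFun (fun q => (g.inner q (coordField v q)).toLinearMap (coordField a q)) p :=
  dFun_inner g (dVec_coordField v) (dVec_coordField a)

variable {e : Fin 7 → TangentSpace (𝓡 7) p}
  (he : ∀ i j, g.inner p (e i) (e j) = if i = j then 1 else 0)
include he

/-- The formula for the Christoffel symbols holds against every z, since both sides are linear in z
and agree on the frame. -/
lemma inner_christoffel (w v z : TangentSpace (𝓡 7) p) :
    g.inner p (christoffel g e w v) z = (1 / 2 : ℝ) *
      (mvfderiv (𝓡 7) (fun q => g.inner q (coordField v q) (coordField z q)) p w
        + mvfderiv (𝓡 7) (fun q => g.inner q (coordField w q) (coordField z q)) p v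
        - mvfderiv (𝓡 7) (fun q => g.inner q (coordField w q) (coordField v q)) p z) := by
  have h1 : ∀ v w : TangentSpace (𝓡 7) p,
      mvfderiv (𝓡 7) (fun q => g.inner q (coordField v q) (coordField z q)) p w =
      ∑ m, g.inner p z (e m) *
        mvfderiv (𝓡 7) (fun q => g.inner q (coordField v q) (coordField (e m) q)) p w := by
    intro v w
    conv_lhs => rw [← frame_expand g he z]
    exact mvfderiv_coordField_sum (fun q => (g.inner q (coordField v q)).toLinearMap) _
      (fun m => dFun_inner_left g v (e m)) w
  have h2 : mvfderiv (𝓡 7) (fun q => g.inner q (coordField w q) (coordField v q)) p z =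
      ∑ m, g.inner p z (e m) *
        mvfderiv (𝓡 7) (fun q => g.inner q (coordField w q) (coordField v q)) p (e m) := by
    conv_lhs => rw [← frame_expand g he z]
    rw [map_sum]
    simp
  rw [h1, h1, h2, ← Finset.sum_add_distrib, ← Finset.sum_sub_distrib, Finset.mul_sum,
    christoffel, map_sum, sum_apply]
  refine Finset.sum_congr rfl fun m _ => ?_
  rw [map_smul, smul_apply, g.symm p (e m) z, smul_eq_mul]
  ring

lemma inner_ext {u v : TangentSpace (𝓡 7) p} (h : ∀ z, g.inner p u z = g.inner p v z) : u = v := by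
  rw [← frame_expand g he u, ← frame_expand g he v]
  simp only [h]

lemma mvfderiv_inner_coordField (w a b : TangentSpace (𝓡 7) p) :
    mvfderiv (𝓡 7) (fun q => g.inner q (coordField a q) (coordField b q)) p w =
      g.inner p (christoffel g e w a) b + g.inner p a (christoffel g e w b) := by
  rw [g.symm p a, inner_christoffel g he, inner_christoffel g he]
  have hs : ∀ x y : TangentSpace (𝓡 7) p,
      (fun q => g.inner q (coordField x q) (coordField y q)) =
      fun q => g.inner q (coordField y q) (coordField x q) := fun x y => by
    funext q; exact g.symm q _ _
  rw [hs b a]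
  ring

/-- The Levi-Civita connection is compatible with the metric. -/
lemma mvfderiv_inner {U V : ∀ q : M, TangentSpace (𝓡 7) q} (hU : DVec U p) (hV : DVec V p)
    (w : TangentSpace (𝓡 7) p) :
    mvfderiv (𝓡 7) (fun q => g.inner q (U q) (V q)) p w =
      g.inner p (nablaVec g e U w) (V p) + g.inner p (U p) (nablaVec g e V w) := by
  have h1 := (leibniz_slot (fun q => (g.inner q (U q)).toLinearMap) g he
    (fun v => dFun_inner g hU (dVec_coordField v)) hV).2 w
  have h2 := (leibniz_slot (fun q => (g.inner q (coordField (V p) q)).toLinearMap) g he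
    (fun v => dFun_inner g (dVec_coordField _) (dVec_coordField v)) hU).2 w
  have h3 := mvfderiv_inner_coordField g he w (V p) (U p)
  simp only [ContinuousLinearMap.coe_coe, coordField_self] at h1 h2
  have hs : (fun q => g.inner q (U q) (coordField (V p) q)) =
      fun q => g.inner q (coordField (V p) q) (U q) := by
    funext q; exact g.symm q _ _
  rw [hs, h2, h3] at h1
  rw [h1, g.symm p (nablaVec g e U w), g.symm p (U p) (christoffel g e w (V p))]
  ring

lemma christoffel_add (w w' v : TangentSpace (𝓡 7) p) :
    christoffel g e (w + w') v = christoffel g e w v + christoffel g e w' v := by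
  refine inner_ext g he fun z => ?_
  have h1 := fun z => mvfderiv_coordField_add (fun q => (g.inner q (coordField z q)).toLinearMap)
    (dFun_inner_left g z w) (dFun_inner_left g z w')
  simp only [ContinuousLinearMap.coe_coe] at h1
  have hs : ∀ x y : TangentSpace (𝓡 7) p,
      (fun q => g.inner q (coordField x q) (coordField y q)) =
      fun q => g.inner q (coordField y q) (coordField x q) := fun x y => by
    funext q; exact g.symm q _ _
  rw [map_add, add_apply, inner_christoffel g he, inner_christoffel g he,
    inner_christoffel g he, hs (w + w'), hs (w + w'), h1, h1, map_add, hs w z, hs w v, hs w' z,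
    hs w' v]
  ring

lemma christoffel_smul (r : ℝ) (w v : TangentSpace (𝓡 7) p) :
    christoffel g e (r • w) v = r • christoffel g e w v := by
  refine inner_ext g he fun z => ?_
  have h1 := fun z => mvfderiv_coordField_smul (fun q => (g.inner q (coordField z q)).toLinearMap)
    r (dFun_inner_left g z w)
  simp only [ContinuousLinearMap.coe_coe] at h1
  have hs : ∀ x y : TangentSpace (𝓡 7) p,
      (fun q => g.inner q (coordField x q) (coordField y q)) =
      fun q => g.inner q (coordField y q) (coordField x q) := fun x y => by
    funext q; exact g.symm q _ _
  rw [map_smul, smul_apply, inner_christoffel g he,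
    inner_christoffel g he, hs (r • w), hs (r • w), h1, h1, map_smul, hs w z, hs w v]
  simp only [smul_eq_mul]
  ring

lemma nablaVec_add {U : ∀ q : M, TangentSpace (𝓡 7) q} (hU : DVec U p)
    (w w' : TangentSpace (𝓡 7) p) :
    nablaVec g e U (w + w') = nablaVec g e U w + nablaVec g e U w' := by
  obtain ⟨u, -, -, hn⟩ := hU.exists_comp g he
  simp only [hn, map_add, add_smul, Finset.sum_add_distrib, christoffel_add g he]
  abel

lemma nablaVec_smul {U : ∀ q : M, TangentSpace (𝓡 7) q} (hU : DVec U p) (r : ℝ)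
    (w : TangentSpace (𝓡 7) p) : nablaVec g e U (r • w) = r • nablaVec g e U w := by
  obtain ⟨u, -, -, hn⟩ := hU.exists_comp g he
  simp only [hn, map_smul, christoffel_smul g he, smul_add, Finset.smul_sum, smul_smul, smul_eq_mul]

end Metric

/-! ### Fields of trilinear forms -/

/-- A differentiable field of trilinear forms. -/
structure DTri (η : ∀ q : M, TangentSpace (𝓡 7) q → TangentSpace (𝓡 7) q →
    TangentSpace (𝓡 7) q → ℝ) (p : M) : Prop where
  add₁ : ∀ q a a' b c, η q (a + a') b c = η q a b c + η q a' b c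
  smul₁ : ∀ q (r : ℝ) a b c, η q (r • a) b c = r * η q a b c
  add₂ : ∀ q a b b' c, η q a (b + b') c = η q a b c + η q a b' c
  smul₂ : ∀ q (r : ℝ) a b c, η q a (r • b) c = r * η q a b c
  add₃ : ∀ q a b c c', η q a b (c + c') = η q a b c + η q a b c'
  smul₃ : ∀ q (r : ℝ) a b c, η q a b (r • c) = r * η q a b c
  diff : ∀ a b c : TangentSpace (𝓡 7) p,
    DFun (fun q => η q (coordField a q) (coordField b q) (coordField c q)) p

namespace DTri

variable {η : ∀ q : M, TangentSpace (𝓡 7) q → TangentSpace (𝓡 7) q →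
    TangentSpace (𝓡 7) q → ℝ} {p : M} (h : DTri η p)
include h

/-- The linear form in the first slot. -/
def slot₁ (b c : ∀ q : M, TangentSpace (𝓡 7) q) (q : M) : TangentSpace (𝓡 7) q →ₗ[ℝ] ℝ where
  toFun a := η q a (b q) (c q)
  map_add' _ _ := h.add₁ ..
  map_smul' _ _ := h.smul₁ ..

/-- The linear form in the second slot. -/
def slot₂ (a c : ∀ q : M, TangentSpace (𝓡 7) q) (q : M) : TangentSpace (𝓡 7) q →ₗ[ℝ] ℝ where
  toFun b := η q (a q) b (c q)
  map_add' _ _ := h.add₂ ..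
  map_smul' _ _ := h.smul₂ ..

/-- The linear form in the third slot. -/
def slot₃ (a b : ∀ q : M, TangentSpace (𝓡 7) q) (q : M) : TangentSpace (𝓡 7) q →ₗ[ℝ] ℝ where
  toFun c := η q (a q) (b q) c
  map_add' _ _ := h.add₃ ..
  map_smul' _ _ := h.smul₃ ..

variable (g : Metric7 M) {e : Fin 7 → TangentSpace (𝓡 7) p}
  (he : ∀ i j, g.inner p (e i) (e j) = if i = j then 1 else 0)
  {U V W : ∀ q : M, TangentSpace (𝓡 7) q} (hU : DVec U p) (hV : DVec V p) (hW : DVec W p)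
include he hU hV hW

/-- `leibniz_slot` is applied to one argument at a time, with coordinate fields kept in the later
slots. The Christoffel terms of the three steps combine with the derivative on coordinate fields to
form `nabla3`. -/
lemma leibniz : DFun (fun q => η q (U q) (V q) (W q)) p ∧
    ∀ w, mvfderiv (𝓡 7) (fun q => η q (U q) (V q) (W q)) p w =
      nabla3 g e η w (U p) (V p) (W p) + η p (nablaVec g e U w) (V p) (W p) +
        η p (U p) (nablaVec g e V w) (W p) + η p (U p) (V p) (nablaVec g e W w) := by
  have h1 := fun b c : TangentSpace (𝓡 7) p => leibniz_slot
    (h.slot₁ (coordField b) (coordField c)) g he (fun v => h.diff v b c) hU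
  have h2 := fun c : TangentSpace (𝓡 7) p => leibniz_slot
    (h.slot₂ U (coordField c)) g he (fun v => (h1 v c).1) hV
  have h3 := leibniz_slot (h.slot₃ U V) g he (fun v => (h2 v).1) hW
  refine ⟨h3.1, fun w => ?_⟩
  have e1 := (h1 (V p) (W p)).2 w
  have e2 := (h2 (W p)).2 w
  have e3 := h3.2 w
  simp only [slot₁, slot₂, slot₃, LinearMap.coe_mk, AddHom.coe_mk, coordField_self] at e1 e2 e3
  rw [e3, e2, e1, nabla3]
  ring

end DTri

end OctKilling
end

/-! ### The 3-forms which are contractions of ψ -/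

noncomputable section

namespace OctKilling

/-- For each `m`, a triple `(i, j, k)` with `ψ_{mijk} = 1`. -/
def rtri (m : Fin 7) : Fin 7 × Fin 7 × Fin 7 :=
  [(2, 4, 6), (2, 5, 6), (0, 3, 5), (4, 5, 6), (0, 2, 6), (3, 4, 6), (0, 1, 3)].getD m.val (0, 0, 0)

/-- The integer components of the 4-form. -/
def cpsiZ (a b c d : Fin 7) : ℤ :=
  csgn a b * csgn c d * dlt (cidx a b) (cidx c d) - dlt a c * dlt b d + dlt a d * dlt b c

/-- Evaluation on the seven triples reads off the coordinates of t from the 3-form t ⌟ ψ. -/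
lemma cpsiZ_rtri : ∀ m n : Fin 7, cpsiZ n (rtri m).1 (rtri m).2.1 (rtri m).2.2 = dlt n m := by
  decide +kernel

/-- The triple is, up to order, one of the distinguished ones. -/
def IsRtri (i j k : Fin 7) : Prop :=
  ∃ m, rtri m = (i, j, k) ∨ rtri m = (j, i, k) ∨ rtri m = (i, k, j) ∨ rtri m = (j, k, i) ∨
    rtri m = (k, i, j) ∨ rtri m = (k, j, i)

instance (i j k : Fin 7) : Decidable (IsRtri i j k) := by unfold IsRtri; infer_instance

lemma csgn_ne_zero : ∀ i j : Fin 7, i ≠ j → csgn i j ≠ 0 := by decide +kernel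

lemma cidx_cidx : ∀ i j : Fin 7, i ≠ j → cidx j (cidx i j) = i ∧ cidx (cidx i j) i = j := by
  decide +kernel

/-- Every triple is degenerate, or a line (k is the index of i × j), or distinguished up to order,
or, after reordering, tied to a distinguished one by the relation between f(i, j, k) and f(j × k, j,
i × j). -/
lemma linked_rtri : ∀ i j k : Fin 7, i = j ∨ j = k ∨ i = k ∨ k = cidx i j ∨ IsRtri i j k ∨
    IsRtri (cidx j k) j (cidx i j) ∨ IsRtri (cidx i k) i (cidx j i) ∨
    IsRtri (cidx k j) k (cidx i k) := by decide +kernel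

/-- An alternating 3-form on the frame which satisfies the linearization of
`φ(a, b, a × b) = |a|² |b|² - ⟨a, b⟩²` and vanishes on the distinguished triples is zero. -/
lemma frame_form_eq_zero {f : Fin 7 → Fin 7 → Fin 7 → ℝ} (h1 : ∀ i j k, f j i k = -f i j k)
    (h2 : ∀ i j k, f i k j = -f i j k)
    (hr : ∀ i j k, (csgn k j : ℝ) * f i j (cidx k j) + (csgn i j : ℝ) * f k j (cidx i j) = 0)
    (h0 : ∀ m, f (rtri m).1 (rtri m).2.1 (rtri m).2.2 = 0) (i j k : Fin 7) : f i j k = 0 := by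
  have hself : ∀ i k, f i i k = 0 := fun i k => by have := h1 i i k; linarith
  have hself' : ∀ i k, f i k k = 0 := fun i k => by have := h2 i k k; linarith
  have hR : ∀ i j k, IsRtri i j k → f i j k = 0 := by
    rintro i j k ⟨m, hm⟩
    have hm0 := h0 m
    rcases hm with hm | hm | hm | hm | hm | hm <;> rw [hm] at hm0 <;> simp only at hm0
    · exact hm0
    · rw [h1, neg_eq_zero] at hm0; exact hm0
    · rw [h2, neg_eq_zero] at hm0; exact hm0
    · rw [h2, h1, neg_neg] at hm0; exact hm0
    · rw [h1, h2, neg_neg] at hm0; exact hm0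
    · rw [h1, h2, h1, neg_neg, neg_eq_zero] at hm0; exact hm0
  -- The relation with k = i doubles a single term.
  have hline : ∀ i j, i ≠ j → f i j (cidx i j) = 0 := fun i j hij => by
    have h := hr i j i
    have hc : (csgn i j : ℝ) ≠ 0 := by exact_mod_cast csgn_ne_zero i j hij
    have : (csgn i j : ℝ) * f i j (cidx i j) = 0 := by linarith
    exact (mul_eq_zero.1 this).resolve_left hc
  have hlink : ∀ i j k, i ≠ j → j ≠ k → IsRtri (cidx j k) j (cidx i j) → f i j k = 0 :=
    fun i j k hij hjk hk => by
    have h := hr i j (cidx j k)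
    rw [hR _ _ _ hk, (cidx_cidx j k hjk).2] at h
    have hk2 := (cidx_cidx j k hjk).2
    have hne : cidx j k ≠ j := by
      intro hE
      have : ∀ j k : Fin 7, j ≠ k → cidx j k ≠ j := by decide +kernel
      exact this j k hjk hE
    have hc : (csgn (cidx j k) j : ℝ) ≠ 0 := by exact_mod_cast csgn_ne_zero _ j hne
    rw [MulZeroClass.mul_zero, _root_.add_zero] at h
    exact (mul_eq_zero.1 h).resolve_left hc
  rcases eq_or_ne i j with rfl | hij
  · exact hself _ _
  rcases eq_or_ne j k with rfl | hjk
  · exact hself' _ _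
  rcases eq_or_ne i k with rfl | hik
  · have := h2 i i j; rw [hself] at this; linarith
  rcases linked_rtri i j k with h | h | h | h | h | h | h | h
  · exact absurd h hij
  · exact absurd h hjk
  · exact absurd h hik
  · rw [h]; exact hline i j hij
  · exact hR _ _ _ h
  · exact hlink i j k hij hjk h
  · rw [h1, hlink j i k hij.symm hik h, neg_zero]
  · rw [h2, hlink i k j hik hjk.symm h, neg_zero]

section Pointwise

variable {V : Type*} [AddCommGroup V] [Module ℝ V]

namespace IsOct

variable {S : G2Point V} (h : IsOct S)
include h

lemma cpsi_self (a b d : V) : S.cpsi a b b d = 0 := by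
  have := h.cpsi_swap₂ a b b d; linarith

lemma cpsi_self_left (a b d : V) : S.cpsi a a b d = 0 := by
  have := h.cpsi_swap a a b d; linarith

lemma cpsi_self_right (a b d : V) : S.cpsi a b d d = 0 := by
  have := h.cpsi_swap₃ a b d d; linarith

/-- Contractions of ψ satisfy the linearized constraint; `exists_eq_cpsi` is the converse. -/
lemma cpsi_cross (t a b : V) : S.cpsi t a b (S.cross a b) = 0 := by
  have h1 : S.cross b (S.cross a b) = S.ip b b • a - S.ip b a • b := by
    rw [h.cross_anti b a, h.cross_neg, h.cross_cross]; module
  have h2 : S.ph a b a = 0 := by rw [h.ph_cyc a a b, h.ph_self]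
  rw [G2Point.cpsi, h1, h.ip_sub', h.ip_smul', h.ip_smul', h.ip_cross, h.ip_cross, h.ip_cross',
    h.ip_cross', h.ph_self', h2, h.ph_cyc t a b, h.ip_comm b a]
  ring

/-- The real part of `sum_psi_mul_mul_mul` at A = δ_b; the metric terms vanish because ψ is
alternating. It explains the normalization 1/48 = 1/(2 · 24) of the torsion. -/
lemma sum_cpsi_cpsi (a b : V) : ∑ i, ∑ j, ∑ k, S.cpsi a (S.e i) (S.e j) (S.e k) *
    S.cpsi b (S.e i) (S.e j) (S.e k) = 24 * S.ip a b := by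
  have h1 := congrArg Prod.fst (h.sum_psi_mul_mul_mul a (delta b))
  simp only [G2Point.cl3, Prod.fst_sum, Prod.smul_fst, smul_eq_mul] at h1
  refine Eq.trans ?_ (h1.trans (by simp [delta]))
  refine Finset.sum_congr rfl fun i _ => Finset.sum_congr rfl fun j _ =>
    Finset.sum_congr rfl fun k _ => ?_
  have e1 : (S.mul (delta (S.e i)) (S.mul (delta (S.e j)) (S.mul (delta (S.e k)) (delta b)))).1 =
      S.ip (S.e i) (S.e j) * S.ip (S.e k) b - S.ip (S.cross (S.e i) (S.e j)) (S.cross (S.e k) b) := by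
    rw [h.mul_delta_delta]
    simp only [G2Point.mul, delta, h.ip_add', h.ip_smul', h.ip_cross', h.ip_cross, h.cross_smul]
    rw [h.ph_cyc (S.e i) (S.e j), ← h.ip_cross (S.e i), h.ip_cross' (S.e k)]
    ring
  rw [e1, h.ip_cross_cross]
  have hij : S.cpsi a (S.e i) (S.e j) (S.e k) * S.ip (S.e i) (S.e j) = 0 := by
    rw [h.orth]; split_ifs with hE
    · rw [hE, h.cpsi_self, MulZeroClass.zero_mul]
    · ring
  have hjk : S.cpsi a (S.e i) (S.e j) (S.e k) * S.ip (S.e j) (S.e k) = 0 := by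
    rw [h.orth]; split_ifs with hE
    · rw [hE, h.cpsi_self_right, MulZeroClass.zero_mul]
    · ring
  have hik : S.cpsi a (S.e i) (S.e j) (S.e k) * S.ip (S.e i) (S.e k) = 0 := by
    rw [h.orth]; split_ifs with hE
    · rw [hE, h.cpsi_swap₃, h.cpsi_self]; ring
    · ring
  rw [h.cpsi_cyc b]
  linear_combination -S.ip (S.e k) b * hij + S.ip (S.e j) b * hik - S.ip (S.e i) b * hjk

/-- The linearization of `φ(a, b, a × b) = |a|² |b|² - ⟨a, b⟩²` is solved by contractions
of the 4-form. -/
lemma exists_eq_cpsi (hph : ∀ i j k, S.ph (S.e i) (S.e j) (S.e k) = phi0 i j k)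
    {η : V → V → V → ℝ} (hadd : ∀ a a' b c, η (a + a') b c = η a b c + η a' b c)
    (hsmul : ∀ (r : ℝ) a b c, η (r • a) b c = r * η a b c)
    (h1 : ∀ a b c, η b a c = -η a b c) (h2 : ∀ a b c, η a c b = -η a b c)
    (hc : ∀ a b, η a b (S.cross a b) = 0) : ∃ t, ∀ a b c, η a b c = 2 * S.cpsi t a b c := by
  have ce : ∀ i j, S.cross (S.e i) (S.e j) = (csgn i j : ℝ) • S.e (cidx i j) := fun i j => by
    simp only [G2Point.cross, G2Point.sharp, hph, phi0_eq]
    push_cast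
    simp only [dlt_cast]
    simp
  have hcp : ∀ i j k l, S.cpsi (S.e i) (S.e j) (S.e k) (S.e l) = ((cpsiZ i j k l : ℤ) : ℝ) := by
    intro i j k l
    rw [G2Point.cpsi, ce, ce, h.ip_smul, h.ip_smul', h.orth, h.orth, h.orth, h.orth, h.orth, cpsiZ]
    push_cast
    simp only [dlt_cast]
    ring
  -- By `cpsiZ_rtri`, half the values of η on the distinguished triples are the only possible
  -- coordinates of t.
  let t : V := ∑ m, ((1 / 2) * η (S.e (rtri m).1) (S.e (rtri m).2.1) (S.e (rtri m).2.2)) • S.e m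
  have ht : ∀ a b c, S.cpsi t a b c = ∑ m, ((1 / 2) *
      η (S.e (rtri m).1) (S.e (rtri m).2.1) (S.e (rtri m).2.2)) * S.cpsi (S.e m) a b c := by
    intro a b c
    let L : V →ₗ[ℝ] ℝ :=
      { toFun := fun t => S.cpsi t a b c
        map_add' := fun x y => h.cpsi_add x y a b c
        map_smul' := fun r x => h.cpsi_smul r x a b c }
    change L t = _
    simp only [t, map_sum, map_smul, smul_eq_mul]
    rfl
  let F : V → V → V → ℝ := fun a b c => η a b c - 2 * S.cpsi t a b c
  have F1 : ∀ a b c, F b a c = -F a b c := fun a b c => by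
    simp only [F, h1 a b c, h.cpsi_swap₂ t a b c]; ring
  have F2 : ∀ a b c, F a c b = -F a b c := fun a b c => by
    simp only [F, h2 a b c, h.cpsi_swap₃ t a b c]; ring
  have Fadd : ∀ a a' b c, F (a + a') b c = F a b c + F a' b c := fun a a' b c => by
    simp only [F, hadd]
    have := h.cpsi_add₂ t a a' b c
    linear_combination -2 * this
  have Fsmul : ∀ (r : ℝ) a b c, F (r • a) b c = r * F a b c := fun r a b c => by
    simp only [F, hsmul, h.cpsi_smul₂]; ring
  have Fc : ∀ a b, F a b (S.cross a b) = 0 := fun a b => by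
    simp only [F, hc, h.cpsi_cross]; ring
  have Fadd₃ : ∀ a b c c', F a b (c + c') = F a b c + F a b c' := fun a b c c' => by
    rw [F2 a (c + c') b, F1 (c + c') a b, Fadd, F2 a c b, F2 a c' b, F1 c a b, F1 c' a b]; ring
  have Fsmul₃ : ∀ (r : ℝ) a b c, F a b (r • c) = r * F a b c := fun r a b c => by
    rw [F2 a (r • c) b, F1 (r • c) a b, Fsmul, F2 a c b, F1 c a b]; ring
  have Fpol : ∀ a a' b, F a b (S.cross a' b) + F a' b (S.cross a b) = 0 := fun a a' b => by
    have := Fc (a + a') b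
    rw [h.add_cross, Fadd, Fadd₃, Fadd₃, Fc, Fc] at this
    linarith
  have hF0 : ∀ i j k, F (S.e i) (S.e j) (S.e k) = 0 := by
    refine frame_form_eq_zero (fun i j k => F1 _ _ _) (fun i j k => F2 _ _ _) (fun i j k => ?_)
      (fun m => ?_)
    · have := Fpol (S.e i) (S.e k) (S.e j)
      rwa [ce, ce, Fsmul₃, Fsmul₃] at this
    · simp only [F, ht, hcp, cpsiZ_rtri, dlt_cast]
      simp
  refine ⟨t, fun a b c => sub_eq_zero.1 ?_⟩
  change F a b c = 0
  refine eq_zero_of_frame h.expand (fun a => F a b c) (fun _ _ => Fadd _ _ _ _)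
    (fun r a => Fsmul r a b c) (fun i => ?_) a
  rw [← neg_neg (F (S.e i) b c), ← F1, neg_eq_zero]
  refine eq_zero_of_frame h.expand (fun b => F b (S.e i) c) (fun _ _ => Fadd _ _ _ _)
    (fun r a => Fsmul r a _ c) (fun j => ?_) b
  refine eq_zero_of_frame h.expand (fun c => F (S.e j) (S.e i) c) (fun _ _ => Fadd₃ _ _ _ _)
    (fun r a => Fsmul₃ r _ _ a) (fun k => hF0 j i k) c

end IsOct
end Pointwise
end OctKilling
end

/-! ### Differentiating vector fields through scalar products -/

noncomputable section

namespace OctKilling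

variable {M : Type*} [TopologicalSpace M] [ChartedSpace E7 M] [IsManifold (𝓡 7) ∞ M]

lemma DFun.comp {f : ℝ → ℝ} {u : M → ℝ} {p : M} (hf : DifferentiableAt ℝ f (u p))
    (hu : DFun u p) : DFun (fun q => f (u q)) p :=
  hf.comp_mdifferentiableAt hu

lemma DFun.inv {u : M → ℝ} {p : M} (hu : DFun u p) (h0 : u p ≠ 0) : DFun (fun q => (u q)⁻¹) p :=
  DFun.comp (differentiableAt_inv h0) hu

lemma dcomp {f : ℝ → ℝ} {f' : ℝ} {u : M → ℝ} {p : M} (hf : HasDerivAt f f' (u p))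
    (hu : DFun u p) (w : TangentSpace (𝓡 7) p) :
    mvfderiv (𝓡 7) (fun q => f (u q)) p w = f' * mvfderiv (𝓡 7) u p w := by
  have hf1 : MDifferentiableAt 𝓘(ℝ) 𝓘(ℝ) f (u p) := hf.differentiableAt.mdifferentiableAt
  have h := mfderiv_comp_apply (I := 𝓡 7) (I' := 𝓘(ℝ)) (I'' := 𝓘(ℝ)) p hf1 hu w
  change mfderiv (𝓡 7) 𝓘(ℝ) (f ∘ u) p w = _
  refine h.trans ?_
  rw [hf.hasFDerivAt.hasMFDerivAt.mfderiv]
  change mvfderiv (𝓡 7) u p w • f' = _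
  rw [smul_eq_mul, mul_comm]

lemma dFun_prod {ι : Type*} [Fintype ι] {f : ι → M → ℝ} {p : M} (hf : ∀ i, DFun (f i) p) :
    DFun (fun q => ∏ i, f i q) p := by
  classical
  have : ∀ s : Finset ι, DFun (fun q => ∏ i ∈ s, f i q) p := by
    intro s
    induction s using Finset.induction_on with
    | empty => simpa using (mdifferentiableAt_const : DFun (fun _ => (1 : ℝ)) p)
    | insert a s ha ih =>
      simp only [Finset.prod_insert ha]
      exact (hf a).mul ih
  exact this _

lemma dFun_det {A : M → Matrix (Fin 7) (Fin 7) ℝ} {p : M} (hA : ∀ i j, DFun (fun q => A q i j) p) :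
    DFun (fun q => (A q).det) p := by
  simp only [Matrix.det_apply', ]
  exact dFun_sum fun σ => MDifferentiableAt.mul mdifferentiableAt_const (dFun_prod fun i => hA _ _)

lemma dFun_adjugate {A : M → Matrix (Fin 7) (Fin 7) ℝ} {p : M}
    (hA : ∀ i j, DFun (fun q => A q i j) p) (i j : Fin 7) :
    DFun (fun q => (A q).adjugate i j) p := by
  simp only [Matrix.adjugate_apply]
  refine dFun_det fun r s => ?_
  by_cases hr : r = j
  · simp only [hr, Matrix.updateRow_self]
    exact mdifferentiableAt_const
  · simp only [Matrix.updateRow_ne hr]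
    exact hA r s

section Metric

variable (g : Metric7 M) {p : M} {e : Fin 7 → TangentSpace (𝓡 7) p}
  (he : ∀ i j, g.inner p (e i) (e j) = if i = j then 1 else 0)
include he

/-- A vector field is differentiable if its scalar products with the coordinate fields are. -/
lemma dVec_of_inner {C : ∀ q : M, TangentSpace (𝓡 7) q}
    (hC : ∀ n, DFun (fun q => g.inner q (C q) (coordField (e n) q)) p) : DVec C p := by
  let A : M → Matrix (Fin 7) (Fin 7) ℝ := fun q =>
    Matrix.of fun m n => g.inner q (coordField (e m) q) (coordField (e n) q)
  have hA : ∀ i j, DFun (fun q => A q i j) p := fun i j =>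
    dFun_inner g (dVec_coordField _) (dVec_coordField _)
  have hAp : A p = 1 := by
    ext i j
    simp [A, coordField_self, he, Matrix.one_apply]
  have hdet : DFun (fun q => (A q).det) p := dFun_det hA
  have hdp : (A p).det ≠ 0 := by rw [hAp, Matrix.det_one]; exact one_ne_zero
  have hev : ∀ᶠ q in nhds p, (A q).det ≠ 0 := hdet.continuousAt.eventually_ne hdp
  -- Cramer's rule for the Gram matrix of the coordinate fields, which is the identity at p and
  -- hence invertible nearby, gives the components as differentiable functions.
  let k : Fin 7 → M → ℝ := fun m q => (A q).det⁻¹ *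
    ∑ n, (A q).adjugate m n * g.inner q (C q) (coordField (e n) q)
  have hk : ∀ m, DFun (k m) p := fun m =>
    (hdet.inv hdp).mul (dFun_sum fun n => (dFun_adjugate hA m n).mul (hC n))
  refine (DVec.sum fun m => (dVec_coordField (e m)).smul (hk m)).congr ?_
  filter_upwards [hev, eventually_mem_baseSet p] with q hq hq'
  let c : Fin 7 → ℝ := fun m => g.inner p (chartComp C p q) (e m)
  have hc : C q = ∑ m, c m • coordField (e m) q := by
    rw [← coordField_sum hq', frame_expand g he, coordField_chartComp C hq']
  have hCn : ∀ n, g.inner q (C q) (coordField (e n) q) = (A q).mulVec c n := by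
    intro n
    rw [hc, map_sum, sum_apply, Matrix.mulVec, dotProduct]
    refine Finset.sum_congr rfl fun m _ => ?_
    rw [map_smul, smul_apply, g.symm, smul_eq_mul, mul_comm]
    rfl
  have hkc : ∀ m, k m q = c m := by
    intro m
    have h1 : ∑ n, (A q).adjugate m n * g.inner q (C q) (coordField (e n) q) =
        ((A q).adjugate.mulVec ((A q).mulVec c)) m := by
      simp only [hCn]; rfl
    simp only [k]
    rw [h1, Matrix.mulVec_mulVec, Matrix.adjugate_mul, Matrix.smul_mulVec, Matrix.one_mulVec,
      Pi.smul_apply, smul_eq_mul, inv_mul_cancel_left₀ hq]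
  simp only [hkc]
  exact hc

/-- Metric compatibility determines ∇C from the derivatives of its scalar products with coordinate
fields; sums, multiples and cross products are differentiated in this way. -/
lemma nablaVec_eq_of_inner {C : ∀ q : M, TangentSpace (𝓡 7) q} (hC : DVec C p)
    (w x : TangentSpace (𝓡 7) p)
    (hx : ∀ z : TangentSpace (𝓡 7) p,
      mvfderiv (𝓡 7) (fun q => g.inner q (C q) (coordField z q)) p w =
        g.inner p x z + g.inner p (C p) (nablaVec g e (coordField z) w)) :
    nablaVec g e C w = x := by
  refine inner_ext g he fun z => ?_
  have h1 := mvfderiv_inner g he hC (dVec_coordField z) w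
  rw [hx, coordField_self] at h1
  linarith

lemma nablaVec_vadd {U V : ∀ q : M, TangentSpace (𝓡 7) q} (hU : DVec U p) (hV : DVec V p)
    (w : TangentSpace (𝓡 7) p) :
    nablaVec g e (fun q => U q + V q) w = nablaVec g e U w + nablaVec g e V w := by
  refine nablaVec_eq_of_inner g he (hU.add hV) w _ fun z => ?_
  have h1 := mvfderiv_inner g he hU (dVec_coordField z) w
  have h2 := mvfderiv_inner g he hV (dVec_coordField z) w
  simp only [map_add, add_apply]
  rw [dadd (dFun_inner g hU (dVec_coordField z)) (dFun_inner g hV (dVec_coordField z)), h1, h2,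
    coordField_self]
  ring

lemma nablaVec_fsmul {f : M → ℝ} {U : ∀ q : M, TangentSpace (𝓡 7) q} (hf : DFun f p)
    (hU : DVec U p) (w : TangentSpace (𝓡 7) p) :
    nablaVec g e (fun q => f q • U q) w =
      mvfderiv (𝓡 7) f p w • U p + f p • nablaVec g e U w := by
  refine nablaVec_eq_of_inner g he (hU.smul hf) w _ fun z => ?_
  have h1 := mvfderiv_inner g he hU (dVec_coordField z) w
  simp only [map_add, add_apply, map_smul, smul_apply, smul_eq_mul]
  rw [dmul hf (dFun_inner g hU (dVec_coordField z)), h1, coordField_self]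
  ring

end Metric

namespace DTri

variable {η : ∀ q : M, TangentSpace (𝓡 7) q → TangentSpace (𝓡 7) q →
    TangentSpace (𝓡 7) q → ℝ} {p : M} (h : DTri η p) (g : Metric7 M)
  {e : Fin 7 → TangentSpace (𝓡 7) p}
  (he : ∀ i j, g.inner p (e i) (e j) = if i = j then 1 else 0)
include h he

lemma christoffel_comm (u v : TangentSpace (𝓡 7) p) :
    christoffel g e u v = christoffel g e v u := by
  refine inner_ext g he fun z => ?_
  rw [inner_christoffel g he, inner_christoffel g he]
  have hs : (fun q => g.inner q (coordField u q) (coordField v q)) =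
      fun q => g.inner q (coordField v q) (coordField u q) := by
    funext q; exact g.symm q _ _
  rw [hs]; ring

lemma nabla3_add (u a a' b c : TangentSpace (𝓡 7) p) : nabla3 g e η u (a + a') b c =
    nabla3 g e η u a b c + nabla3 g e η u a' b c := by
  have h1 := mvfderiv_coordField_add (h.slot₁ (coordField b) (coordField c))
    (h.diff a b c) (h.diff a' b c) u
  simp only [slot₁, LinearMap.coe_mk, AddHom.coe_mk] at h1
  simp only [nabla3]
  rw [h1, h.christoffel_comm g he u (a + a'), christoffel_add g he, h.christoffel_comm g he a,
    h.christoffel_comm g he a', h.add₁, h.add₁, h.add₁]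
  ring

lemma nabla3_smul (u : TangentSpace (𝓡 7) p) (r : ℝ) (a b c : TangentSpace (𝓡 7) p) :
    nabla3 g e η u (r • a) b c = r * nabla3 g e η u a b c := by
  have h1 := mvfderiv_coordField_smul (h.slot₁ (coordField b) (coordField c)) r
    (h.diff a b c) u
  simp only [slot₁, LinearMap.coe_mk, AddHom.coe_mk] at h1
  simp only [nabla3]
  rw [h1, h.christoffel_comm g he u (r • a), christoffel_smul g he, h.christoffel_comm g he a,
    h.smul₁, h.smul₁, h.smul₁]
  ring

lemma nabla3_dir_add (u u' a b c : TangentSpace (𝓡 7) p) : nabla3 g e η (u + u') a b c =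
    nabla3 g e η u a b c + nabla3 g e η u' a b c := by
  simp only [nabla3, map_add, christoffel_add g he, h.add₁, h.add₂, h.add₃]
  ring

lemma nabla3_dir_smul (r : ℝ) (u a b c : TangentSpace (𝓡 7) p) : nabla3 g e η (r • u) a b c =
    r * nabla3 g e η u a b c := by
  simp only [nabla3, map_smul, christoffel_smul g he, h.smul₁, h.smul₂, h.smul₃, smul_eq_mul]
  ring

lemma nabla3_swap (hη : ∀ q a b c, η q b a c = -η q a b c) (u a b c : TangentSpace (𝓡 7) p) :
    nabla3 g e η u b a c = -nabla3 g e η u a b c := by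
  have : (fun q => η q (coordField b q) (coordField a q) (coordField c q)) =
      fun q => -η q (coordField a q) (coordField b q) (coordField c q) := by
    funext q; exact hη ..
  simp only [nabla3]
  rw [this, mvfderiv_fun_neg, neg_apply, hη p (christoffel g e u a), hη p a, hη p a b]
  ring

lemma nabla3_swap' (hη : ∀ q a b c, η q a c b = -η q a b c) (u a b c : TangentSpace (𝓡 7) p) :
    nabla3 g e η u a c b = -nabla3 g e η u a b c := by
  have : (fun q => η q (coordField a q) (coordField c q) (coordField b q)) =
      fun q => -η q (coordField a q) (coordField b q) (coordField c q) := by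
    funext q; exact hη ..
  simp only [nabla3]
  rw [this, mvfderiv_fun_neg, neg_apply, hη p (christoffel g e u a) b c,
    hη p a b (christoffel g e u c), hη p a (christoffel g e u b) c]
  ring

end DTri

end OctKilling
end

/-! ### The covariant derivative of φ and its torsion -/

noncomputable section

namespace OctKilling

section Pointwise

variable {V : Type*} [AddCommGroup V] [Module ℝ V] {S : G2Point V}

/-- Real parts drop out of the associator, so only the imaginary parts of A and B enter it. -/
lemma IsOct.mul_mul_delta (h : IsOct S) (A B : Oct V) (t : V) :
    S.mul A (S.mul B (delta t)) = S.mul (S.mul A B) (delta t) +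
      S.assoc (delta A.2) (delta B.2) (delta t) := by
  have e1 : ∀ a b (C : Oct V), S.assoc (a + b) C (delta t) = S.assoc a C (delta t) +
      S.assoc b C (delta t) := fun a b C => by
    simp only [G2Point.assoc, h.add_mul]; abel
  have e2 : ∀ a b (C : Oct V), S.assoc C (a + b) (delta t) = S.assoc C a (delta t) +
      S.assoc C b (delta t) := fun a b C => by
    simp only [G2Point.assoc, h.add_mul, h.mul_add]; abel
  have e3 : ∀ (r : ℝ) (C : Oct V), S.assoc (r • (1, 0)) C (delta t) = 0 := fun r C => by
    simp only [G2Point.assoc, h.smul_mul, h.one_mul, sub_self]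
  have e4 : ∀ (r : ℝ) (C : Oct V), S.assoc C (r • (1, 0)) (delta t) = 0 := fun r C => by
    simp only [G2Point.assoc, h.mul_smul, h.smul_mul, h.one_mul, h.mul_one, sub_self]
  have : S.assoc A B (delta t) = S.assoc (delta A.2) (delta B.2) (delta t) := by
    conv_lhs => rw [oct_eq A, oct_eq B]
    rw [e1, e3, e2, e4, _root_.zero_add, _root_.zero_add]
  rw [← this, G2Point.assoc]; abel

lemma IsOct.assoc_fst (h : IsOct S) (a b c : V) :
    (S.assoc (delta a) (delta b) (delta c)).1 = 0 := by
  simp only [G2Point.assoc, h.mul_delta_delta, Prod.fst_sub]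
  simp only [G2Point.mul, delta, h.ip_smul, h.ip_smul', h.ip_add, h.ip_add', h.ip_cross, h.ip_cross']
  rw [h.ph_cyc a b c]; ring

lemma IsOct.oip_mul_delta_skew (h : IsOct S) (A B : Oct V) (t : V) :
    S.oip (S.mul A (delta t)) B + S.oip A (S.mul B (delta t)) = 0 := by
  have : oconj (delta t) = -delta t := by simp [oconj, delta]
  rw [h.oip_mul_right, this, h.mul_neg, h.oip_neg']; ring

end Pointwise

variable {M : Type*} [TopologicalSpace M] [ChartedSpace E7 M] [IsManifold (𝓡 7) ∞ M]

section Structure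

variable {g : Metric7 M} {φ : FormField M 3} (hφ : IsG2Structure g φ) {p : M}
include hφ

namespace IsG2Structure

lemma orth (i j : Fin 7) :
    g.inner p ((g2 g φ p).e i) ((g2 g φ p).e j) = if i = j then 1 else 0 := (hφ.isG2 p).orth i j

lemma dTri : DTri (fun q => (g2 g φ q).ph) p where
  add₁ q := (hφ.isG2 q).ph_add
  smul₁ q := (hφ.isG2 q).ph_smul
  add₂ q := (hφ.isG2 q).ph_add₂
  smul₂ q r a b c := (hφ.isG2 q).ph_smul₂ r a b c
  add₃ q a b c c' := (hφ.isG2 q).ph_add₃ a b c c'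
  smul₃ q r a b c := (hφ.isG2 q).ph_smul₃ r a b c
  diff a b c := by
    have h1 := hφ.1 p ![a, b, c]
    have h2 := (h1.contMDiffAt ((chartAt E7 p).open_source.mem_nhds
      (mem_chart_source E7 p))).mdifferentiableAt (by simp)
    refine DFun.congr h2 (Filter.Eventually.of_forall fun q => ?_)
    change φ q _ = φ q _
    congr 1
    funext i; fin_cases i <;> rfl

variable {U V : ∀ q : M, TangentSpace (𝓡 7) q} (hU : DVec U p) (hV : DVec V p)
include hU hV

lemma dFun_ip : DFun (fun q => (g2 g φ q).ip (U q) (V q)) p := dFun_inner g hU hV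

lemma mvfderiv_ip (w : TangentSpace (𝓡 7) p) :
    mvfderiv (𝓡 7) (fun q => (g2 g φ q).ip (U q) (V q)) p w =
      (g2 g φ p).ip (nablaVec g (g2 g φ p).e U w) (V p) +
        (g2 g φ p).ip (U p) (nablaVec g (g2 g φ p).e V w) :=
  mvfderiv_inner g hφ.orth hU hV w

/-- The scalar products with coordinate fields are values of φ, which are differentiable by its
Leibniz rule. -/
lemma dVec_cross : DVec (fun q => (g2 g φ q).cross (U q) (V q)) p := by
  refine dVec_of_inner g hφ.orth fun n => ?_
  refine DFun.congr (hφ.dTri.leibniz g hφ.orth hU hV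
    (dVec_coordField ((g2 g φ p).e n))).1 (Filter.Eventually.of_forall fun q => ?_)
  exact (hφ.isG2 q).ip_cross _ _ _

/-- The Leibniz rule for φ, tested against coordinate fields; x is the vector dual to (∇_w φ)(U, V,
·). -/
lemma nablaVec_cross {w x : TangentSpace (𝓡 7) p}
    (hx : ∀ z, (g2 g φ p).ip x z =
      nabla3 g (g2 g φ p).e (fun q => (g2 g φ q).ph) w (U p) (V p) z) :
    nablaVec g (g2 g φ p).e (fun q => (g2 g φ q).cross (U q) (V q)) w =
      (g2 g φ p).cross (nablaVec g (g2 g φ p).e U w) (V p) +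
        (g2 g φ p).cross (U p) (nablaVec g (g2 g φ p).e V w) + x := by
  have h := hφ.isG2 p
  refine nablaVec_eq_of_inner g hφ.orth (hφ.dVec_cross hU hV) w _ fun z => ?_
  have e1 : (fun q => g.inner q ((g2 g φ q).cross (U q) (V q)) (coordField z q)) =
      fun q => (g2 g φ q).ph (U q) (V q) (coordField z q) := by
    funext q; exact (hφ.isG2 q).ip_cross _ _ _
  rw [e1, (hφ.dTri.leibniz g hφ.orth hU hV (dVec_coordField z)).2 w, coordField_self, ← hx]
  change _ = (g2 g φ p).ip _ _ + (g2 g φ p).ip _ _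
  rw [h.ip_add, h.ip_add, h.ip_cross, h.ip_cross, h.ip_cross]
  ring

omit hU hV

lemma exists_nabla3_ip (w a b : TangentSpace (𝓡 7) p) : ∃ x, ∀ z, (g2 g φ p).ip x z =
    nabla3 g (g2 g φ p).e (fun q => (g2 g φ q).ph) w a b z := by
  have h := hφ.isG2 p
  have s1 := hφ.dTri.nabla3_swap g hφ.orth (fun q a b c => (hφ.isG2 q).ph_swap a b c) w
  have s2 := hφ.dTri.nabla3_swap' g hφ.orth (fun q a b c => (hφ.isG2 q).ph_swap' a b c) w
  have s3 : ∀ z, nabla3 g (g2 g φ p).e (fun q => (g2 g φ q).ph) w a b z =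
      nabla3 g (g2 g φ p).e (fun q => (g2 g φ q).ph) w z a b := fun z => by
    rw [s2 a z b, s1 z a b, neg_neg]
  let L : TangentSpace (𝓡 7) p →ₗ[ℝ] ℝ :=
    { toFun := fun z => nabla3 g (g2 g φ p).e (fun q => (g2 g φ q).ph) w a b z
      map_add' := fun x y => by
        simp only [s3]; exact hφ.dTri.nabla3_add g hφ.orth w x y a b
      map_smul' := fun r x => by
        simp only [s3]; exact hφ.dTri.nabla3_smul g hφ.orth w r x a b }
  exact ⟨(g2 g φ p).sharp L, fun z => h.ip_sharp L z⟩

/-- The covariant derivative of the 3-form is determined by the torsion. -/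
lemma nabla3_ph (w : TangentSpace (𝓡 7) p) :
    (∀ z, (g2 g φ p).ip ((g2 g φ p).sharp fun v => torsion g (g2 g φ) p w v) z =
      torsion g (g2 g φ) p w z) ∧
    ∀ a b c, nabla3 g (g2 g φ p).e (fun q => (g2 g φ q).ph) w a b c =
      2 * (g2 g φ p).cpsi ((g2 g φ p).sharp fun v => torsion g (g2 g φ) p w v) a b c := by
  have h := hφ.isG2 p
  obtain ⟨t, ht⟩ := h.exists_eq_cpsi (hφ.g2_ph p)
    (η := nabla3 g (g2 g φ p).e (fun q => (g2 g φ q).ph) w)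
    (hφ.dTri.nabla3_add g hφ.orth w) (hφ.dTri.nabla3_smul g hφ.orth w)
    (hφ.dTri.nabla3_swap g hφ.orth (fun q a b c => (hφ.isG2 q).ph_swap a b c) w)
    (hφ.dTri.nabla3_swap' g hφ.orth (fun q a b c => (hφ.isG2 q).ph_swap' a b c) w)
    -- The linearized constraint: differentiate |a × b|² = |a|²|b|² − ⟨a, b⟩². By metric
    -- compatibility the terms with ∇a and ∇b cancel, which leaves (∇_w φ)(a, b, a × b) = 0.
    (fun a b => by
      have ha := dVec_coordField a
      have hb := dVec_coordField b
      obtain ⟨x, hx⟩ := hφ.exists_nabla3_ip w a b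
      have hC := hφ.dVec_cross ha hb
      have e1 := hφ.mvfderiv_ip hC hC w
      rw [hφ.nablaVec_cross ha hb (x := x) (by simpa only [coordField_self] using hx)] at e1
      have e2 : (fun q => (g2 g φ q).ip ((g2 g φ q).cross (coordField a q) (coordField b q))
          ((g2 g φ q).cross (coordField a q) (coordField b q))) =
          fun q => (g2 g φ q).ip (coordField a q) (coordField a q) *
            (g2 g φ q).ip (coordField b q) (coordField b q) -
            (g2 g φ q).ip (coordField a q) (coordField b q) *
            (g2 g φ q).ip (coordField a q) (coordField b q) := by
        funext q
        have hq := (hφ.isG2 q).toIsOct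
        rw [hq.ip_cross_cross, hq.cpsi_swap₂, hq.cpsi_self_left,
          hq.ip_comm (coordField b q) (coordField a q)]
        ring
      have i1 := hφ.dFun_ip ha ha
      have i2 := hφ.dFun_ip hb hb
      have i3 := hφ.dFun_ip ha hb
      rw [e2, dsub (i1.mul i2) (i3.mul i3), dmul i1 i2, dmul i3 i3, hφ.mvfderiv_ip ha ha,
        hφ.mvfderiv_ip hb hb, hφ.mvfderiv_ip ha hb] at e1
      simp only [coordField_self] at e1
      generalize nablaVec g (g2 g φ p).e (coordField a) w = a' at e1
      generalize nablaVec g (g2 g φ p).e (coordField b) w = b' at e1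
      rw [← hx]
      simp only [h.ip_add, h.ip_add', h.ip_cross_cross, h.ip_comm ((g2 g φ p).cross a b) x] at e1
      have c1 : (g2 g φ p).cpsi a' b a b = 0 := by rw [h.cpsi_swap₃, h.cpsi_self, neg_zero]
      have c2 : (g2 g φ p).cpsi a b' a b = 0 := by rw [h.cpsi_swap₂, h.cpsi_self_left, neg_zero]
      have c3 : (g2 g φ p).cpsi a b a' b = 0 := by
        rw [h.cpsi_swap₃, h.cpsi_self, neg_zero]
      have c4 : (g2 g φ p).cpsi a b a b' = 0 := by rw [h.cpsi_swap₂, h.cpsi_self_left, neg_zero]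
      rw [c1, c2, c3, c4, h.ip_comm a' a, h.ip_comm b' b, h.ip_comm b a, h.ip_comm b a',
        h.ip_comm b' a] at e1
      linarith)
  have hT : ∀ z, torsion g (g2 g φ) p w z = (g2 g φ p).ip t z := by
    intro z
    have := h.sum_cpsi_cpsi t z
    simp only [torsion, ht, h.psi_eq, mul_assoc, ← Finset.mul_sum]
    rw [this]; ring
  have hs : ((g2 g φ p).sharp fun v => torsion g (g2 g φ) p w v) = t := by
    refine h.sharp_eq fun a => (hT a).symm
  rw [hs]
  exact ⟨fun z => (hT z).symm, ht⟩

end IsG2Structure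
end Structure
end OctKilling
end

/-! ### The octonion covariant derivative and the torsion of φ_A -/

noncomputable section

namespace OctKilling

section Pointwise

variable {V : Type*} [AddCommGroup V] [Module ℝ V] {S : G2Point V}

/-- Real κ doubles φ. For imaginary κ, right multiplication is skew up to an associator, which is
given by the 4-form. -/
lemma IsOct.oip_mul_mul_add (h : IsOct S) (a b c : V) (κ : Oct V) :
    S.oip (S.mul (delta a) (S.mul (delta b) κ)) (delta c) +
      S.oip (S.mul (delta a) (delta b)) (S.mul (delta c) κ) =
      2 * κ.1 * S.ph a b c - 2 * S.cpsi κ.2 a b c := by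
  have e1 : S.cpsi a b κ.2 c = S.cpsi κ.2 a b c := by rw [h.cpsi_swap₂, h.cpsi_swap]; ring
  have e2 := h.oip_assoc a b κ.2 c
  have e3 := h.oip_mul_delta_skew (S.mul (delta a) (delta b)) (delta c) κ.2
  have e4 : S.oip (S.mul (delta a) (delta b)) (delta c) = S.ph a b c := by
    rw [h.mul_delta_delta, h.oip_delta, h.ip_cross]
  have e5 : S.mul (delta b) κ = κ.1 • delta b + S.mul (delta b) (delta κ.2) := by
    conv_lhs => rw [oct_eq κ, h.mul_add, h.mul_smul, h.mul_one]
  have e6 : S.mul (delta c) κ = κ.1 • delta c + S.mul (delta c) (delta κ.2) := by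
    conv_lhs => rw [oct_eq κ, h.mul_add, h.mul_smul, h.mul_one]
  rw [e5, e6, h.mul_add, h.mul_smul, h.mul_mul_delta, h.oip_add, h.oip_add, h.oip_add', h.oip_smul,
    h.oip_smul', e4]
  simp only [delta] at e2 e3 ⊢
  rw [e2, e1]
  linarith

end Pointwise

variable {M : Type*} [TopologicalSpace M] [ChartedSpace E7 M] [IsManifold (𝓡 7) ∞ M]

/-- Differentiability of an octonion section at a point. -/
def DOct (A : OctField M) (p : M) : Prop :=
  DFun (fun q => (A q).1) p ∧ DVec (fun q => (A q).2) p

/-- The Levi-Civita derivative of an octonion section. -/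
def nablaOct (g : Metric7 M) {p : M} (e : Fin 7 → TangentSpace (𝓡 7) p) (A : OctField M)
    (w : TangentSpace (𝓡 7) p) : Oct (TangentSpace (𝓡 7) p) :=
  (mvfderiv (𝓡 7) (fun q => (A q).1) p w, nablaVec g e (fun q => (A q).2) w)

/-- The imaginary octonion field of a coordinate field. -/
def deltaField {p : M} (a : TangentSpace (𝓡 7) p) : OctField M := fun q => delta (coordField a q)

lemma dOct_deltaField {p : M} (a : TangentSpace (𝓡 7) p) : DOct (deltaField a) p :=
  ⟨mdifferentiableAt_const, dVec_coordField a⟩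

lemma nablaOct_deltaField (g : Metric7 M) {p : M} (e : Fin 7 → TangentSpace (𝓡 7) p)
    (a w : TangentSpace (𝓡 7) p) :
    nablaOct g e (deltaField a) w = delta (nablaVec g e (coordField a) w) := by
  refine Prod.ext ?_ rfl
  change mvfderiv (𝓡 7) (fun _ : M => (0 : ℝ)) p w = 0
  rw [mvfderiv_const]; rfl

lemma nablaVec_coordField (g : Metric7 M) {p : M} {e : Fin 7 → TangentSpace (𝓡 7) p}
    (he : ∀ i j, g.inner p (e i) (e j) = if i = j then 1 else 0) (a w : TangentSpace (𝓡 7) p) :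
    nablaVec g e (coordField a) w = christoffel g e w a := by
  refine inner_ext g he fun z => ?_
  have h1 := (leibniz_slot (fun q => (g.inner q (coordField z q)).toLinearMap) g he
    (fun v => dFun_inner_left g z v) (dVec_coordField a)).2 w
  simp only [ContinuousLinearMap.coe_coe, coordField_self] at h1
  rw [g.symm p _ z, g.symm p _ z]
  linarith

lemma octD_eq (g : Metric7 M) (S : ∀ q : M, G2Point (TangentSpace (𝓡 7) q)) (A : OctField M)
    (p : M) (w : TangentSpace (𝓡 7) p) : octD g S A p w =
      nablaOct g (S p).e A w - (S p).mul (A p) (delta ((S p).sharp fun v => torsion g S p w v)) :=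
  rfl

namespace IsG2Structure

variable {g : Metric7 M} {φ : FormField M 3} (hφ : IsG2Structure g φ) {p : M}
  {A B : OctField M} (hA : DOct A p) (hB : DOct B p)
include hφ hA hB

lemma dFun_oip : DFun (fun q => (g2 g φ q).oip (A q) (B q)) p :=
  (hA.1.mul hB.1).add (hφ.dFun_ip hA.2 hB.2)

lemma mvfderiv_oip (w : TangentSpace (𝓡 7) p) :
    mvfderiv (𝓡 7) (fun q => (g2 g φ q).oip (A q) (B q)) p w =
      (g2 g φ p).oip (nablaOct g (g2 g φ p).e A w) (B p) +
        (g2 g φ p).oip (A p) (nablaOct g (g2 g φ p).e B w) := by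
  have := dadd (hA.1.mul hB.1) (hφ.dFun_ip hA.2 hB.2) w
  refine this.trans ?_
  rw [dmul hA.1 hB.1, hφ.mvfderiv_ip hA.2 hB.2]
  simp only [G2Point.oip, nablaOct]
  ring

/-- D is metric: it differs from ∇ by right multiplication with an imaginary octonion, which is
skew. -/
lemma mvfderiv_oip_octD (w : TangentSpace (𝓡 7) p) :
    mvfderiv (𝓡 7) (fun q => (g2 g φ q).oip (A q) (B q)) p w =
      (g2 g φ p).oip (octD g (g2 g φ) A p w) (B p) +
        (g2 g φ p).oip (A p) (octD g (g2 g φ) B p w) := by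
  have h := hφ.isG2 p
  rw [hφ.mvfderiv_oip hA hB, octD_eq, octD_eq, h.oip_sub, h.oip_sub']
  linarith [h.oip_mul_delta_skew (A p) (B p) ((g2 g φ p).sharp fun v => torsion g (g2 g φ) p w v)]

lemma dOct_mul : DOct (fun q => (g2 g φ q).mul (A q) (B q)) p :=
  ⟨(hA.1.mul hB.1).sub (hφ.dFun_ip hA.2 hB.2),
    ((hB.2.smul hA.1).add (hA.2.smul hB.1)).add (hφ.dVec_cross hA.2 hB.2)⟩

/-- Since ∇φ = 2T ⌟ ψ, the derivative of the product itself contributes −[A, B, T]. This is exactly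
the difference between (AB)T and A(BT), so the torsion term of D can be attached to B. -/
lemma octD_mul (w : TangentSpace (𝓡 7) p) :
    octD g (g2 g φ) (fun q => (g2 g φ q).mul (A q) (B q)) p w =
      (g2 g φ p).mul (nablaOct g (g2 g φ p).e A w) (B p) +
        (g2 g φ p).mul (A p) (octD g (g2 g φ) B p w) := by
  have h := hφ.isG2 p
  let T := (g2 g φ p).sharp fun v => torsion g (g2 g φ) p w v
  let x := -((g2 g φ p).assoc (delta (A p).2) (delta (B p).2) (delta T)).2
  have hx : ∀ z, (g2 g φ p).ip x z =
      nabla3 g (g2 g φ p).e (fun q => (g2 g φ q).ph) w (A p).2 (B p).2 z := by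
    intro z
    rw [(hφ.nabla3_ph w).2, h.ip_neg, ← h.oip_delta, h.oip_assoc]
    have : (g2 g φ p).cpsi (A p).2 (B p).2 T z = (g2 g φ p).cpsi T (A p).2 (B p).2 z := by
      rw [h.cpsi_swap₂, h.cpsi_swap]; ring
    rw [this]; ring
  have key : nablaOct g (g2 g φ p).e (fun q => (g2 g φ q).mul (A q) (B q)) w =
      (g2 g φ p).mul (nablaOct g (g2 g φ p).e A w) (B p) +
        (g2 g φ p).mul (A p) (nablaOct g (g2 g φ p).e B w) + (0, x) := by
    refine Prod.ext ?_ ?_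
    · have := dsub (hA.1.mul hB.1) (hφ.dFun_ip hA.2 hB.2) w
      refine this.trans ?_
      rw [dmul hA.1 hB.1, hφ.mvfderiv_ip hA.2 hB.2]
      simp only [G2Point.mul, nablaOct, Prod.fst_add]
      ring
    · have e1 := nablaVec_vadd g hφ.orth ((hB.2.smul hA.1).add (hA.2.smul hB.1))
        (hφ.dVec_cross hA.2 hB.2) w
      have e2 := nablaVec_vadd g hφ.orth (hB.2.smul hA.1) (hA.2.smul hB.1) w
      refine e1.trans ?_
      rw [e2, nablaVec_fsmul g hφ.orth hA.1 hB.2, nablaVec_fsmul g hφ.orth hB.1 hA.2,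
        hφ.nablaVec_cross hA.2 hB.2 hx]
      simp only [G2Point.mul, nablaOct, Prod.snd_add]
      abel
  have hx' : (g2 g φ p).assoc (delta (A p).2) (delta (B p).2) (delta T) =
      -((0, x) : Oct (TangentSpace (𝓡 7) p)) := by
    refine Prod.ext ?_ ?_
    · rw [h.assoc_fst]; simp
    · simp [x]
  rw [octD_eq, octD_eq, key, h.mul_sub]
  change _ - (g2 g φ p).mul ((g2 g φ p).mul (A p) (B p)) (delta T) = _ +
    (_ - (g2 g φ p).mul (A p) ((g2 g φ p).mul (B p) (delta T)))
  rw [h.mul_mul_delta, hx']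
  abel

omit hB

lemma octD_add (u v : TangentSpace (𝓡 7) p) : octD g (g2 g φ) A p (u + v) =
    octD g (g2 g φ) A p u + octD g (g2 g φ) A p v := by
  have h := hφ.isG2 p
  have hT : ∀ z, torsion g (g2 g φ) p (u + v) z = torsion g (g2 g φ) p u z +
      torsion g (g2 g φ) p v z := fun z => by
    simp only [torsion, hφ.dTri.nabla3_dir_add g hφ.orth, _root_.add_mul,
      Finset.sum_add_distrib, _root_.mul_add]
  have hs : ((g2 g φ p).sharp fun z => torsion g (g2 g φ) p (u + v) z) =
      ((g2 g φ p).sharp fun z => torsion g (g2 g φ) p u z) +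
      (g2 g φ p).sharp fun z => torsion g (g2 g φ) p v z := by
    simp only [G2Point.sharp, hT, add_smul, Finset.sum_add_distrib]
  have hn : nablaOct g (g2 g φ p).e A (u + v) = nablaOct g (g2 g φ p).e A u +
      nablaOct g (g2 g φ p).e A v :=
    Prod.ext (map_add _ _ _) (nablaVec_add g hφ.orth hA.2 u v)
  rw [octD_eq, octD_eq, octD_eq, hn, hs, h.delta_add, h.mul_add]
  abel

lemma octD_smul (r : ℝ) (u : TangentSpace (𝓡 7) p) : octD g (g2 g φ) A p (r • u) =
    r • octD g (g2 g φ) A p u := by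
  have h := hφ.isG2 p
  have hT : ∀ z, torsion g (g2 g φ) p (r • u) z = r * torsion g (g2 g φ) p u z := fun z => by
    simp only [torsion, hφ.dTri.nabla3_dir_smul g hφ.orth, mul_assoc, ← Finset.mul_sum]
    ring
  have hs : ((g2 g φ p).sharp fun z => torsion g (g2 g φ) p (r • u) z) =
      r • ((g2 g φ p).sharp fun z => torsion g (g2 g φ) p u z) := by
    simp only [G2Point.sharp, hT, SemigroupAction.mul_smul, Finset.smul_sum]
  have hn : nablaOct g (g2 g φ p).e A (r • u) = r • nablaOct g (g2 g φ p).e A u :=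
    Prod.ext (map_smul _ _ _) (nablaVec_smul g hφ.orth hA.2 r u)
  rw [octD_eq, octD_eq, hn, hs, h.delta_smul, h.mul_smul, smul_sub]

/-- The torsion of `φ_A` is minus the imaginary part of `(D A) A⁻¹`. -/
lemma torsion_gauge (h0 : ∀ q, A q ≠ 0) (u w : TangentSpace (𝓡 7) p)
    {κ : Oct (TangentSpace (𝓡 7) p)} (hκ : (g2 g φ p).mul κ (A p) = octD g (g2 g φ) A p u) :
    torsion g (g2gauge g φ A) p u w = -(g2 g φ p).oip κ (delta w) := by
  have h := hφ.isG2 p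
  have hS := hφ.gauge_isG2 (p := p) (h0 p)
  have hN := h.normSq_ne_zero (h0 p)
  have key : ∀ a b c, nabla3 g (g2 g φ p).e (fun q => (g2gauge g φ A q).ph) u a b c =
      -2 * (g2gauge g φ A p).cpsi κ.2 a b c := by
    intro a b c
    have dab := hφ.dOct_mul (dOct_deltaField a) (hφ.dOct_mul (dOct_deltaField b) hA)
    have dc := hφ.dOct_mul (dOct_deltaField c) hA
    have dN : DFun (fun q => (g2 g φ q).oip (A q) (A q)) p := hφ.dFun_oip hA hA
    have dR := hφ.dFun_oip dab dc
    -- Writing φ_A as |A|⁻² ⟨a(bA), cA⟩ near p lets `octD_mul` carry D through to A.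
    have eq : (fun q => (g2gauge g φ A q).ph (coordField a q) (coordField b q)
        (coordField c q)) = fun q => ((g2 g φ q).oip (A q) (A q))⁻¹ * (g2 g φ q).oip
          ((g2 g φ q).mul (deltaField a q) ((g2 g φ q).mul (deltaField b q) (A q)))
          ((g2 g φ q).mul (deltaField c q) (A q)) := by
      funext q
      have hq := hφ.isG2 q
      have := hq.normSq_mul_sigma (h0 q) (coordField a q) (coordField b q) (coordField c q)
      rw [← hq.normSq_eq, eq_inv_mul_iff_mul_eq₀ (hq.normSq_ne_zero (h0 q))]
      exact this
    have hd1 := hφ.mvfderiv_oip_octD dab dc u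
    rw [hφ.octD_mul (dOct_deltaField a) (hφ.dOct_mul (dOct_deltaField b) hA),
      hφ.octD_mul (dOct_deltaField b) hA, hφ.octD_mul (dOct_deltaField c) hA,
      nablaOct_deltaField, nablaOct_deltaField, nablaOct_deltaField] at hd1
    have hd2 := hφ.mvfderiv_oip_octD hA hA u
    have hN' : (g2 g φ p).oip (A p) (A p) ≠ 0 := by rw [← h.normSq_eq]; exact hN
    have hgm : ∀ P Q : Oct (TangentSpace (𝓡 7) p), (g2 g φ p).mul P ((g2 g φ p).mul Q (A p)) =
        (g2 g φ p).mul ((g2gauge g φ A p).mul P Q) (A p) := h.gauge_mul (h0 p)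
    have hσ : ∀ x y z, (g2 g φ p).oip ((g2 g φ p).mul (delta x) ((g2 g φ p).mul (delta y) (A p)))
        ((g2 g φ p).mul (delta z) (A p)) =
        (g2 g φ p).oip (A p) (A p) * (g2gauge g φ A p).ph x y z := fun x y z => by
      rw [← h.normSq_mul_sigma (h0 p), h.normSq_eq]; rfl
    have hc : deltaField c p = delta c := by rw [deltaField, coordField_self]
    have hb : deltaField b p = delta b := by rw [deltaField, coordField_self]
    have ha : deltaField a p = delta a := by rw [deltaField, coordField_self]
    simp only [nabla3]
    rw [eq, dmul (dN.inv hN') dR, dcomp (u := fun q => (g2 g φ q).oip (A q) (A q)) (hasDerivAt_inv hN') dN, hd1, hd2, ha, hb, hc, ← hκ]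
    simp only [h.mul_add, h.oip_add, h.oip_add', hσ]
    have hself := h.oip_mul_mul κ (1, 0) (A p)
    rw [h.one_mul, h.oip_one] at hself
    rw [h.oip_comm (A p) ((g2 g φ p).mul κ (A p)), hself]
    simp only [hgm, h.oip_mul_mul, h.normSq_eq]
    -- The two terms in which D falls on A give 2 Re κ φ_A − 2 Im κ ⌟ ψ_A; the real part cancels
    -- against the derivative of |A|⁻².
    have hκ' := hS.oip_mul_mul_add a b c κ
    change (g2 g φ p).oip _ _ + (g2 g φ p).oip _ _ = _ at hκ'
    rw [nablaVec_coordField g hφ.orth, nablaVec_coordField g hφ.orth,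
      nablaVec_coordField g hφ.orth]
    field_simp
    linear_combination hκ'
  simp only [torsion, hS.psi_eq]
  have hs := hS.sum_cpsi_cpsi κ.2 w
  rw [h.oip_delta]
  change _ = 24 * (g2 g φ p).ip κ.2 w at hs
  have key' : ∀ a b c, nabla3 g (g2gauge g φ A p).e (fun q => (g2gauge g φ A q).ph) u a b c =
      -2 * (g2gauge g φ A p).cpsi κ.2 a b c := key
  simp only [key', mul_assoc, ← Finset.mul_sum]
  rw [hs]; ring

end IsG2Structure
end OctKilling
end

/-! ### Derivatives of `W` and of the norms -/

noncomputable section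

namespace OctKilling

variable {M : Type*} [TopologicalSpace M] [ChartedSpace E7 M] [IsManifold (𝓡 7) ∞ M]

lemma SmoothOct.dOct {A : OctField M} (hA : SmoothOct A) (p : M) : DOct A p :=
  ⟨(hA.1 p).mdifferentiableAt (by simp), (hA.2 p).mdifferentiableAt (by simp)⟩

namespace IsG2Structure

variable {g : Metric7 M} {φ : FormField M 3} (hφ : IsG2Structure g φ) {p : M}
  {X Y : OctField M} (hX : ∀ q, X q ≠ 0)
include hφ hX

lemma quot_mul (q : M) : (g2 g φ q).mul (quot g φ X Y q) (X q) = Y q :=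
  (hφ.isG2 q).mul_inv_mul (hX q) (Y q)

/-- From ⟨WX, X⟩ = |X|² w₀: as a quotient of scalar products w₀ is differentiated without
differentiating the inverse of X. -/
lemma quot_fst (q : M) : (quot g φ X Y q).1 =
    ((g2 g φ q).oip (X q) (X q))⁻¹ * (g2 g φ q).oip (Y q) (X q) := by
  have h := hφ.isG2 q
  have h1 := h.oip_mul_mul (quot g φ X Y q) (1, 0) (X q)
  rw [hφ.quot_mul hX, h.one_mul, h.oip_one, h.normSq_eq] at h1
  rw [h1, inv_mul_cancel_left₀]
  rw [← h.normSq_eq]; exact h.normSq_ne_zero (hX q)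

lemma quot_normSq (q : M) : (g2 g φ q).normSq (quot g φ X Y q) =
    ((g2 g φ q).oip (X q) (X q))⁻¹ * (g2 g φ q).oip (Y q) (Y q) := by
  have h := hφ.isG2 q
  have h1 := h.oip_mul_mul (quot g φ X Y q) (quot g φ X Y q) (X q)
  rw [hφ.quot_mul hX, ← h.normSq_eq (quot g φ X Y q), h.normSq_eq (X q)] at h1
  rw [h1, inv_mul_cancel_left₀]
  rw [← h.normSq_eq]; exact h.normSq_ne_zero (hX q)

lemma quot_ne_zero (hY : ∀ q, Y q ≠ 0) (q : M) : quot g φ X Y q ≠ 0 := fun hE => hY q <| by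
  rw [← hφ.quot_mul hX (Y := Y) q, hE, (hφ.isG2 q).zero_mul]

section Derivatives

variable (dX : DOct X p) (dY : DOct Y p) {a : TangentSpace (𝓡 7) p}
  {K E : Oct (TangentSpace (𝓡 7) p)}
  (hK : (g2 g φ p).mul K (X p) = octD g (g2 g φ) X p a)
  (hE : (g2 g φ p).mul E (X p) = octD g (g2 g φ) Y p a)
include dX dY hK hE

lemma mvfderiv_oip_quot :
    mvfderiv (𝓡 7) (fun q => (g2 g φ q).oip (X q) (X q)) p a =
      2 * ((g2 g φ p).oip (X p) (X p) * (g2 g φ p).oip K (1, 0)) ∧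
    mvfderiv (𝓡 7) (fun q => (g2 g φ q).oip (Y q) (X q)) p a =
      (g2 g φ p).oip (X p) (X p) *
        ((g2 g φ p).oip E (1, 0) + (g2 g φ p).oip (quot g φ X Y p) K) ∧
    mvfderiv (𝓡 7) (fun q => (g2 g φ q).oip (Y q) (Y q)) p a =
      2 * ((g2 g φ p).oip (X p) (X p) * (g2 g φ p).oip E (quot g φ X Y p)) := by
  have h := hφ.isG2 p
  have e0 : ∀ A : Oct (TangentSpace (𝓡 7) p), (g2 g φ p).oip ((g2 g φ p).mul A (X p)) (X p) =
      (g2 g φ p).oip (X p) (X p) * (g2 g φ p).oip A (1, 0) := fun A => by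
    have := h.oip_mul_mul A (1, 0) (X p)
    rwa [h.one_mul, h.normSq_eq] at this
  have e1 : ∀ A : Oct (TangentSpace (𝓡 7) p), (g2 g φ p).oip ((g2 g φ p).mul A (X p)) (Y p) =
      (g2 g φ p).oip (X p) (X p) * (g2 g φ p).oip A (quot g φ X Y p) := fun A => by
    have := h.oip_mul_mul A (quot g φ X Y p) (X p)
    rwa [hφ.quot_mul hX, h.normSq_eq] at this
  refine ⟨?_, ?_, ?_⟩
  · rw [hφ.mvfderiv_oip_octD dX dX, ← hK, h.oip_comm (X p), e0]; ring
  · rw [hφ.mvfderiv_oip_octD dY dX, ← hK, ← hE, h.oip_comm (Y p), e0, e1,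
      h.oip_comm (quot g φ X Y p)]; ring
  · rw [hφ.mvfderiv_oip_octD dY dY, ← hE, h.oip_comm (Y p), e1]; ring

lemma mvfderiv_quot_fst : mvfderiv (𝓡 7) (fun q => (quot g φ X Y q).1) p a =
    (g2 g φ p).oip E (1, 0) + (g2 g φ p).oip (quot g φ X Y p) K -
      2 * (quot g φ X Y p).1 * (g2 g φ p).oip K (1, 0) := by
  obtain ⟨e1, e2, -⟩ := hφ.mvfderiv_oip_quot hX dX dY hK hE
  have hN : (g2 g φ p).oip (X p) (X p) ≠ 0 := by
    rw [← (hφ.isG2 p).normSq_eq]; exact (hφ.isG2 p).normSq_ne_zero (hX p)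
  have dXX := hφ.dFun_oip dX dX
  have dYX := hφ.dFun_oip dY dX
  rw [funext (hφ.quot_fst hX (Y := Y)), dmul (dXX.inv hN) dYX,
    dcomp (u := fun q => (g2 g φ q).oip (X q) (X q)) (hasDerivAt_inv hN) dXX, e1, e2,
    hφ.quot_fst hX p]
  field_simp
  ring

lemma mvfderiv_quot_normSq :
    mvfderiv (𝓡 7) (fun q => (g2 g φ q).normSq (quot g φ X Y q)) p a =
    2 * (g2 g φ p).oip E (quot g φ X Y p) -
      2 * (g2 g φ p).normSq (quot g φ X Y p) * (g2 g φ p).oip K (1, 0) := by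
  obtain ⟨e1, -, e3⟩ := hφ.mvfderiv_oip_quot hX dX dY hK hE
  have hN : (g2 g φ p).oip (X p) (X p) ≠ 0 := by
    rw [← (hφ.isG2 p).normSq_eq]; exact (hφ.isG2 p).normSq_ne_zero (hX p)
  have dXX := hφ.dFun_oip dX dX
  have dYY := hφ.dFun_oip dY dY
  rw [funext (hφ.quot_normSq hX (Y := Y)), dmul (dXX.inv hN) dYY,
    dcomp (u := fun q => (g2 g φ q).oip (X q) (X q)) (hasDerivAt_inv hN) dXX, e1, e3,
    hφ.quot_normSq hX p]
  field_simp
  ring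

/-- The nonzero factor e^{-Δ}|X|² splits off, so the normalization is a linear equation between K, E
and dΔ. -/
lemma mvfderiv_norm {Δ : M → ℝ} (dΔ : DFun Δ p) :
    mvfderiv (𝓡 7) (fun q => Real.exp (-Δ q) *
      ((g2 g φ q).normSq (X q) + (g2 g φ q).normSq (Y q))) p a =
    Real.exp (-Δ p) * (g2 g φ p).normSq (X p) *
      (2 * (g2 g φ p).oip K (1, 0) + 2 * (g2 g φ p).oip E (quot g φ X Y p) -
        (1 + (g2 g φ p).normSq (quot g φ X Y p)) * mvfderiv (𝓡 7) Δ p a) := by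
  obtain ⟨e1, -, e3⟩ := hφ.mvfderiv_oip_quot hX dX dY hK hE
  have hN : (g2 g φ p).oip (X p) (X p) ≠ 0 := by
    rw [← (hφ.isG2 p).normSq_eq]; exact (hφ.isG2 p).normSq_ne_zero (hX p)
  have dXX := hφ.dFun_oip dX dX
  have dYY := hφ.dFun_oip dY dY
  have hn : (fun q => Real.exp (-Δ q) * ((g2 g φ q).normSq (X q) + (g2 g φ q).normSq (Y q))) =
      fun q => Real.exp (-Δ q) * ((g2 g φ q).oip (X q) (X q) + (g2 g φ q).oip (Y q) (Y q)) := by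
    funext q; rw [(hφ.isG2 q).normSq_eq, (hφ.isG2 q).normSq_eq]
  have hexp : HasDerivAt (fun t : ℝ => Real.exp (-t)) (-Real.exp (-Δ p)) (Δ p) := by
    simpa using (hasDerivAt_id (Δ p)).neg.exp
  have dE : DFun (fun q => Real.exp (-Δ q)) p :=
    DFun.comp (f := fun t : ℝ => Real.exp (-t)) hexp.differentiableAt dΔ
  rw [hn, dmul dE (dXX.add dYY), dadd dXX dYY, dcomp hexp dΔ, e1, e3, hφ.quot_normSq hX p,
    (hφ.isG2 p).normSq_eq]
  field_simp
  ring

end Derivatives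

lemma ip_grad (Δ : M → ℝ) (a : TangentSpace (𝓡 7) p) :
    (g2 g φ p).ip (grad (g2 g φ) Δ p) a = mvfderiv (𝓡 7) Δ p a :=
  (hφ.isG2 p).ip_sharp (mvfderiv (𝓡 7) Δ p).toLinearMap a

end IsG2Structure

/-- The division of an octonion-valued 1-form by an octonion. -/
def divForm {V : Type*} [AddCommGroup V] [Module ℝ V] {S : G2Point V} (h : IsOct S)
    (F : V →ₗ[ℝ] Oct V) (A : Oct V) : V →ₗ[ℝ] Oct V where
  toFun a := S.mul (F a) (S.inv A)
  map_add' a b := by rw [map_add, h.add_mul]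
  map_smul' r a := by rw [map_smul, h.smul_mul]; rfl

end OctKilling
end

/-! ### Assembling the equivalence on the manifold -/

noncomputable section

namespace OctKilling

variable {M : Type*} [TopologicalSpace M] [ChartedSpace E7 M] [IsManifold (𝓡 7) ∞ M]

section AtPoint

variable (g : Metric7 M) (φ : FormField M 3) (G : FormField M 4) (Δ : M → ℝ) (l1 l2 μ : ℝ)
  (X Y : OctField M) (p : M)

/-- The Killing equations at one point. -/
def KillingAt : Prop :=
  (0 = csmul ((⟨l1, l2⟩ : ℂ) * (Real.exp (-Δ p) : ℂ)) (cstar (X p, Y p))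
    + csmul Complex.I
        ((g2 g φ p).lmul (μ * Real.exp (-4 * Δ p), (1 / 2 : ℝ) • grad (g2 g φ) Δ p) (X p, Y p))
    + (1 / 144 : ℝ) • (g2 g φ p).cliff4 (form4 G p) (X p, Y p)) ∧
  ∀ u : TangentSpace (𝓡 7) p,
    ((octD g (g2 g φ) X p u, octD g (g2 g φ) Y p u) : COct (TangentSpace (𝓡 7) p)) =
      -(((1 / 2 : ℝ) * μ * Real.exp (-4 * Δ p)) • (g2 g φ p).lmul (delta u) (X p, Y p))
      - csmul (Complex.I / 144) ((g2 g φ p).lmul (delta u)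
          ((g2 g φ p).cliff4 (form4 G p) (X p, Y p)))
      - csmul (Complex.I / 12) ((g2 g φ p).cliff3 (form4 G p) u (X p, Y p))

/-- The equations for `w₀` and `|W|²` at one point. -/
def ScalarEqAt : Prop :=
  let S := g2 g φ
  let W := quot g φ X Y
  (2 * (W p).1 * l1 - l2 * (1 - (S p).normSq (W p)) =
    μ * Real.exp (-3 * Δ p) * (1 + (S p).normSq (W p))) ∧
  (∀ u : TangentSpace (𝓡 7) p, mvfderiv (𝓡 7) (fun q => (W q).1) p u =
    -(3 / 2) * (1 + (S p).normSq (W p)) * (W p).1 * mvfderiv (𝓡 7) Δ p u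
      - 4 * ((W p).1 * l1 - l2) * Real.exp (-Δ p) * (S p).ip (W p).2 u) ∧
  ∀ u : TangentSpace (𝓡 7) p,
    mvfderiv (𝓡 7) (fun q => (S q).normSq (W q)) p u / (1 + (S p).normSq (W p)) =
      (3 / 2) * (1 - (S p).normSq (W p)) * mvfderiv (𝓡 7) Δ p u
        - 4 * l1 * Real.exp (-Δ p) * (S p).ip (W p).2 u

/-- The relations for the components of the 4-form and the torsion of `φ_X` at one point. -/
def FluxEqAt (Q0 : ℝ) (Q1 : TangentSpace (𝓡 7) p)
    (Q2 : TangentSpace (𝓡 7) p →ₗ[ℝ] TangentSpace (𝓡 7) p) : Prop :=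
  let SX := g2gauge g φ X
  let W := quot g φ X Y p
  let dΔ := grad SX Δ p
  (Q2 W.2 = W.1 • Q1 - ((1 / 4) * (Q0 - 6 * l1 * Real.exp (-Δ p))) • W.2
    - (3 / 4 : ℝ) • dΔ) ∧
  ((((7 / 3) * Q0, (4 / 3 : ℝ) • Q1) : Oct (TangentSpace (𝓡 7) p)) =
    (SX p).mul (2 * Real.exp (-Δ p) * (l2 - μ * Real.exp (-3 * Δ p)), -dΔ) W
      + (2 * l1 * Real.exp (-Δ p), 0)) ∧
  ∀ u : TangentSpace (𝓡 7) p,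
    torsionTransposeOct g SX p u =
      (SX p).mul
          ((SX p).ip Q1 u, -((1 / 4) * (Q0 - 2 * l1 * Real.exp (-Δ p))) • u - Q2 u)
          (oconj W)
        + (1 / 4 : ℝ) • (SX p).mul (delta u) (delta dΔ)
        + (l1 * Real.exp (-Δ p) * (SX p).ip W.2 u - (1 / 2) * mvfderiv (𝓡 7) Δ p u,
            -((1 / 2) * l2 * Real.exp (-Δ p)) • u)

/-- The relations for the torsion components at one point. -/
def TorsionEqAt : Prop :=
  (g2gauge g φ X p).TorsionRel (g2gauge g φ Y p) (quot g φ X Y p) (grad (g2gauge g φ X) Δ p)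
    ((1 / 2) * μ * Real.exp (-4 * Δ p)) (torsion g (g2gauge g φ X) p)
    (torsion g (g2gauge g φ Y) p)

lemma isKilling_iff_forall : IsKilling g φ G Δ ⟨l1, l2⟩ μ X Y ↔
    ∀ p, KillingAt g φ G Δ l1 l2 μ X Y p := Iff.rfl

lemma conditions_iff_forall : Conditions g φ G Δ l1 l2 μ X Y ↔
    ∀ p, ScalarEqAt g φ Δ l1 l2 μ X Y p ∧
      (∃ Q0 Q1 Q2, (g2gauge g φ X p).IsFourFormDecomp (form4 G p) Q0 Q1 Q2 ∧
        FluxEqAt g φ Δ l1 l2 μ X Y p Q0 Q1 Q2) ∧ TorsionEqAt g φ Δ μ X Y p :=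
  ⟨fun h p => ⟨h.1 p, h.2.1 p, h.2.2 p⟩, fun h => ⟨fun p => (h p).1, fun p => (h p).2.1,
    fun p => (h p).2.2⟩⟩

end AtPoint

namespace IsG2Structure

variable {g : Metric7 M} {φ : FormField M 3} (hφ : IsG2Structure g φ)
  {X Y : OctField M} (hX : IsNonvanishing X) (hY : IsNonvanishing Y)
  {Δ : M → ℝ} (hΔ : ContMDiff (𝓡 7) 𝓘(ℝ) ∞ Δ)
include hφ hX hY hΔ

lemma killingAt_iff (G : FormField M 4) (l1 l2 μ : ℝ) (p : M) {Q0 : ℝ}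
    {Q1 : TangentSpace (𝓡 7) p} {Q2 : TangentSpace (𝓡 7) p →ₗ[ℝ] TangentSpace (𝓡 7) p}
    (hdec : (g2gauge g φ X p).IsFourFormDecomp (form4 G p) Q0 Q1 Q2) :
    KillingAt g φ G Δ l1 l2 μ X Y p ↔
      (ScalarEqAt g φ Δ l1 l2 μ X Y p ∧ FluxEqAt g φ Δ l1 l2 μ X Y p Q0 Q1 Q2 ∧
        TorsionEqAt g φ Δ μ X Y p) ∧
      ∀ a, mvfderiv (𝓡 7) (fun q => Real.exp (-Δ q) *
          ((g2 g φ q).normSq (X q) + (g2 g φ q).normSq (Y q))) p a = 0 := by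
  have h := hφ.isG2 p
  have hS := hφ.gauge_isG2 (p := p) (hX.2 p)
  have dX := hX.1.dOct p
  have dY := hY.1.dOct p
  have dΔ : DFun Δ p := (hΔ p).mdifferentiableAt (by simp)
  let W := quot g φ X Y p
  have hW : W ≠ 0 := hφ.quot_ne_zero hX.2 hY.2 p
  have hWX : (g2 g φ p).mul W (X p) = Y p := hφ.quot_mul hX.2 p
  let K := divForm h.toIsOct
    { toFun := octD g (g2 g φ) X p, map_add' := hφ.octD_add dX, map_smul' := hφ.octD_smul dX }
    (X p)
  let E := divForm h.toIsOct
    { toFun := octD g (g2 g φ) Y p, map_add' := hφ.octD_add dY, map_smul' := hφ.octD_smul dY }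
    (X p)
  have hK : ∀ a, (g2 g φ p).mul (K a) (X p) = octD g (g2 g φ) X p a := fun a =>
    h.mul_inv_mul (hX.2 p) _
  have hE : ∀ a, (g2 g φ p).mul (E a) (X p) = octD g (g2 g φ) Y p a := fun a =>
    h.mul_inv_mul (hX.2 p) _
  -- In the pointwise algebra s = e^{-Δ} and n = μ e^{-3Δ}, so μ e^{-4Δ} = s n.
  have hm : μ * Real.exp (-4 * Δ p) = Real.exp (-Δ p) * (μ * Real.exp (-3 * Δ p)) := by
    have : Real.exp (-4 * Δ p) = Real.exp (-Δ p) * Real.exp (-3 * Δ p) := by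
      rw [← Real.exp_add]; ring_nf
    rw [this]; ring
  have hgY : (g2gauge g φ X p).gauge W = g2gauge g φ Y p := by
    have := h.gauge_gauge (hX.2 p) hS hW (by rw [hWX]; exact hY.2 p)
    rw [hWX] at this
    exact this
  have hTX : ∀ a c, torsion g (g2gauge g φ X) p a c =
      -(g2gauge g φ X p).oip (K a) (delta c) := fun a c =>
    hφ.torsion_gauge dX hX.2 a c (hK a)
  have hTY : ∀ a c, (g2gauge g φ X p).normSq W * torsion g (g2gauge g φ Y) p a c =
      -(g2gauge g φ X p).oip (E a) ((g2gauge g φ X p).mul (delta c) W) := fun a c => by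
    -- The torsion of φ_Y comes from κ = (D_a Y)Y⁻¹. Since Y = WX, the product of κ and W for φ_X is
    -- E_a, and multiplicativity of the norm supplies |W|².
    let κ := (g2 g φ p).mul (octD g (g2 g φ) Y p a) ((g2 g φ p).inv (Y p))
    have hκ : (g2 g φ p).mul κ (Y p) = octD g (g2 g φ) Y p a := h.mul_inv_mul (hY.2 p) _
    have hκE : (g2gauge g φ X p).mul κ W = E a := by
      refine h.mul_right_cancel (hX.2 p) ?_
      rw [hE, ← hκ, ← hWX]
      exact (h.gauge_mul (hX.2 p) κ W).symm
    rw [hφ.torsion_gauge dY hY.2 a c hκ, ← hκE, hS.oip_mul_mul]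
    change _ * -(g2 g φ p).oip _ _ = -(_ * (g2 g φ p).oip _ _)
    ring
  have e1 := h.killing_div (hX.2 p) hS (isAlt4_form4 G p) hdec hWX _ _ K E hK hE
    (grad (g2 g φ) Δ p) (Real.exp (-Δ p)) (μ * Real.exp (-4 * Δ p)) (μ * Real.exp (-3 * Δ p))
    l1 l2 hm
  have e2 := hS.killing_iff hW K E Q0 Q1 Q2 hdec.symm hdec.traceless (grad (g2 g φ) Δ p)
    (Real.exp (-Δ p)) (μ * Real.exp (-3 * Δ p)) l1 l2 hTX hTY (Real.exp_pos _).ne'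
  rw [hgY] at e2
  have hip : ∀ a, (g2gauge g φ X p).ip (grad (g2 g φ) Δ p) a = mvfderiv (𝓡 7) Δ p a :=
    hφ.ip_grad hX.2 Δ
  have hpos : Real.exp (-Δ p) * (g2 g φ p).normSq (X p) ≠ 0 :=
    mul_ne_zero (Real.exp_pos _).ne' (h.normSq_ne_zero (hX.2 p))
  refine Iff.trans (by simp only [KillingAt, ← mul_assoc]) ((e1.trans e2).trans ?_)
  simp only [hip]
  refine and_congr (and_congr ?_ (and_congr Iff.rfl ?_)) (forall_congr' fun a => ?_)
  · refine and_congr Iff.rfl (and_congr (forall_congr' fun a => ?_) (forall_congr' fun a => ?_))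
    · rw [hφ.mvfderiv_quot_fst hX.2 dX dY (hK a) (hE a)]; rfl
    · rw [hφ.mvfderiv_quot_normSq hX.2 dX dY (hK a) (hE a)]; rfl
  · rw [TorsionEqAt, mul_assoc (1 / 2 : ℝ) μ, hm]; rfl
  · rw [hφ.mvfderiv_norm hX.2 dX dY (hK a) (hE a) dΔ, mul_eq_zero, or_iff_right hpos, sub_eq_zero]
    rfl

lemma isKilling_iff (G : FormField M 4) (l1 l2 μ : ℝ) : IsKilling g φ G Δ ⟨l1, l2⟩ μ X Y ↔
      Conditions g φ G Δ l1 l2 μ X Y ∧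
        ∀ p, mvfderiv (𝓡 7) (fun q => Real.exp (-Δ q) *
          ((g2 g φ q).normSq (X q) + (g2 g φ q).normSq (Y q))) p = 0 := by
  rw [isKilling_iff_forall, conditions_iff_forall, ← forall_and]
  refine forall_congr' fun p => ⟨fun H => ?_, ?_⟩
  · obtain ⟨Q0, Q1, Q2, hdec⟩ :=
      (hφ.gauge_isG2 (p := p) (hX.2 p)).exists_fourFormDecomp (isAlt4_form4 G p)
    have h1 := (hφ.killingAt_iff hX hY hΔ G l1 l2 μ p hdec).1 H
    exact ⟨⟨h1.1.1, ⟨Q0, Q1, Q2, hdec, h1.1.2.1⟩, h1.1.2.2⟩, ContinuousLinearMap.ext h1.2⟩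
  · rintro ⟨⟨h1, ⟨Q0, Q1, Q2, hdec, h2⟩, h3⟩, hn⟩
    refine (hφ.killingAt_iff hX hY hΔ G l1 l2 μ p hdec).2 ⟨⟨h1, h2, h3⟩, fun a => ?_⟩
    rw [hn]; rfl

end IsG2Structure
end OctKilling
end

/-! ### Rescaling and the existence statement -/

noncomputable section

namespace OctKilling

section Pointwise

variable {V : Type*} [AddCommGroup V] [Module ℝ V] {S : G2Point V}

lemma IsOct.normSq_smul (h : IsOct S) (c : ℝ) (A : Oct V) :
    S.normSq (c • A) = c ^ 2 * S.normSq A := by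
  rw [h.normSq_eq, h.oip_smul, h.oip_smul', h.normSq_eq]; ring

/-- `σ_A` is homogeneous of degree 0 in A. -/
lemma IsG2.gauge_smul (h : IsG2 S) {c : ℝ} (hc : c ≠ 0) {A : Oct V} (hA : A ≠ 0) :
    S.gauge (c • A) = S.gauge A := by
  have : S.sigma (c • A) = S.sigma A := by
    funext u v w
    have e1 := h.normSq_mul_sigma (smul_ne_zero hc hA) u v w
    have e2 := h.normSq_mul_sigma hA u v w
    simp only [h.mul_smul, h.oip_smul, h.oip_smul', ← e2, h.normSq_smul] at e1
    have hN := h.normSq_ne_zero hA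
    have : c ^ 2 * S.normSq A ≠ 0 := by positivity
    exact mul_left_cancel₀ this (by rw [e1]; ring)
  simp only [G2Point.gauge, this]

lemma IsOct.smul_mul_inv_smul (h : IsOct S) {c : ℝ} (hc : c ≠ 0) (A B : Oct V) :
    S.mul (c • A) (S.inv (c • B)) = S.mul A (S.inv B) := by
  have : S.inv (c • B) = c⁻¹ • S.inv B := by
    have e : oconj (c • B) = c • oconj B := by simp [oconj]
    rw [G2Point.inv, G2Point.inv, h.normSq_smul, e, smul_smul, smul_smul]
    congr 1
    field_simp
  rw [this, h.smul_mul, h.mul_smul, smul_smul, mul_inv_cancel₀ hc, one_smul]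

end Pointwise

variable {M : Type*} [TopologicalSpace M] [ChartedSpace E7 M] [IsManifold (𝓡 7) ∞ M]

lemma SmoothOct.smul {A : OctField M} (hA : SmoothOct A) {f : M → ℝ}
    (hf : ContMDiff (𝓡 7) 𝓘(ℝ) ∞ f) : SmoothOct (fun q => f q • A q) :=
  ⟨hf.mul hA.1, ContMDiff.smul_section hf hA.2⟩

lemma SmoothOct.normSq {A : OctField M} (hA : SmoothOct A) (g : Metric7 M) (φ : FormField M 3) :
    ContMDiff (𝓡 7) 𝓘(ℝ) ∞ (fun q => (g2 g φ q).normSq (A q)) := by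
  have h1 : ContMDiff (𝓡 7) 𝓘(ℝ) ∞ (fun q => g.inner q (A q).2 (A q).2) := by
    have := ContMDiff.clm_bundle_apply₂ (F₁ := E7) (F₂ := E7) (F₃ := ℝ) g.contMDiff hA.2 hA.2
    intro q
    have hq := this q
    rw [Bundle.contMDiffAt_totalSpace] at hq
    exact hq.2
  exact (hA.1.pow 2).add h1

namespace IsG2Structure

variable {g : Metric7 M} {φ : FormField M 3} (hφ : IsG2Structure g φ)
  {X Y : OctField M}
include hφ

/-- The four conditions are invariant under a common rescaling. -/
lemma conditions_smul_iff (hX : ∀ q, X q ≠ 0) (hY : ∀ q, Y q ≠ 0) {f : M → ℝ} (hf : ∀ q, f q ≠ 0)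
    (G : FormField M 4) (Δ : M → ℝ) (l1 l2 μ : ℝ) :
    Conditions g φ G Δ l1 l2 μ (fun q => f q • X q) (fun q => f q • Y q) ↔
      Conditions g φ G Δ l1 l2 μ X Y := by
  have e1 : ∀ A : OctField M, (∀ q, A q ≠ 0) →
      g2gauge g φ (fun q => f q • A q) = g2gauge g φ A := fun A hA =>
    funext fun q => (hφ.isG2 q).gauge_smul (hf q) (hA q)
  have e2 : quot g φ (fun q => f q • X q) (fun q => f q • Y q) = quot g φ X Y :=
    funext fun q => (hφ.isG2 q).smul_mul_inv_smul (hf q) _ _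
  simp only [Conditions, Cond1, Cond23, Cond4, e1 X hX, e1 Y hY, e2]

lemma exists_isKilling_iff {G : FormField M 4} {Δ : M → ℝ} (hΔ : ContMDiff (𝓡 7) 𝓘(ℝ) ∞ Δ)
    (l1 l2 μ : ℝ) :
    (∃ X Y : OctField M, IsNonvanishing X ∧ IsNonvanishing Y ∧
      IsKilling g φ G Δ ⟨l1, l2⟩ μ X Y) ↔
    ∃ X Y : OctField M, IsNonvanishing X ∧ IsNonvanishing Y ∧
      Conditions g φ G Δ l1 l2 μ X Y := by
  constructor
  · rintro ⟨X, Y, hX, hY, h⟩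
    exact ⟨X, Y, hX, hY, ((hφ.isKilling_iff hX hY hΔ G l1 l2 μ).1 h).1⟩
  rintro ⟨X, Y, hX, hY, h⟩
  let N : M → ℝ := fun q => (g2 g φ q).normSq (X q) + (g2 g φ q).normSq (Y q)
  have hN : ContMDiff (𝓡 7) 𝓘(ℝ) ∞ N := (hX.1.normSq g φ).add (hY.1.normSq g φ)
  have hpos : ∀ q, 0 < N q := fun q =>
    add_pos ((hφ.isG2 q).normSq_pos (hX.2 q)) ((hφ.isG2 q).normSq_pos (hY.2 q))
  -- With f² = e^Δ/(|X|² + |Y|²) the rescaled sections satisfy e^{-Δ}(|fX|² + |fY|²) = 1; f is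
  -- smooth because its radicand is positive.
  let f : M → ℝ := fun q => Real.sqrt (Real.exp (Δ q) * (N q)⁻¹)
  have hfp : ∀ q, 0 < Real.exp (Δ q) * (N q)⁻¹ := fun q =>
    mul_pos (Real.exp_pos _) (inv_pos.2 (hpos q))
  have hf0 : ∀ q, f q ≠ 0 := fun q => (Real.sqrt_pos.2 (hfp q)).ne'
  have hexp : ContMDiff (𝓡 7) 𝓘(ℝ) ∞ (fun q => Real.exp (Δ q)) :=
    Real.contDiff_exp.contMDiff.comp hΔ
  have hinv : ContMDiff (𝓡 7) 𝓘(ℝ) ∞ (fun q => (N q)⁻¹) := fun q =>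
    ContMDiffAt.comp (I' := 𝓘(ℝ)) q (contDiffAt_inv ℝ (hpos q).ne').contMDiffAt (hN q)
  have hf : ContMDiff (𝓡 7) 𝓘(ℝ) ∞ f := fun q =>
    ContMDiffAt.comp (I' := 𝓘(ℝ)) q (Real.contDiffAt_sqrt (hfp q).ne').contMDiffAt
      ((hexp.mul hinv) q)
  have hX' : IsNonvanishing (fun q => f q • X q) :=
    ⟨hX.1.smul hf, fun q => smul_ne_zero (hf0 q) (hX.2 q)⟩
  have hY' : IsNonvanishing (fun q => f q • Y q) :=
    ⟨hY.1.smul hf, fun q => smul_ne_zero (hf0 q) (hY.2 q)⟩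
  refine ⟨_, _, hX', hY', (hφ.isKilling_iff hX' hY' hΔ G l1 l2 μ).2
    ⟨(hφ.conditions_smul_iff hX.2 hY.2 hf0 G Δ l1 l2 μ).2 h, fun p => ?_⟩⟩
  have hone : (fun q => Real.exp (-Δ q) *
      ((g2 g φ q).normSq (f q • X q) + (g2 g φ q).normSq (f q • Y q))) = fun _ => (1 : ℝ) := by
    funext q
    have hq := (hφ.isG2 q).toIsOct
    have hE := (Real.exp_pos (Δ q)).ne'
    rw [hq.normSq_smul, hq.normSq_smul, ← _root_.mul_add, Real.sq_sqrt (hfp q).le, Real.exp_neg]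
    change _ * (_ * (N q)⁻¹ * N q) = 1
    have := (hpos q).ne'
    field_simp
  rw [hone, mvfderiv_const]

end IsG2Structure
end OctKilling
end

theorem mainTheorem3 {M : Type*} [TopologicalSpace M]
    [ChartedSpace (EuclideanSpace ℝ (Fin 7)) M] [IsManifold (𝓡 7) ∞ M]
    (g : OctKilling.Metric7 M) (φ : OctKilling.FormField M 3) (hφ : OctKilling.IsG2Structure g φ)
    (G : OctKilling.FormField M 4) (hG : OctKilling.SmoothForm G)
    (Δ : M → ℝ) (hΔ : ContMDiff (𝓡 7) 𝓘(ℝ) ∞ Δ) (l1 l2 μ : ℝ) :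
    ((∃ X Y : OctKilling.OctField M,
        OctKilling.IsNonvanishing X ∧ OctKilling.IsNonvanishing Y ∧
          OctKilling.IsKilling g φ G Δ ⟨l1, l2⟩ μ X Y) ↔
      ∃ X Y : OctKilling.OctField M,
        OctKilling.IsNonvanishing X ∧ OctKilling.IsNonvanishing Y ∧
          OctKilling.Conditions g φ G Δ l1 l2 μ X Y) ∧
    ∀ X Y : OctKilling.OctField M,
      OctKilling.IsNonvanishing X → OctKilling.IsNonvanishing Y →
        (OctKilling.IsKilling g φ G Δ ⟨l1, l2⟩ μ X Y ↔
          OctKilling.Conditions g φ G Δ l1 l2 μ X Y ∧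
            ∀ p, mvfderiv (𝓡 7) (fun q => Real.exp (-Δ q) *
              ((OctKilling.g2 g φ q).normSq (X q) + (OctKilling.g2 g φ q).normSq (Y q))) p = 0) :=
  ⟨hφ.exists_isKilling_iff hΔ l1 l2 μ,
    fun _ _ hX hY => hφ.isKilling_iff hX hY hΔ G l1 l2 μ⟩
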